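/- **Setting.** For a finite set $V$ of quantum variables $r_0,r_1,\dots$ let $\mathcal H(V)$ be the Hilbert space of functions $\{0,1\}^V\to\mathbb C$, with standard basis vectors $|f\rangle$, $f\in\{0,1\}^V$. A complex number is in $\mathbf P\mathbb C$ if its real and imaginary parts are polynomial-time computable reals; a unitary operator on $\mathbb C^{2^n}$ (an $n$-qubit gate) is computable if it maps vectors with entries in $\mathbf P\mathbb C$ to such vectors. Fix an effective enumeration $(\mathbf U_i)_{i\in\mathbb N}$ of all computable unitary operators (only the computability of $i\mapsto$ number of qubits of $\mathbf U_i$ is needed). For an $n$-qubit gate $U$ and distinct $q_1,\dots,q_n\in V$, $U_{\langle\langle q_1,\dots,q_n\rangle\rangle}$ is the operator on $\mathcal H(V)$ acting as $U$ on $q_1,\dots,q_n$ (in this order) and as the identity on the other variables. *Terms* (modulo $\alpha$-conversion) of the Q-calculus: $$M::=x\mid r\mid\, !M\mid 0\mid 1\mid U_i\mid \mathtt{new}(M)\mid M_1M_2\mid\langle M_1,\dots,M_n\rangle\mid\lambda!x.M\mid\lambda\pi.M,\qquad \pi::=x\mid\langle x_1,\dots,x_n\rangle,\quad n\ge2,$$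 with $x,x_j$ classical and $r$ quantum variables. Environments are multisets $\Gamma$ of patterns $\pi$, banged variables $!x$ and quantum variables, in which each variable name occurs at most once. Judgements are derived by: $\vdash C$ for $C\in\{0,1,U_i\}$; $r\vdash r$; $x\vdash x$; from $\Gamma\vdash M$ infer $\Gamma,!x\vdash M$; from $\Gamma,!x,!y\vdash M$ infer $\Gamma,!z\vdash M\{z/x,z/y\}$; from $!x_1,\dots,!x_k\vdash M$ infer $!x_1,\dots,!x_k\vdash\,!M$; from $\Gamma,x\vdash M$ infer $\Gamma,!x\vdash M$; from $\Gamma,x_1,\dots,x_k\vdash M$ infer $\Gamma,\langle x_1,\dots,x_k\rangle\vdash M$; from $\Gamma_i\vdash M_i$ ($1\le i\le k$) infer $\Gamma_1,\dots,\Gamma_k\vdash\langle M_1,\dots,M_k\rangle$; from $\Gamma\vdash M$ infer $\Gamma\vdash\mathtt{new}(M)$; from $\Gamma,\pi\vdash M$ infer $\Gamma\vdash\lambda\pi.M$; from $\Gamma,!x\vdash M$ infer $\Gamma\vdash\lambda!x.M$; from $\Gamma_1\vdash M_1$ and $\Gamma_2\vdash M_2$ infer $\Gamma_1,\Gamma_2\vdash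 M_1M_2$. A term $M$ is *well formed* if $\Theta\vdash M$ is derivable, where $\Theta$ consists of the quantum variables occurring in $M$. *Configurations* are triples $[Q,V,M]$, with $V$ a finite set of quantum variables containing those of $M$ and $Q\in\mathcal H(V)$, modulo bijective renaming of the quantum variables in $V$. Reduction $\to$ on well-formed configurations (those for which $\Gamma\vdash M$ is derivable for some $\Gamma$) is the closure, under all term contexts except those of the form $!M$, of - $[Q,V,U_i\langle q_1,\dots,q_n\rangle]\to[(\mathbf U_i)_{\langle\langle q_1,\dots,q_n\rangle\rangle}Q,V,\langle q_1,\dots,q_n\rangle]$ for $\mathbf U_i$ an $n$-qubit gate and quantum variables $q_j$; - $[Q,V,\mathtt{new}(c)]\to[Q\otimes|r\mapsto c\rangle,V\cup\{r\},r]$ for $c\in\{0,1\}$ and $r\notin V$; - leaving $Q,V$ unchanged: $(\lambda x.M)N\to M\{N/x\}$; $(\lambda\langle x_1,\dots,x_n\rangle.M)\langle q_1,\dots,q_n\rangle\to M\{q_1/x_1,\dots,q_n/x_n\}$ for quantum variables $q_j$; $(\lambda!x.M)\,!N\to M\{N/x\}$; $L((\lambda\pi.M)N)\to(\lambda\pi.LM)N$;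 $((\lambda\pi.M)N)L\to(\lambda\pi.ML)N$. $C\Downarrow D$ means that $C$ reduces to $D$ in finitely many steps and $D$ is in normal form. $[Q,M]$ denotes $[Q,V,M]$ with $V$ the set of quantum variables of $M$; $1\in\mathcal H(\emptyset)$ is the constant $1$. Lists are encoded by $[\,]=\lambda!x.\lambda!y.y$ and $[M,M_1,\dots,M_n]=\lambda!x.\lambda!y.\,x\,M\,[M_1,\dots,M_n]$. A term $M$ is *quantum relevant* if it is well formed (and contains no quantum variable, so that the initial configurations below make sense) and for each list of bits $c_1,\dots,c_n$ ($n\ge0$) there are $m$ and $Q$ with $[1,M\,![!c_1,\dots,!c_n]]\Downarrow[Q,[r_1,\dots,r_m]]$. For a set $\mathcal G$ of computable gates, a *$V$-circuit based on $\mathcal G$* is a finite (possibly empty) sequence $K$ of gates of $\mathcal G$ (given by indices in the enumeration), each with a list of distinct variables of $V$, as many as the gate has qubits; $U_K$ is the composition on $\mathcal H(V)$ of the corresponding operators, the first gate being applied first. Let $(\mathbf K_i)_{i\in\mathbb N}$ be the standard effective enumeration of circuits (the sequence with code $i$ if it is a circuit, and the empty circuit otherwise). A *circuit family* generated by $\mathcal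 G$ is a triple $(f,g,h)$ of total computable functions $f,h:\mathbb N\to\mathbb N$, $g:\mathbb N^2\to\mathbb N$ such that $g(n,i)\le n+1$ whenever $1\le i\le f(n)$, and $\mathbf K_{h(n)}$ is an $\{r_1,\dots,r_{f(n)}\}$-circuit based on $\mathcal G$ for every $n$. It is *finitely generated* if $\mathcal G$ can be chosen finite. **Theorem.** For each quantum relevant term $M$ there is a (finitely generated) quantum circuit family $(f,g,h)$ such that for every list of bits $c_1,\dots,c_n$, every $m$ and every $Q$: if $[1,M\,![!c_1,\dots,!c_n]]\Downarrow[Q,[r_1,\dots,r_m]]$, then $m=f(n)$ and $$Q=U_{\mathbf K_{h(n)}}\bigl(|r_1\mapsto c_{g(n,1)},\dots,r_{f(n)}\mapsto c_{g(n,f(n))}\rangle\bigr),$$ where $c_0=0$ and $c_{n+1}=1$. -/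

import Mathlib

/-!
The Q-calculus (an untyped linear lambda calculus with classical control and quantum data), its
configurations and reduction, quantum relevant terms, and finitely generated families of quantum
circuits.
-/

namespace QCalc

/-! ### Hilbert spaces on sets of quantum variables -/

/-- The Hilbert space `H(V) = {φ : {0,1}^V → ℂ}` on a finite set `V` of quantum variables
(the quantum variable `r_i` is represented by the number `i`). -/
abbrev Reg (V : Finset ℕ) : Type := (V → Bool) → ℂ

/-- The standard basis vector `|f⟩`. -/
def ket {V : Finset ℕ} (f : V → Bool) : Reg V := fun f' => if f' = f then 1 else 0

/-- `φ ⊗ |r ↦ b⟩`, as an element of `H(V ∪ {r})` (used for `r ∉ V`). -/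
def Reg.adjoin {V : Finset ℕ} (φ : Reg V) (r : ℕ) (b : Bool) : Reg (insert r V) := fun f =>
  if f ⟨r, Finset.mem_insert_self r V⟩ = b then
    φ (fun v => f ⟨v.1, Finset.mem_insert_of_mem v.2⟩)
  else 0

/-- The operator `U_{⟨⟨r_1,…,r_n⟩⟩}` on `H(V)`: it acts as `U` on the variables `r_1,…,r_n`, taken
in this order, and as the identity on the other variables (used for distinct `r_1,…,r_n`).
The space `ℂ^{2^n}` is indexed by the binary strings of length `n`. In the sum,
`Function.extend r b f` is `f` with the value at `r_j` replaced by `b_j`. -/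
noncomputable def applyAt {n : ℕ} (U : Matrix (Fin n → Bool) (Fin n → Bool) ℂ)
    {V : Finset ℕ} (r : Fin n → V) (φ : Reg V) : Reg V := fun f =>
  ∑ b : Fin n → Bool, U (fun j => f (r j)) b * φ (Function.extend r b f)

/-! ### Computable unitary operators and their enumeration -/

/-- Binary representation of an integer: a sign bit followed by the binary digits. -/
def encodeInt (z : ℤ) : List Bool := decide (z < 0) :: Computability.encodeNat z.natAbs

/-- Polynomial-time computable real numbers: some deterministic polynomial-time machine computes on
input `1^n` an integer `m` with `|m / 2^n - x| ≤ 1 / 2^n`. -/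
def PolyReal (x : ℝ) : Prop :=
  ∃ a : ℕ → ℤ,
    Nonempty (Turing.TM2ComputableInPolyTime Computability.unaryEncodeNat encodeInt a) ∧
    ∀ n : ℕ, |(a n : ℝ) / 2 ^ n - x| ≤ 1 / 2 ^ n

/-- Polynomial-time computable complex numbers. -/
def PolyComplex (z : ℂ) : Prop := PolyReal z.re ∧ PolyReal z.im

/-- A qubit gate: a number `n` and a unitary operator on `ℂ^{2^n}`. -/
abbrev Gate : Type := Σ n : ℕ, Matrix.unitaryGroup (Fin n → Bool) ℂ

/-- A unitary operator is computable if it maps vectors with polynomial-time computable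
coordinates to such vectors. -/
def Gate.IsComputable (G : Gate) : Prop :=
  ∀ v : (Fin G.1 → Bool) → ℂ, (∀ b, PolyComplex (v b)) →
    ∀ b, PolyComplex ((G.2 : Matrix (Fin G.1 → Bool) (Fin G.1 → Bool) ℂ).mulVec v b)

/-- An enumeration `(U_i)` of the set of all computable unitary operators. The only effectiveness
that is asked for is that the number of qubits of `U_i` is a computable function of `i`; so every
effective enumeration is covered. -/
structure GateEnum where
  op : ℕ → Gate
  range_op : Set.range op = {G : Gate | G.IsComputable}
  computable_arity : Computable fun i => (op i).1

/-- The number of qubits of `U_i`. -/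
def GateEnum.arity (E : GateEnum) (i : ℕ) : ℕ := (E.op i).1

/-- `U_i` as a matrix. -/
def GateEnum.mat (E : GateEnum) (i : ℕ) :
    Matrix (Fin (E.arity i) → Bool) (Fin (E.arity i) → Bool) ℂ :=
  ((E.op i).2 : Matrix (Fin (E.op i).1 → Bool) (Fin (E.op i).1 → Bool) ℂ)

/-! ### Terms, up to renaming of bound variables -/

/-- The three forms of abstraction: `λ!x.M`, `λx.M`, and `λ⟨x_1,…,x_n⟩.M`. -/
inductive Binder : Type
  | bang
  | lin
  | tup (n : ℕ)

/-- The number of bound variables. -/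
def Binder.width : Binder → ℕ
  | .bang => 1
  | .lin => 1
  | .tup n => n

/-- Terms modulo `α`-conversion, in de Bruijn form: a binder of width `k` binds the indices
`0,…,k-1` of its body, and an index that is free at top level stands for the classical variable
of that number. `gate i` is the symbol of the unitary operator `U_i`. The restriction `n ≥ 2` on
tuples and tuple patterns is part of well-formedness. -/
inductive Term : Type
  | var (i : ℕ)
  | qvar (r : ℕ)
  | bang (M : Term)
  | bit (b : Bool)
  | gate (i : ℕ)
  | new (M : Term)
  | app (M N : Term)
  | tuple (n : ℕ) (Ms : Fin n → Term)
  | lam (p : Binder) (M : Term)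

namespace Term

/-- The set of quantum variables occurring in a term. -/
def qvars : Term → Finset ℕ
  | var _ => ∅
  | qvar r => {r}
  | bang M => M.qvars
  | bit _ => ∅
  | gate _ => ∅
  | new M => M.qvars
  | app M N => M.qvars ∪ N.qvars
  | tuple _ Ms => Finset.univ.biUnion fun i => (Ms i).qvars
  | lam _ M => M.qvars

/-- Replace the quantum variables of a term according to `θ`. -/
def mapQ (θ : ℕ → ℕ) : Term → Term
  | var i => var i
  | qvar r => qvar (θ r)
  | bang M => bang (M.mapQ θ)
  | bit b => bit b
  | gate i => gate i
  | new M => new (M.mapQ θ)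
  | app M N => app (M.mapQ θ) (N.mapQ θ)
  | tuple n Ms => tuple n fun i => (Ms i).mapQ θ
  | lam p M => lam p (M.mapQ θ)

/-- Rename the free classical variables according to `ρ`. -/
def rename (ρ : ℕ → ℕ) : Term → Term
  | var i => var (ρ i)
  | qvar r => qvar r
  | bang M => bang (M.rename ρ)
  | bit b => bit b
  | gate i => gate i
  | new M => new (M.rename ρ)
  | app M N => app (M.rename ρ) (N.rename ρ)
  | tuple n Ms => tuple n fun i => (Ms i).rename ρ
  | lam p M => lam p
      (M.rename fun i => if i < p.width then i else ρ (i - p.width) + p.width)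

/-- Weakening of a term under `k` additional binders. -/
def shift (k : ℕ) (M : Term) : Term := M.rename (· + k)

/-- Simultaneous capture-avoiding substitution for the free classical variables. -/
def subst (σ : ℕ → Term) : Term → Term
  | var i => σ i
  | qvar r => qvar r
  | bang M => bang (M.subst σ)
  | bit b => bit b
  | gate i => gate i
  | new M => new (M.subst σ)
  | app M N => app (M.subst σ) (N.subst σ)
  | tuple n Ms => tuple n fun i => (Ms i).subst σ
  | lam p M => lam p
      (M.subst fun i => if i < p.width then var i else (σ (i - p.width)).shift p.width)

/-- Substitute `N_0,…,N_{k-1}` for the `k` variables bound by a removed binder. -/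
def inst {k : ℕ} (Ns : Fin k → Term) (M : Term) : Term :=
  M.subst fun i => if h : i < k then Ns ⟨i, h⟩ else var (i - k)

/-- The body of the abstraction that binds the named classical variables `xs` in `M`. -/
def bindVars (xs : List ℕ) (M : Term) : Term :=
  M.rename fun y => if y ∈ xs then xs.idxOf y else y + xs.length

/-- The encoding of lists: `[] = λ!x.λ!y.y` and `[M, M_1, …] = λ!x.λ!y.x M [M_1, …]`. -/
def list : List Term → Term
  | [] => lam .bang (lam .bang (var 0))
  | M :: Ms => lam .bang (lam .bang (app (app (var 1) (M.shift 2)) ((list Ms).shift 2)))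

end Term

/-! ### Well-formed terms -/

/-- The members of an environment: a variable pattern `x`, a tuple pattern `⟨x_1,…,x_n⟩`, a banged
variable `!x`, or a quantum variable `r`. -/
inductive Item : Type
  | var (x : ℕ)
  | pat (xs : List ℕ)
  | bang (x : ℕ)
  | qvar (r : ℕ)

/-- The names in an item: classical on the left, quantum on the right. -/
def Item.names : Item → Multiset (ℕ ⊕ ℕ)
  | .var x => {Sum.inl x}
  | .pat xs => (xs : Multiset ℕ).map Sum.inl
  | .bang x => {Sum.inl x}
  | .qvar r => {Sum.inr r}

/-- Environments are multisets of items; see `Env.Valid`. -/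
abbrev Env : Type := Multiset Item

/-- Each variable name occurs at most once in the environment. -/
def Env.Valid (Γ : Env) : Prop := (Γ.bind Item.names).Nodup

/-- `WF Γ M`: the judgement `Γ ⊢ M` is derivable by the well-forming rules. -/
inductive WF : Env → Term → Prop
  | bit (b : Bool) : WF 0 (.bit b)
  | gate (i : ℕ) : WF 0 (.gate i)
  | qvar (r : ℕ) : WF {.qvar r} (.qvar r)
  | var (x : ℕ) : WF {.var x} (.var x)
  | weak {Γ : Env} {M : Term} (x : ℕ) :
      WF Γ M → (Γ + {.bang x}).Valid → WF (Γ + {.bang x}) M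
  | contr {Γ : Env} {M : Term} (x y z : ℕ) :
      WF (Γ + {.bang x} + {.bang y}) M → (Γ + {.bang z}).Valid →
      WF (Γ + {.bang z}) (M.rename fun i => if i = x ∨ i = y then z else i)
  | prom {M : Term} (xs : Multiset ℕ) :
      WF (xs.map Item.bang) M → WF (xs.map Item.bang) (.bang M)
  | der {Γ : Env} {M : Term} (x : ℕ) :
      WF (Γ + {.var x}) M → WF (Γ + {.bang x}) M
  | tensL {Γ : Env} {M : Term} (xs : List ℕ) (hxs : 2 ≤ xs.length) :
      WF (Γ + ((xs.map Item.var : List Item) : Multiset Item)) M → WF (Γ + {.pat xs}) M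
  | tensR {k : ℕ} (hk : 2 ≤ k) (Γ : Fin k → Env) (Ms : Fin k → Term) :
      (∀ i, WF (Γ i) (Ms i)) → Env.Valid (∑ i, Γ i) → WF (∑ i, Γ i) (.tuple k Ms)
  | new {Γ : Env} {M : Term} : WF Γ M → WF Γ (.new M)
  | lamVar {Γ : Env} {M : Term} (x : ℕ) :
      WF (Γ + {.var x}) M → WF Γ (.lam .lin (M.bindVars [x]))
  | lamPat {Γ : Env} {M : Term} (xs : List ℕ) :
      WF (Γ + {.pat xs}) M → WF Γ (.lam (.tup xs.length) (M.bindVars xs))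
  | lamBang {Γ : Env} {M : Term} (x : ℕ) :
      WF (Γ + {.bang x}) M → WF Γ (.lam .bang (M.bindVars [x]))
  | app {Γ₁ Γ₂ : Env} {M₁ M₂ : Term} :
      WF Γ₁ M₁ → WF Γ₂ M₂ → (Γ₁ + Γ₂).Valid → WF (Γ₁ + Γ₂) (.app M₁ M₂)

/-- A term `M` is well formed if `M` is well formed with respect to the environment of the quantum
variables occurring in it. -/
def Term.WellFormed (M : Term) : Prop := WF (M.qvars.val.map Item.qvar) M

/-! ### Configurations -/

/-- Preconfigurations `[Q, QV, M]`. -/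
structure PreConf where
  QV : Finset ℕ
  reg : Reg QV
  term : Term
  qvars_subset : term.qvars ⊆ QV

/-- The extension of a map between sets of quantum variables by the identity. -/
def extendMap {V W : Finset ℕ} (θ : V → W) (r : ℕ) : ℕ := if h : r ∈ V then θ ⟨r, h⟩ else r

/-- Two preconfigurations are equivalent if a bijection between their sets of quantum variables
carries the vector and the term of the one to those of the other. -/
def PreConf.Equiv (C D : PreConf) : Prop :=
  ∃ θ : C.QV ≃ D.QV, (D.reg = fun f => C.reg (f ∘ θ)) ∧ D.term = C.term.mapQ (extendMap θ)

theorem Term.mapQ_eq_self {θ : ℕ → ℕ} {M : Term} (h : ∀ r ∈ M.qvars, θ r = r) :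
    M.mapQ θ = M := by
  induction M with
  | var i => rfl
  | qvar r => simp [Term.mapQ, h r (by simp [Term.qvars])]
  | bang M ih => simp [Term.mapQ, ih h]
  | bit b => rfl
  | gate i => rfl
  | new M ih => simp [Term.mapQ, ih h]
  | app M N ihM ihN =>
    simp only [Term.mapQ]
    rw [ihM fun r hr => h r (by simp [Term.qvars, hr]),
      ihN fun r hr => h r (by simp [Term.qvars, hr])]
  | tuple n Ms ih =>
    simp only [Term.mapQ]
    congr 1
    funext i
    exact ih i fun r hr => h r (by simp only [Term.qvars, Finset.mem_biUnion]; exact ⟨i, by simp, hr⟩)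
  | lam p M ih => simp [Term.mapQ, ih h]

theorem Term.mapQ_mapQ (θ η : ℕ → ℕ) (M : Term) :
    (M.mapQ θ).mapQ η = M.mapQ (fun r => η (θ r)) := by
  induction M with
  | var i => rfl
  | qvar r => rfl
  | bang M ih => simp [Term.mapQ, ih]
  | bit b => rfl
  | gate i => rfl
  | new M ih => simp [Term.mapQ, ih]
  | app M N ihM ihN => simp [Term.mapQ, ihM, ihN]
  | tuple n Ms ih => simp [Term.mapQ, ih]
  | lam p M ih => simp [Term.mapQ, ih]

theorem Term.mapQ_congr {θ η : ℕ → ℕ} {M : Term} (h : ∀ r ∈ M.qvars, θ r = η r) :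
    M.mapQ θ = M.mapQ η := by
  induction M with
  | var i => rfl
  | qvar r => simp [Term.mapQ, h r (by simp [Term.qvars])]
  | bang M ih => simp [Term.mapQ, ih h]
  | bit b => rfl
  | gate i => rfl
  | new M ih => simp [Term.mapQ, ih h]
  | app M N ihM ihN =>
    simp only [Term.mapQ]
    rw [ihM fun r hr => h r (by simp [Term.qvars, hr]),
      ihN fun r hr => h r (by simp [Term.qvars, hr])]
  | tuple n Ms ih =>
    simp only [Term.mapQ]
    congr 1
    funext i
    exact ih i fun r hr => h r (by simp only [Term.qvars, Finset.mem_biUnion]; exact ⟨i, by simp, hr⟩)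
  | lam p M ih => simp [Term.mapQ, ih h]

theorem PreConf.Equiv.refl (C : PreConf) : C.Equiv C := by
  refine ⟨_root_.Equiv.refl _, rfl, (Term.mapQ_eq_self fun r _ => ?_).symm⟩
  simp [extendMap]

theorem PreConf.Equiv.symm {C D : PreConf} (h : C.Equiv D) : D.Equiv C := by
  obtain ⟨θ, h1, h2⟩ := h
  refine ⟨θ.symm, ?_, ?_⟩
  · rw [h1]
    funext f
    congr 1
    funext v
    simp
  · rw [h2, Term.mapQ_mapQ]
    refine (Term.mapQ_eq_self fun r hr => ?_).symm
    have hr' := C.qvars_subset hr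
    simp [extendMap, hr']

theorem PreConf.Equiv.trans {C D F : PreConf} (h : C.Equiv D) (h' : D.Equiv F) : C.Equiv F := by
  obtain ⟨θ, h1, h2⟩ := h
  obtain ⟨η, h3, h4⟩ := h'
  refine ⟨θ.trans η, ?_, ?_⟩
  · rw [h3, h1]
    rfl
  · rw [h4, h2, Term.mapQ_mapQ]
    refine Term.mapQ_congr fun r hr => ?_
    have hr' := C.qvars_subset hr
    simp [extendMap, hr']

/-- Equivalence of preconfigurations as a setoid. -/
def PreConf.setoid : Setoid PreConf :=
  ⟨PreConf.Equiv, PreConf.Equiv.refl, PreConf.Equiv.symm, PreConf.Equiv.trans⟩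

/-- Configurations: preconfigurations modulo equivalence. -/
abbrev Conf : Type := Quotient PreConf.setoid

/-- The configuration of a preconfiguration. -/
abbrev PreConf.conf (C : PreConf) : Conf := Quotient.mk PreConf.setoid C

/-! ### Reduction -/

/-- One reduction step between preconfigurations, by any of the rules: the basic rules
`Uq`, `new`, `l.β`, `q.β`, `c.β`, `l.cm`, `r.cm`, closed under all contexts except those of the
form `!M`. The patterns `π` of the commuting rules and of `l.β`, `q.β` are not of the form `!x`.
That the reduced configuration is well formed is required in `Red`. -/
inductive Step (E : GateEnum) : PreConf → PreConf → Prop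
  | tuple {C D : PreConf} {n : ℕ} (Ms : Fin n → Term) (i : Fin n) (hi : Ms i = C.term) (hC hD) :
      Step E C D →
      Step E ⟨C.QV, C.reg, .tuple n Ms, hC⟩
        ⟨D.QV, D.reg, .tuple n (Function.update Ms i D.term), hD⟩
  | argR {C D : PreConf} (M : Term) (hC hD) : Step E C D →
      Step E ⟨C.QV, C.reg, .app M C.term, hC⟩ ⟨D.QV, D.reg, .app M D.term, hD⟩
  | argL {C D : PreConf} (N : Term) (hC hD) : Step E C D →
      Step E ⟨C.QV, C.reg, .app C.term N, hC⟩ ⟨D.QV, D.reg, .app D.term N, hD⟩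
  | inNew {C D : PreConf} (hC hD) : Step E C D →
      Step E ⟨C.QV, C.reg, .new C.term, hC⟩ ⟨D.QV, D.reg, .new D.term, hD⟩
  | inLam {C D : PreConf} (p : Binder) (hC hD) : Step E C D →
      Step E ⟨C.QV, C.reg, .lam p C.term, hC⟩ ⟨D.QV, D.reg, .lam p D.term, hD⟩
  | Uq {V : Finset ℕ} (φ : Reg V) (i : ℕ) (r : Fin (E.arity i) → V) (hC hD) :
      Step E ⟨V, φ, .app (.gate i) (.tuple (E.arity i) fun j => .qvar (r j)), hC⟩
        ⟨V, applyAt (E.mat i) r φ, .tuple (E.arity i) fun j => .qvar (r j), hD⟩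
  | new {V : Finset ℕ} (φ : Reg V) (b : Bool) (r : ℕ) (hr : r ∉ V) (hC hD) :
      Step E ⟨V, φ, .new (.bit b), hC⟩ ⟨insert r V, φ.adjoin r b, .qvar r, hD⟩
  | lBeta {V : Finset ℕ} (φ : Reg V) (M N : Term) (hC hD) :
      Step E ⟨V, φ, .app (.lam .lin M) N, hC⟩ ⟨V, φ, M.inst ![N], hD⟩
  | qBeta {V : Finset ℕ} (φ : Reg V) (n : ℕ) (M : Term) (r : Fin n → ℕ) (hC hD) :
      Step E ⟨V, φ, .app (.lam (.tup n) M) (.tuple n fun j => .qvar (r j)), hC⟩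
        ⟨V, φ, M.inst fun j => .qvar (r j), hD⟩
  | cBeta {V : Finset ℕ} (φ : Reg V) (M N : Term) (hC hD) :
      Step E ⟨V, φ, .app (.lam .bang M) (.bang N), hC⟩ ⟨V, φ, M.inst ![N], hD⟩
  | lCm {V : Finset ℕ} (φ : Reg V) (p : Binder) (hp : p ≠ .bang) (L M N : Term) (hC hD) :
      Step E ⟨V, φ, .app L (.app (.lam p M) N), hC⟩
        ⟨V, φ, .app (.lam p (.app (L.shift p.width) M)) N, hD⟩
  | rCm {V : Finset ℕ} (φ : Reg V) (p : Binder) (hp : p ≠ .bang) (L M N : Term) (hC hD) :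
      Step E ⟨V, φ, .app (.app (.lam p M) N) L, hC⟩
        ⟨V, φ, .app (.lam p (.app M (L.shift p.width))) N, hD⟩

/-- One reduction step `→` between configurations; the reduced configuration is well formed. -/
def Red (E : GateEnum) (c d : Conf) : Prop :=
  ∃ C D : PreConf, C.conf = c ∧ D.conf = d ∧ (∃ Γ : Env, WF Γ C.term) ∧ Step E C D

/-- `c ⇓ d`: `c` reduces to `d` in finitely many steps, and `d` is in normal form. -/
def Eval (E : GateEnum) (c d : Conf) : Prop :=
  Relation.ReflTransGen (Red E) c d ∧ ¬ ∃ e, Red E d e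

/-! ### Quantum relevant terms -/

/-- The quantum variables `r_1,…,r_m`. -/
def outVars (m : ℕ) : Finset ℕ := Finset.Icc 1 m

/-- The term `M ![!c_1,…,!c_n]`. -/
def applyInput (M : Term) (cs : List Bool) : Term :=
  .app M (.bang (.list (cs.map fun c => .bang (.bit c))))

/-- The term `[r_1,…,r_m]`. -/
def outList (m : ℕ) : Term := .list ((List.range' 1 m).map .qvar)

/-- `[1, M ![!c_1,…,!c_n]] ⇓ [Q, [r_1,…,r_m]]`. The initial configuration has the empty set of
quantum variables and the vector `1 ∈ H(∅)`, the final one has the set `{r_1,…,r_m}`; the inclusions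
`h` and `h'` say that these are preconfigurations. -/
def Computes (E : GateEnum) (M : Term) (cs : List Bool) (m : ℕ) (Q : Reg (outVars m)) : Prop :=
  ∃ (h : (applyInput M cs).qvars ⊆ ∅) (h' : (outList m).qvars ⊆ outVars m),
    Eval E (PreConf.conf ⟨∅, fun _ => 1, applyInput M cs, h⟩)
      (PreConf.conf ⟨outVars m, Q, outList m, h'⟩)

/-- Quantum relevant terms. -/
def QRel (E : GateEnum) (M : Term) : Prop :=
  M.WellFormed ∧ ∀ cs : List Bool, ∃ (m : ℕ) (Q : Reg (outVars m)), Computes E M cs m Q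

/-! ### Circuits -/

/-- Sequences `U_{i_1}, r^1_1, …, r^1_{n_1}, …, U_{i_k}, r^k_1, …, r^k_{n_k}`: each entry holds the
index of a gate in the enumeration and a list of quantum variables. -/
abbrev GateSeq : Type := List (ℕ × List ℕ)

/-- The sequence is a circuit: the gates are applied to the right number of distinct variables. -/
def IsCircuit (E : GateEnum) (K : GateSeq) : Prop :=
  ∀ a ∈ K, a.2.length = E.arity a.1 ∧ a.2.Nodup

/-- `K` is a `Λ`-circuit based on the set `𝒢` of gates. -/
def IsCircuitOn (E : GateEnum) (𝒢 : Set Gate) (Λ : Finset ℕ) (K : GateSeq) : Prop :=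
  IsCircuit E K ∧ ∀ a ∈ K, E.op a.1 ∈ 𝒢 ∧ ∀ r ∈ a.2, r ∈ Λ

open Classical in
/-- The action on `H(Λ)` of a gate and a list of variables (the identity if these do not fit). -/
noncomputable def applyGate (E : GateEnum) (Λ : Finset ℕ) (φ : Reg Λ) (a : ℕ × List ℕ) : Reg Λ :=
  if h : a.2.length = E.arity a.1 ∧ ∀ r ∈ a.2, r ∈ Λ then
    applyAt (E.mat a.1)
      (fun j => (⟨a.2.get (Fin.cast h.1.symm j), h.2 _ (List.get_mem _ _)⟩ : Λ)) φ
  else φ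

/-- The operator `U_K` on `H(Λ)`: the first gate of the sequence is applied first. -/
noncomputable def circuitOp (E : GateEnum) (Λ : Finset ℕ) (K : GateSeq) (φ : Reg Λ) : Reg Λ :=
  K.foldl (applyGate E Λ) φ

open Classical in
/-- The effective enumeration `(K_i)` of the quantum circuits: the sequence of code `i` if it is a
circuit, the empty circuit otherwise. -/
noncomputable def circuit (E : GateEnum) (i : ℕ) : GateSeq :=
  if IsCircuit E (Denumerable.ofNat GateSeq i) then Denumerable.ofNat GateSeq i else []

/-- `(f, g, h)` is a family of circuits generated by the set `𝒢` of (computable) gates. -/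
structure IsCircuitFamily (E : GateEnum) (𝒢 : Set Gate) (f : ℕ → ℕ) (g : ℕ → ℕ → ℕ) (h : ℕ → ℕ) :
    Prop where
  gates : ∀ G ∈ 𝒢, G.IsComputable
  computable_f : Computable f
  computable_g : Computable₂ g
  computable_h : Computable h
  g_le : ∀ n m, 1 ≤ m → m ≤ f n → g n m ≤ n + 1
  circuit_on : ∀ n, IsCircuitOn E 𝒢 (outVars (f n)) (circuit E (h n))

/-- `(f, g, h)` is a finitely generated family of circuits. -/
def IsFinGenCircuitFamily (E : GateEnum) (f : ℕ → ℕ) (g : ℕ → ℕ → ℕ) (h : ℕ → ℕ) : Prop :=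
  ∃ 𝒢 : Set Gate, 𝒢.Finite ∧ IsCircuitFamily E 𝒢 f g h

/-- The bit `c_i` of an input `c_1,…,c_n`, with `c_0 = 0` and `c_{n+1} = 1`. -/
def inputBit (cs : List Bool) : ℕ → Bool
  | 0 => false
  | i + 1 => cs.getD i true

end QCalc

/-! Computations never branch on the value of a bit: no rule inspects it, and `new` merely turns it
into a quantum variable. Hence all inputs of one length lead to the same creations of variables and
the same gates, up to the bits used for the creations, and these gates form the circuit. Three
obstacles remain: reduction is nondeterministic, configurations are taken modulo renaming, and the
circuit has to be found by a computable function.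

Reduction is replaced by a weak evaluation `Ev` of terms `Tm`, in which `new` and the formation of
tuples are constants and bits are numbers; an evaluation records the trace of created variables and
applied gates. The bridge is postponement (`St.expand`): if `C` reduces to `D` and `D` evaluates,
then so does `C`, with the same labels up to exchanging independent ones and up to one step left
under the λ of the value. Working backwards from the end of a reduction (`Chain.expand`), neither
confluence nor termination is needed. The final list is a λ-abstraction, so the computation is
placed in a context `observe` in which this list evaluates to an atom and no step can be left over.
Labels from separate subterms are independent by linearity: well-formed terms are linear (`WF.lin`),
and a weight that counts occurrences, doubly below `!`, is conserved as long as it is at most one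
(`Ev.lin_wt`, `St.lin_wt`), so that quantum variables are neither copied nor lost.

With canonical names for the created variables, evaluation (`EvC`) is deterministic, and each
evaluation of a renamed instance of a term is the image of the canonical evaluation of the term
itself (`Ev.canonical`). Applied to an input of `n` symbolic bits (`symRun`), this gives one trace
for all inputs of length `n`. Gates act on variables that are already available (`Ev.scoped`), so
the creations can be moved to the front (`Scoped.teq`). They prepare a basis vector, to which the
remaining gates are applied (`Computes.eq_circuitOp`). The number of outputs, the bit from which
each output is created, and the code of the list of gates are `f`, `g` and `h`. Only gates occurring
in the term are used, which are finitely many (`Ev.gatesIn`).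

For computability, canonical evaluation is presented as derivability in a primitive recursive system
of rules, so that derivations can be searched for. The search ends because quantum relevance, for
the input of `n` zeros, provides an evaluation. -/

namespace QCalc

/-! ### Terms with constants for tuples and creation, and their substitution calculus. -/

/-- Terms with symbolic bits and few constructors. An atom is a tag with a list of numbers (see the
abbreviations below); a binder is `0` for `λ!x`, `1` for `λx`, and `n + 2` for `λ⟨x_1,…,x_n⟩`. -/
inductive Tm : Type
  | var (i : ℕ)
  | atom (k : ℕ) (l : List ℕ)
  | bang (M : Tm)
  | app (M N : Tm)
  | lam (p : ℕ) (M : Tm)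

/-- The number of variables bound by a binder. -/
def bw : ℕ → ℕ
  | 0 => 1
  | 1 => 1
  | n + 2 => n

/-- Lifting of a renaming under `k` binders. -/
def up (k : ℕ) (ρ : ℕ → ℕ) : ℕ → ℕ := fun i => if i < k then i else ρ (i - k) + k

namespace Tm

abbrev qvar (r : ℕ) : Tm := atom 0 [r]
abbrev bit (j : ℕ) : Tm := atom 1 [j]
abbrev gate (i : ℕ) : Tm := atom 2 [i]
abbrev newC : Tm := atom 3 []
abbrev consC : Tm := atom 4 []
/-- The constant `consC` applied to an evaluated first component. -/
abbrev pcons (r : ℕ) : Tm := atom 5 [r]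
/-- An evaluated tuple of quantum variables. -/
abbrev tup (qs : List ℕ) : Tm := atom 6 qs

/-- The tuple of the given components. -/
def tree (l : List Tm) : Tm := l.foldr (fun M T => app (app consC M) T) (tup [])

def rename (ρ : ℕ → ℕ) : Tm → Tm
  | var i => var (ρ i)
  | atom k l => atom k l
  | bang M => bang (M.rename ρ)
  | app M N => app (M.rename ρ) (N.rename ρ)
  | lam p M => lam p (M.rename (up (bw p) ρ))

/-- Lifting of a substitution under `k` binders. -/
def ups (k : ℕ) (σ : ℕ → Tm) : ℕ → Tm := fun i =>
  if i < k then var i else (σ (i - k)).rename (· + k)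

def subst (σ : ℕ → Tm) : Tm → Tm
  | var i => σ i
  | atom k l => atom k l
  | bang M => bang (M.subst σ)
  | app M N => app (M.subst σ) (N.subst σ)
  | lam p M => lam p (M.subst (ups (bw p) σ))

/-- The substitution that instantiates the first variables by `Ns`. -/
def instS (Ns : List Tm) : ℕ → Tm := fun i => (Ns[i]?).getD (var (i - Ns.length))

def inst (Ns : List Tm) (M : Tm) : Tm := M.subst (instS Ns)

theorem up_comp (k : ℕ) (ρ ρ' : ℕ → ℕ) : up k (ρ' ∘ ρ) = up k ρ' ∘ up k ρ := by
  funext i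
  simp only [up, Function.comp]
  split <;> simp

theorem rename_rename (ρ ρ' : ℕ → ℕ) (M : Tm) :
    (M.rename ρ).rename ρ' = M.rename (ρ' ∘ ρ) := by
  induction M generalizing ρ ρ' with
  | lam p M ih => simp only [rename, ih, up_comp]
  | _ => simp_all [rename]

theorem up_add (k : ℕ) (ρ : ℕ → ℕ) : up k ρ ∘ (· + k) = (· + k) ∘ ρ := by
  funext i
  simp [up]

theorem rename_shift (k : ℕ) (ρ : ℕ → ℕ) (M : Tm) :
    (M.rename (· + k)).rename (up k ρ) = (M.rename ρ).rename (· + k) := by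
  rw [rename_rename, rename_rename, up_add]

theorem subst_rename (ρ : ℕ → ℕ) (σ : ℕ → Tm) (M : Tm) :
    (M.rename ρ).subst σ = M.subst (σ ∘ ρ) := by
  induction M generalizing ρ σ with
  | lam p M ih =>
    simp only [rename, subst, ih]
    congr 2
    funext i
    simp only [ups, up, Function.comp]
    split <;> simp
  | _ => simp_all [rename, subst]

theorem rename_subst (σ : ℕ → Tm) (ρ : ℕ → ℕ) (M : Tm) :
    (M.subst σ).rename ρ = M.subst (fun i => (σ i).rename ρ) := by
  induction M generalizing ρ σ with
  | lam p M ih =>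
    simp only [rename, subst, ih]
    congr 2
    funext i
    simp only [ups]
    split
    · simp [rename, up, *]
    · rw [rename_shift]
  | _ => simp_all [rename, subst]

theorem subst_shift (k : ℕ) (σ : ℕ → Tm) (M : Tm) :
    (M.rename (· + k)).subst (ups k σ) = (M.subst σ).rename (· + k) := by
  rw [subst_rename, rename_subst]
  congr 1
  funext i
  simp [ups]

theorem subst_subst (σ τ : ℕ → Tm) (M : Tm) :
    (M.subst σ).subst τ = M.subst (fun i => (σ i).subst τ) := by
  induction M generalizing σ τ with
  | lam p M ih =>
    simp only [subst, ih]
    congr 2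
    funext i
    simp only [ups]
    split
    · simp [subst, ups, *]
    · exact subst_shift _ _ _
  | _ => simp_all [subst]

theorem rename_eq_subst (ρ : ℕ → ℕ) (M : Tm) : M.rename ρ = M.subst (fun i => var (ρ i)) := by
  induction M generalizing ρ with
  | lam p M ih =>
    simp only [rename, subst, ih]
    congr 2
    funext i
    simp only [ups, up]
    split <;> simp [rename]
  | _ => simp_all [rename, subst]

theorem subst_var (M : Tm) : M.subst var = M := by
  induction M with
  | lam p M ih =>
    have h : ups (bw p) var = var := by
      funext i
      simp only [ups, rename]
      split
      · rfl
      · congr 1; omega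
    simp [subst, h, ih]
  | _ => simp_all [subst]

theorem shift_inst (Ns : List Tm) (M : Tm) : (M.rename (· + Ns.length)).inst Ns = M := by
  rw [inst, subst_rename]
  conv_rhs => rw [← subst_var M]
  congr 1
  funext i
  simp [instS]

/-- The substitution lemma. It makes contraction, evaluation and reduction stable under
substitution, so that a step in the body of a function survives the contraction of this function. -/
theorem inst_subst (Ns : List Tm) (σ : ℕ → Tm) (M : Tm) :
    (M.inst Ns).subst σ = (M.subst (ups Ns.length σ)).inst (Ns.map (subst σ)) := by
  rw [inst, inst, subst_subst, subst_subst]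
  congr 1
  funext i
  simp only [instS, ups]
  split
  · rename_i h
    simp [subst, h, instS]
  · rename_i h
    have h' := shift_inst (Ns.map (subst σ)) (σ (i - Ns.length))
    rw [List.length_map] at h'
    rw [List.getElem?_eq_none (by omega)]
    exact h'.symm

/-! ### Weights and linearity -/

/-- Lifting of a weight under `k` binders. -/
def low (k : ℕ) (ω : ℕ → ℕ) : ℕ → ℕ := fun i => if i < k then 0 else ω (i - k)

theorem low_single (k i : ℕ) : low k (Pi.single i 1) = Pi.single (i + k) 1 := by
  funext j
  simp only [low, Pi.single_apply]
  split
  · rw [if_neg (by omega)]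
  · congr 1
    apply propext
    omega

/-- The weight of a term for weights `ω` of the free classical variables and `κ` of the quantum
variables; occurrences below `!` count twice. -/
def wt (κ : ℕ → ℕ) (ω : ℕ → ℕ) : Tm → ℕ
  | var i => ω i
  | atom k l => if k = 0 ∨ k = 5 ∨ k = 6 then (l.map κ).sum else 0
  | bang M => 2 * M.wt κ ω
  | app M N => M.wt κ ω + N.wt κ ω
  | lam p M => M.wt κ (low (bw p) ω)

/-- The weight of the free variable `i`. -/
def occ (i : ℕ) (M : Tm) : ℕ := M.wt (fun _ => 0) (Pi.single i 1)

/-- Every variable bound by a binder other than `λ!x` occurs exactly once, and not below `!`. -/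
def Lin : Tm → Prop
  | var _ => True
  | atom _ _ => True
  | bang M => M.Lin
  | app M N => M.Lin ∧ N.Lin
  | lam p M => M.Lin ∧ (p ≠ 0 → ∀ i < bw p, M.occ i = 1)

theorem occ_lam (i p : ℕ) (M : Tm) : (lam p M).occ i = M.occ (i + bw p) := by
  simp only [occ, wt, low_single]

theorem wt_rename (κ ω : ℕ → ℕ) (ρ : ℕ → ℕ) (M : Tm) :
    (M.rename ρ).wt κ ω = M.wt κ (ω ∘ ρ) := by
  induction M generalizing ρ ω with
  | lam p M ih =>
    simp only [rename, wt, ih]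
    congr 1
    funext i
    simp only [up, low, Function.comp]
    split <;> simp
  | _ => simp_all [rename, wt]

/-- With `wt_smul`, this says that the weight is linear in the pair of `κ` and `ω`. The weight of an
instance can therefore be split into contributions of single variables, and classical and quantum
variables are counted by one and the same argument. -/
theorem wt_add (κ κ' ω ω' : ℕ → ℕ) (M : Tm) :
    M.wt (κ + κ') (ω + ω') = M.wt κ ω + M.wt κ' ω' := by
  induction M generalizing ω ω' with
  | var i => rfl
  | atom k l =>
    simp only [wt]
    split
    · rw [← List.sum_map_add]; rfl
    · rfl
  | bang M ih => simp only [wt, ih]; ring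
  | app M N ihM ihN => simp only [wt, ihM, ihN]; ring
  | lam p M ih =>
    simp only [wt]
    rw [← ih]
    congr 1
    funext i
    simp only [low, Pi.add_apply]
    split <;> simp

theorem wt_smul (c : ℕ) (κ ω : ℕ → ℕ) (M : Tm) :
    M.wt (fun i => c * κ i) (fun i => c * ω i) = c * M.wt κ ω := by
  induction M generalizing ω with
  | var i => rfl
  | atom k l =>
    simp only [wt]
    split
    · rw [List.sum_map_mul_left]
    · simp
  | bang M ih => simp only [wt, ih]; ring
  | app M N ihM ihN => simp only [wt, ihM, ihN]; ring
  | lam p M ih =>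
    simp only [wt]
    rw [← ih]
    congr 1
    funext i
    simp only [low]
    split <;> simp

theorem wt_zero (M : Tm) : M.wt (fun _ => 0) (fun _ => 0) = 0 := by
  have := M.wt_smul 0 (fun _ => 0) (fun _ => 0)
  simpa using this

/-- The weight of a substitution instance. -/
theorem wt_subst (κ ω : ℕ → ℕ) (σ : ℕ → Tm) (M : Tm) :
    (M.subst σ).wt κ ω = M.wt κ (fun i => (σ i).wt κ ω) := by
  induction M generalizing ω σ with
  | lam p M ih =>
    simp only [subst, wt, ih]
    congr 1
    funext i
    simp only [ups, low]
    split
    · simp [wt, low, *]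
    · rw [wt_rename]
      congr 1
      funext j
      simp [low, Function.comp]
  | _ => simp_all [subst, wt]

theorem wt_finset_sum {ι : Type} (s : Finset ι) (ω : ι → ℕ → ℕ) (M : Tm) :
    M.wt (fun _ => 0) (fun i => ∑ x ∈ s, ω x i) = ∑ x ∈ s, M.wt (fun _ => 0) (ω x) := by
  classical
  induction s using Finset.induction_on with
  | empty => simpa using M.wt_zero
  | insert a s ha ih =>
    simp only [Finset.sum_insert ha]
    rw [← ih, ← wt_add]
    rfl

/-- The weight of an instance, when the instantiated variables occur exactly once. -/
theorem wt_inst (κ ω : ℕ → ℕ) (Ns : List Tm) (M : Tm) :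
    (M.inst Ns).wt κ ω = M.wt κ (low Ns.length ω) +
      ∑ j : Fin Ns.length, (Ns[j]).wt κ ω * M.occ j := by
  -- The pulled-back weight is `ω` lifted past the instantiated variables, where it vanishes, plus a
  -- combination of point weights. Linearity turns the latter into the counts `occ j`.
  have h : (fun i => (instS Ns i).wt κ ω) =
      (low Ns.length ω) +
        fun i => ∑ j : Fin Ns.length, (Ns[j]).wt κ ω * (Pi.single (j : ℕ) 1 : ℕ → ℕ) i := by
    funext i
    simp only [Pi.add_apply, instS, low]
    split
    · rename_i h
      rw [Finset.sum_eq_single ⟨i, h⟩]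
      · simp [h]
      · intro j _ hj
        rw [Pi.single_eq_of_ne, mul_zero]
        intro h'
        exact hj (Fin.ext h'.symm)
      · simp
    · rename_i h
      rw [Finset.sum_eq_zero]
      · rw [List.getElem?_eq_none (by omega)]; rfl
      · intro j _
        rw [Pi.single_eq_of_ne, mul_zero]
        have := j.2
        omega
  rw [inst, wt_subst, h]
  have h0 := wt_add κ (fun _ => 0) (low Ns.length ω)
    (fun i => ∑ j : Fin Ns.length, (Ns[j]).wt κ ω * (Pi.single (j : ℕ) 1 : ℕ → ℕ) i) M
  rw [wt_finset_sum] at h0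
  refine h0.trans ?_
  congr 1
  refine Finset.sum_congr rfl fun j _ => ?_
  have := M.wt_smul ((Ns[j]).wt κ ω) (fun _ => 0) (Pi.single (j : ℕ) 1)
  simpa [occ] using this

theorem wt_inst_of_occ (κ ω : ℕ → ℕ) (Ns : List Tm) (M : Tm) (h : ∀ i < Ns.length, M.occ i = 1) :
    (M.inst Ns).wt κ ω = M.wt κ (low Ns.length ω) +
      (Ns.map (wt κ ω)).sum := by
  rw [wt_inst, ← Fin.sum_univ_getElem, ← Equiv.sum_comp (finCongr (List.length_map (wt κ ω)))]
  congr 1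
  refine Finset.sum_congr rfl fun j _ => ?_
  have hj : (j : ℕ) < Ns.length := by simpa using j.2
  simp [h _ hj]

theorem Lin.rename {M : Tm} (h : M.Lin) (ρ : ℕ → ℕ) : (M.rename ρ).Lin := by
  induction M generalizing ρ with
  | var i => trivial
  | atom k l => trivial
  | bang M ih => exact ih h ρ
  | app M N ihM ihN => exact ⟨ihM h.1 ρ, ihN h.2 ρ⟩
  | lam p M ih =>
    refine ⟨ih h.1 _, fun hp i hi => ?_⟩
    rw [← h.2 hp i hi, occ, occ, wt_rename]
    congr 1
    funext j
    simp only [Function.comp, up, Pi.single_apply]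
    split
    · rfl
    · rw [if_neg (by omega), if_neg (by omega)]

/-- Lifting fixes the variables of a binder and shifts the substituted terms past them, so their
counts are those in the original body. The substituted terms may be copied freely, since linearity
only constrains bound variables. -/
theorem Lin.subst {M : Tm} (h : M.Lin) {σ : ℕ → Tm} (hσ : ∀ i, (σ i).Lin) : (M.subst σ).Lin := by
  induction M generalizing σ with
  | var i => exact hσ i
  | atom k l => trivial
  | bang M ih => exact ih h hσ
  | app M N ihM ihN => exact ⟨ihM h.1 hσ, ihN h.2 hσ⟩
  | lam p M ih =>
    refine ⟨ih h.1 fun i => ?_, fun hp i hi => ?_⟩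
    · simp only [ups]
      split
      · trivial
      · exact (hσ _).rename _
    · rw [← h.2 hp i hi, occ, occ, wt_subst]
      congr 1
      funext j
      simp only [ups]
      split
      · rfl
      · rw [wt_rename, Pi.single_eq_of_ne (by omega)]
        convert wt_zero _ using 2
        funext l
        simp only [Function.comp]
        rw [Pi.single_eq_of_ne (by omega)]

theorem Lin.inst {M : Tm} (h : M.Lin) {Ns : List Tm} (hN : ∀ N ∈ Ns, N.Lin) :
    (M.inst Ns).Lin := by
  refine h.subst fun i => ?_
  simp only [instS]
  cases hi : Ns[i]? with
  | none => trivial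
  | some N => exact hN N (List.mem_of_getElem? hi)

theorem Lin.tree {l : List Tm} (h : ∀ N ∈ l, N.Lin) : (tree l).Lin := by
  induction l with
  | nil => trivial
  | cons N l ih =>
    simp only [List.mem_cons, forall_eq_or_imp] at h
    exact ⟨⟨trivial, h.1⟩, ih h.2⟩

theorem wt_tree (κ ω : ℕ → ℕ) (l : List Tm) : (tree l).wt κ ω = (l.map (wt κ ω)).sum := by
  induction l with
  | nil => simp [tree, wt]
  | cons N l ih => rw [tree] at *; simp [wt, ih]

theorem tree_subst (σ : ℕ → Tm) (l : List Tm) : (tree l).subst σ = tree (l.map (subst σ)) := by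
  induction l with
  | nil => rfl
  | cons N l ih => rw [tree] at *; simp [subst, ih, tree]

/-- The tuple of the given quantum variables. -/
abbrev qtree (qs : List ℕ) : Tm := tree (qs.map qvar)

theorem qtree_subst (σ : ℕ → Tm) (qs : List ℕ) : (qtree qs).subst σ = qtree qs := by
  rw [tree_subst, List.map_map]
  rfl

theorem wt_qtree (κ ω : ℕ → ℕ) (qs : List ℕ) : (qtree qs).wt κ ω = (qs.map κ).sum := by
  rw [wt_tree, List.map_map]
  congr 1

theorem subst_congr {σ τ : ℕ → Tm} {M : Tm} (h : ∀ i, M.occ i ≠ 0 → σ i = τ i) :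
    M.subst σ = M.subst τ := by
  induction M generalizing σ τ with
  | var i => exact h i (by simp [occ, wt])
  | atom k l => rfl
  | bang M ih => simp only [subst]; rw [ih fun i hi => h i (by simpa [occ, wt] using hi)]
  | app M N ihM ihN =>
    simp only [subst]
    rw [ihM fun i hi => h i (by simp only [occ, wt] at *; omega),
      ihN fun i hi => h i (by simp only [occ, wt] at *; omega)]
  | lam p M ih =>
    simp only [subst]
    rw [ih fun i hi => ?_]
    simp only [ups]
    split
    · rfl
    · rename_i hp
      rw [h]
      rw [occ_lam]
      rwa [Nat.sub_add_cancel (by omega)]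

end Tm

end QCalc

/-! ### Traces up to independence, evaluation, and labelled reduction. -/

namespace QCalc

/-- A label is the creation `Sum.inl (j, r)` of the quantum variable `r` from the bit `j`, or the
application `Sum.inr (i, qs)` of the gate `i` to the quantum variables `qs`. -/
abbrev Label : Type := (ℕ × ℕ) ⊕ (ℕ × List ℕ)

namespace Label

/-- The quantum variables that a label acts on. -/
def supp : Label → List ℕ
  | .inl a => [a.2]
  | .inr a => a.2

/-- The weight of the created variables. -/
def newWt (κ : ℕ → ℕ) : Label → ℕ
  | .inl a => κ a.2
  | .inr _ => 0

end Label

/-- The weight of the variables created in a trace. -/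
def newWt (κ : ℕ → ℕ) (t : List Label) : ℕ := (t.map (Label.newWt κ)).sum

@[simp] theorem newWt_nil (κ : ℕ → ℕ) : newWt κ [] = 0 := rfl

@[simp] theorem newWt_append (κ : ℕ → ℕ) (s t : List Label) :
    newWt κ (s ++ t) = newWt κ s + newWt κ t := by simp [newWt]

@[simp] theorem newWt_cons (κ : ℕ → ℕ) (a : Label) (t : List Label) :
    newWt κ (a :: t) = a.newWt κ + newWt κ t := by simp [newWt]

/-- Equivalence of traces up to exchanging independent labels. -/
inductive TEq : List Label → List Label → Prop
  | refl (l) : TEq l l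
  | cons (a) {l l'} : TEq l l' → TEq (a :: l) (a :: l')
  | swap (a b : Label) (l) : a.supp.Disjoint b.supp → TEq (a :: b :: l) (b :: a :: l)
  | trans {l₁ l₂ l₃} : TEq l₁ l₂ → TEq l₂ l₃ → TEq l₁ l₃

namespace TEq

theorem symm {s t : List Label} (h : TEq s t) : TEq t s := by
  induction h with
  | refl l => exact .refl l
  | cons a _ ih => exact .cons a ih
  | swap a b l h => exact .swap b a l h.symm
  | trans _ _ ih ih' => exact ih'.trans ih

theorem perm {s t : List Label} (h : TEq s t) : s.Perm t := by
  induction h with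
  | refl l => exact .refl l
  | cons a _ ih => exact .cons a ih
  | swap a b l h => exact .swap b a l
  | trans _ _ ih ih' => exact ih.trans ih'

theorem newWt_eq {s t : List Label} (h : TEq s t) (κ : ℕ → ℕ) : newWt κ s = newWt κ t :=
  (h.perm.map _).sum_eq

theorem append_left (r : List Label) {s t : List Label} (h : TEq s t) : TEq (r ++ s) (r ++ t) := by
  induction r with
  | nil => exact h
  | cons a r ih => exact .cons a ih

theorem append_right {s t : List Label} (h : TEq s t) (r : List Label) : TEq (s ++ r) (t ++ r) := by
  induction h with
  | refl l => exact .refl _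
  | cons a _ ih => exact .cons a ih
  | swap a b l h => exact .swap a b _ h
  | trans _ _ ih ih' => exact ih.trans ih'

theorem comm_one {a : Label} {t : List Label} (h : ∀ b ∈ t, a.supp.Disjoint b.supp) :
    TEq (a :: t) (t ++ [a]) := by
  induction t with
  | nil => exact .refl _
  | cons b t ih =>
    simp only [List.mem_cons, forall_eq_or_imp] at h
    exact (TEq.swap a b t h.1).trans (.cons b (ih h.2))

theorem comm {s t : List Label} (h : ∀ a ∈ s, ∀ b ∈ t, a.supp.Disjoint b.supp) :
    TEq (s ++ t) (t ++ s) := by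
  induction s with
  | nil => simpa using TEq.refl t
  | cons a s ih =>
    simp only [List.mem_cons, forall_eq_or_imp] at h
    have h2 := (comm_one h.1).append_right s
    simp only [List.cons_append, List.append_assoc] at h2 ⊢
    exact (TEq.cons a (ih h.2)).trans h2

end TEq

open Tm

/-- Contraction of the application of an evaluated function to an evaluated argument. -/
inductive Delta : Tm → Tm → List Label → Tm → Prop
  | beta (M P : Tm) : Delta (lam 0 M) (bang P) [] (M.inst [P])
  | pat (M : Tm) (qs : List ℕ) :
      Delta (lam (qs.length + 2) M) (tup qs) [] (M.inst (qs.map qvar))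
  | new (j r : ℕ) : Delta newC (bit j) [Sum.inl (j, r)] (qvar r)
  | gate (i : ℕ) (qs : List ℕ) : Delta (gate i) (tup qs) [Sum.inr (i, qs)] (qtree qs)
  | cons (r : ℕ) : Delta consC (qvar r) [] (pcons r)
  | pcons (r : ℕ) (qs : List ℕ) : Delta (pcons r) (tup qs) [] (tup (r :: qs))

/-- Terms that evaluate to themselves. -/
def Tm.IsVal : Tm → Prop
  | var _ => False
  | app _ _ => False
  | _ => True

/-- Weak evaluation, with the trace of the created variables and the applied gates. -/
inductive Ev : Tm → List Label → Tm → Prop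
  | val {v : Tm} : v.IsVal → Ev v [] v
  | lin {F A M v : Tm} {t₁ t₂ : List Label} :
      Ev F t₁ (lam 1 M) → Ev (M.inst [A]) t₂ v → Ev (app F A) (t₁ ++ t₂) v
  | strict {F A f a B v : Tm} {t₁ t₂ t₃ t₄ : List Label} :
      Ev F t₁ f → Ev A t₂ a → Delta f a t₃ B → Ev B t₄ v →
      Ev (app F A) (t₁ ++ (t₂ ++ (t₃ ++ t₄))) v

/-- One step of labelled reduction at any place that is not below `!`. -/
inductive St : Tm → List Label → Tm → Prop
  | appL {F F' : Tm} {t : List Label} (A : Tm) : St F t F' → St (app F A) t (app F' A)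
  | appR {A A' : Tm} {t : List Label} (F : Tm) : St A t A' → St (app F A) t (app F A')
  | lam {M M' : Tm} {t : List Label} (p : ℕ) : St M t M' → St (lam p M) t (lam p M')
  | lbeta (M A : Tm) : St (app (lam 1 M) A) [] (M.inst [A])
  | delta {F A f a B : Tm} {t₁ t₂ t₃ : List Label} :
      Ev F t₁ f → Ev A t₂ a → Delta f a t₃ B → St (app F A) (t₁ ++ (t₂ ++ t₃)) B
  | lcm (p : ℕ) (hp : p ≠ 0) (L M N : Tm) :
      St (app L (app (lam p M) N)) [] (app (lam p (app (L.rename (· + bw p)) M)) N)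
  | rcm (p : ℕ) (hp : p ≠ 0) (L M N : Tm) :
      St (app (app (lam p M) N) L) [] (app (lam p (app M (L.rename (· + bw p)))) N)

theorem Delta.subst {f a B : Tm} {t : List Label} (h : Delta f a t B) (σ : ℕ → Tm) :
    Delta (f.subst σ) (a.subst σ) t (B.subst σ) := by
  cases h with
  | beta M P => rw [inst_subst]; exact .beta _ _
  | pat M qs =>
    rw [inst_subst, List.map_map, List.length_map]
    exact .pat _ _
  | new j r => exact .new j r
  | gate i qs => rw [qtree_subst]; exact .gate i qs
  | cons r => exact .cons r
  | pcons r qs => exact .pcons r qs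

theorem Ev.subst {A v : Tm} {t : List Label} (h : Ev A t v) (σ : ℕ → Tm) :
    Ev (A.subst σ) t (v.subst σ) := by
  induction h with
  | @val v hv => exact .val (by cases v <;> trivial)
  | lin _ _ ih₁ ih₂ =>
    rw [inst_subst] at ih₂
    exact .lin ih₁ ih₂
  | strict _ _ hd _ ih₁ ih₂ ih₃ => exact .strict ih₁ ih₂ (hd.subst σ) ih₃

theorem St.subst {M M' : Tm} {t : List Label} (h : St M t M') (σ : ℕ → Tm) :
    St (M.subst σ) t (M'.subst σ) := by
  induction h generalizing σ with
  | appL A _ ih => exact .appL _ (ih σ)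
  | appR F _ ih => exact .appR _ (ih σ)
  | lam p _ ih => exact .lam p (ih _)
  | lbeta M A => rw [inst_subst]; exact .lbeta _ _
  | delta h₁ h₂ hd => exact .delta (h₁.subst σ) (h₂.subst σ) (hd.subst σ)
  | lcm p hp L M N =>
    simp only [Tm.subst, subst_shift]
    exact .lcm p hp _ _ _
  | rcm p hp L M N =>
    simp only [Tm.subst, subst_shift]
    exact .rcm p hp _ _ _

theorem St.rename {M M' : Tm} {t : List Label} (h : St M t M') (ρ : ℕ → ℕ) :
    St (M.rename ρ) t (M'.rename ρ) := by
  simp only [rename_eq_subst]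
  exact h.subst _

/-- A step in the term that is substituted for a variable that occurs exactly once. -/
theorem St.subst_arg {A A' : Tm} {t : List Label} {i : ℕ} {σ σ' : ℕ → Tm} {M : Tm}
    (hi : σ i = A) (hi' : σ' i = A') (h : St A t A') (hσ : ∀ j, j ≠ i → σ j = σ' j)
    (hM : M.occ i = 1) : St (M.subst σ) t (M.subst σ') := by
  induction M generalizing A A' i σ σ' with
  | var j =>
    have : j = i := by
      by_contra hj
      simp [occ, wt, Pi.single_eq_of_ne hj] at hM
    subst this
    simpa [Tm.subst, hi, hi'] using h
  | atom k l => simp [occ, wt] at hM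
  -- Occurrences below `!` count twice, so a count of one excludes them. This is essential, as steps
  -- do not go below `!`.
  | bang M ih => simp only [occ, wt] at hM; omega
  | app M N ihM ihN =>
    have hs : M.occ i + N.occ i = 1 := hM
    have hcg : ∀ P : Tm, P.occ i = 0 → P.subst σ = P.subst σ' := fun P hP =>
      subst_congr fun j hj => hσ j fun hji => hj (hji ▸ hP)
    rcases Nat.eq_zero_or_pos (M.occ i) with h0 | h0
    · simp only [Tm.subst]
      rw [hcg M h0]
      exact .appR _ (ihN hi hi' h hσ (by omega))
    · simp only [Tm.subst]
      rw [hcg N (by omega)]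
      exact .appL _ (ihM hi hi' h hσ (by omega))
  | lam p M ih =>
    refine .lam p (ih (i := i + bw p) rfl rfl ?_ ?_ ?_)
    · simp only [ups]
      simpa [hi, hi'] using h.rename _
    · intro j hj
      simp only [ups]
      split
      · rfl
      · rw [hσ _ (by omega)]
    · rw [← hM, occ_lam]

theorem St.inst_arg {A A' M : Tm} {t : List Label} (h : St A t A') (hM : M.occ 0 = 1) :
    St (M.inst [A]) t (M.inst [A']) := by
  refine St.subst_arg (i := 0) rfl rfl h (fun j hj => ?_) hM
  simp only [instS]
  rw [List.getElem?_eq_none (by simp; omega), List.getElem?_eq_none (by simp; omega)]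
  rfl

/-! ### Linearity along evaluation and reduction -/

theorem Delta.lin {f a B : Tm} {t : List Label} (h : Delta f a t B) (hf : f.Lin) (ha : a.Lin) :
    B.Lin := by
  cases h with
  | beta M P => exact hf.1.inst (by simpa [Tm.Lin] using ha)
  | pat M qs => exact hf.1.inst (by simp [Tm.Lin])
  | gate i qs => exact Lin.tree (by simp [Tm.Lin])
  | _ => trivial

/-- Only the contraction of `λ!x` can copy or erase its argument. That argument stands below `!`,
where weights are doubled, so the bound by one forces its weight to be zero. -/
theorem Delta.wt {f a B : Tm} {t : List Label} (h : Delta f a t B) (hf : f.Lin) (κ ω : ℕ → ℕ)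
    (hw : f.wt κ ω + a.wt κ ω ≤ 1) : B.wt κ ω = f.wt κ ω + a.wt κ ω + newWt κ t := by
  cases h with
  | beta M P =>
    have h0 : P.wt κ ω = 0 := by simp only [Tm.wt] at hw; omega
    rw [wt_inst]
    simp [Tm.wt, h0, bw]
  | pat M qs =>
    rw [wt_inst_of_occ]
    · simp [Tm.wt, bw, Function.comp_def]
    · intro i hi
      exact hf.2 (by omega) i (by simpa [bw] using hi)
  | gate i qs => rw [wt_qtree]; simp [Tm.wt, Label.newWt]
  | new j r => simp [Tm.wt, Label.newWt]
  | cons r => simp [Tm.wt]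
  | pcons r qs => simp [Tm.wt]

/-- A conservation law. The bound is on the total weight including all variables still to be
created, so it holds at every intermediate stage and `Delta.wt` applies there. Point weights give
the counts of single quantum or classical variables. -/
theorem Ev.lin_wt {A v : Tm} {t : List Label} (h : Ev A t v) (hA : A.Lin) :
    v.Lin ∧ ∀ κ ω, A.wt κ ω + newWt κ t ≤ 1 → v.wt κ ω = A.wt κ ω + newWt κ t := by
  induction h with
  | val _ => exact ⟨hA, fun _ _ _ => rfl⟩
  | @lin F A M v t₁ t₂ _ _ ih₁ ih₂ =>
    obtain ⟨l₁, w₁⟩ := ih₁ hA.1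
    obtain ⟨l₂, w₂⟩ := ih₂ (l₁.1.inst (by simpa using hA.2))
    refine ⟨l₂, fun κ ω hw => ?_⟩
    simp only [newWt_append, Tm.wt] at hw ⊢
    have e₁ := w₁ κ ω (by omega)
    have e := wt_inst_of_occ κ ω [A] M (fun i hi => l₁.2 (by omega) i (by simpa [bw] using hi))
    simp only [Tm.wt, bw] at e₁
    simp only [List.length_singleton, List.map_cons, List.map_nil, List.sum_cons, List.sum_nil] at e
    rw [w₂ κ ω (by omega)]
    omega
  | @strict F A f a B v t₁ t₂ t₃ t₄ _ _ hd _ ih₁ ih₂ ih₃ =>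
    obtain ⟨l₁, w₁⟩ := ih₁ hA.1
    obtain ⟨l₂, w₂⟩ := ih₂ hA.2
    obtain ⟨l₃, w₃⟩ := ih₃ (hd.lin l₁ l₂)
    refine ⟨l₃, fun κ ω hw => ?_⟩
    simp only [newWt_append, Tm.wt] at hw ⊢
    have e₁ := w₁ κ ω (by omega)
    have e₂ := w₂ κ ω (by omega)
    have e₃ := hd.wt l₁ κ ω (by omega)
    have e₄ := w₃ κ ω (by omega)
    omega

theorem St.lin_wt {C D : Tm} {t : List Label} (h : St C t D) (hC : C.Lin) :
    D.Lin ∧ ∀ κ ω, C.wt κ ω + newWt κ t ≤ 1 → D.wt κ ω = C.wt κ ω + newWt κ t := by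
  have hsh : ∀ (L : Tm) (p : ℕ) (κ ω : ℕ → ℕ),
      (L.rename (· + bw p)).wt κ (low (bw p) ω) = L.wt κ ω := by
    intro L p κ ω
    rw [wt_rename]
    congr 1
    funext i
    simp [low]
  have hocc : ∀ (L : Tm) (k i : ℕ), i < k → (L.rename (· + k)).occ i = 0 := by
    intro L k i hi
    rw [occ, wt_rename]
    refine (congrArg (fun ω => L.wt _ ω) ?_).trans L.wt_zero
    funext j
    have hj : j + k ≠ i := by omega
    simp [hj]
  induction h with
  | appL A _ ih =>
    obtain ⟨l, w⟩ := ih hC.1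
    refine ⟨⟨l, hC.2⟩, fun κ ω hw => ?_⟩
    simp only [Tm.wt] at hw ⊢
    rw [w κ ω (by omega)]
    omega
  | appR F _ ih =>
    obtain ⟨l, w⟩ := ih hC.2
    refine ⟨⟨hC.1, l⟩, fun κ ω hw => ?_⟩
    simp only [Tm.wt] at hw ⊢
    rw [w κ ω (by omega)]
    omega
  | lam p _ ih =>
    obtain ⟨l, w⟩ := ih hC.1
    refine ⟨⟨l, fun hp i hi => ?_⟩, fun κ ω hw => w κ _ hw⟩
    -- With weight zero for all quantum variables, the conservation law shows that a variable of the
    -- binder still occurs exactly once after a step in the body.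
    have e := w (fun _ => 0) (Pi.single i 1)
    have e0 : ∀ t, newWt (fun _ => 0) t = 0 := by
      intro t
      induction t with
      | nil => rfl
      | cons a t ih => cases a <;> simp [ih, Label.newWt]
    have e1 := hC.2 hp i hi
    rw [e0] at e
    rw [occ] at e1 ⊢
    omega
  | lbeta M A =>
    refine ⟨hC.1.1.inst (by simpa using hC.2), fun κ ω _ => ?_⟩
    rw [wt_inst_of_occ _ _ _ _ fun i hi => hC.1.2 (by omega) i (by simpa [bw] using hi)]
    simp [Tm.wt, bw]
  | delta h₁ h₂ hd =>
    obtain ⟨l₁, w₁⟩ := h₁.lin_wt hC.1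
    obtain ⟨l₂, w₂⟩ := h₂.lin_wt hC.2
    refine ⟨hd.lin l₁ l₂, fun κ ω hw => ?_⟩
    simp only [newWt_append, Tm.wt] at hw ⊢
    have e₁ := w₁ κ ω (by omega)
    have e₂ := w₂ κ ω (by omega)
    have e₃ := hd.wt l₁ κ ω (by omega)
    omega
  | lcm p hp L M N =>
    refine ⟨⟨⟨⟨hC.1.rename _, hC.2.1.1⟩, fun _ i hi => ?_⟩, hC.2.2⟩, fun κ ω _ => ?_⟩
    · have e := hC.2.1.2 hp i hi
      have e' := hocc L _ i hi
      simp only [occ, Tm.wt] at *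
      omega
    · simp only [Tm.wt, hsh, newWt_nil]
      omega
  | rcm p hp L M N =>
    refine ⟨⟨⟨⟨hC.1.1.1, hC.2.rename _⟩, fun _ i hi => ?_⟩, hC.1.2⟩, fun κ ω _ => ?_⟩
    · have e := hC.1.1.2 hp i hi
      have e' := hocc L _ i hi
      simp only [occ, Tm.wt] at *
      omega
    · simp only [Tm.wt, hsh, newWt_nil]
      omega

end QCalc

/-! ### Conservation of quantum variables. -/

namespace QCalc
open Tm

/-- The number of occurrences of a quantum variable in a term. -/
def Tm.qc (r : ℕ) (M : Tm) : ℕ := M.wt (Pi.single r 1) (fun _ => 0)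

/-- The number of times a quantum variable is created in a trace. -/
def newCount (r : ℕ) (t : List Label) : ℕ := newWt (Pi.single r 1) t

@[simp] theorem newCount_nil (r : ℕ) : newCount r [] = 0 := rfl

@[simp] theorem newCount_append (r : ℕ) (s t : List Label) :
    newCount r (s ++ t) = newCount r s + newCount r t := newWt_append _ _ _

theorem TEq.newCount_eq {s t : List Label} (h : TEq s t) (r : ℕ) : newCount r s = newCount r t :=
  h.newWt_eq _

theorem Ev.qc {A v : Tm} {t : List Label} (h : Ev A t v) (hA : A.Lin) {r : ℕ}
    (hr : A.qc r + newCount r t ≤ 1) : v.qc r = A.qc r + newCount r t :=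
  (h.lin_wt hA).2 _ _ hr

theorem St.qc {C D : Tm} {t : List Label} (h : St C t D) (hC : C.Lin) {r : ℕ}
    (hr : C.qc r + newCount r t ≤ 1) : D.qc r = C.qc r + newCount r t :=
  (h.lin_wt hC).2 _ _ hr

theorem Delta.qc {f a B : Tm} {t : List Label} (h : Delta f a t B) (hf : f.Lin) {r : ℕ}
    (hw : f.qc r + a.qc r ≤ 1) : B.qc r = f.qc r + a.qc r + newCount r t :=
  h.wt hf _ _ hw

theorem Tm.qc_app (r : ℕ) (M N : Tm) : (app M N).qc r = M.qc r + N.qc r := rfl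

theorem Tm.qc_lam (r p : ℕ) (M : Tm) : (lam p M).qc r = M.qc r := by
  have : low (bw p) (fun _ => 0) = fun _ => 0 := by
    funext i
    simp [low]
  simp [Tm.qc, wt, this]

theorem Tm.qc_inst_single {M A : Tm} (r : ℕ) (h : M.occ 0 = 1) :
    (M.inst [A]).qc r = M.qc r + A.qc r := by
  have : low 1 (fun _ => 0) = fun _ => 0 := by
    funext i
    simp [low]
  simp only [Tm.qc]
  rw [wt_inst_of_occ _ _ _ _ fun i hi => by
    simp only [List.length_singleton, Nat.lt_one_iff] at hi; rwa [hi]]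
  simp [this]

theorem sum_map_single (r : ℕ) (qs : List ℕ) :
    (qs.map (Pi.single r 1 : ℕ → ℕ)).sum = qs.count r := by
  induction qs with
  | nil => rfl
  | cons a qs ih =>
    rw [List.map_cons, List.sum_cons, ih, List.count_cons, Pi.single_apply, add_comm]
    congr 1
    simp

theorem Tm.qc_tup (r : ℕ) (qs : List ℕ) : (tup qs).qc r = qs.count r := by
  simp [Tm.qc, wt, sum_map_single]

theorem Delta.supp {f a B : Tm} {t : List Label} (h : Delta f a t B) {x : Label} (hx : x ∈ t)
    {r : ℕ} (hr : r ∈ x.supp) : 1 ≤ a.qc r + newCount r t := by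
  cases h with
  | gate i qs =>
    simp only [List.mem_singleton] at hx
    subst hx
    rw [Tm.qc_tup]
    have : 0 < qs.count r := List.count_pos_iff.2 hr
    omega
  | new j r' =>
    simp only [List.mem_singleton] at hx
    subst hx
    simp only [Label.supp, List.mem_singleton] at hr
    subst hr
    simp [newCount, Label.newWt]
  | _ => simp at hx

/-- A gate acts on the variables of an evaluated tuple, and by conservation these occur in the
initial term or are created in the trace. Hence subterms without common names have independent
traces. -/
theorem Ev.supp {A v : Tm} {t : List Label} (h : Ev A t v) (hA : A.Lin)
    (hf : ∀ r, A.qc r + newCount r t ≤ 1) {x : Label} (hx : x ∈ t) {r : ℕ} (hr : r ∈ x.supp) :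
    1 ≤ A.qc r + newCount r t := by
  induction h with
  | val _ => simp at hx
  | @lin F A M v t₁ t₂ h₁ _ ih₁ ih₂ =>
    have l₁ := (h₁.lin_wt hA.1).1
    have hq : ∀ r, (M.inst [A]).qc r = F.qc r + newCount r t₁ + A.qc r := by
      intro r
      have := hf r
      simp only [newCount_append, Tm.qc_app] at this
      rw [Tm.qc_inst_single r (l₁.2 (by omega) 0 (by simp [bw])), ← h₁.qc hA.1 (by omega),
        Tm.qc_lam]
    simp only [newCount_append, Tm.qc_app] at hf ⊢
    rcases List.mem_append.1 hx with hx | hx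
    · have := ih₁ hA.1 (fun r => by have := hf r; omega) hx
      omega
    · have := ih₂ (l₁.1.inst (by simpa using hA.2)) (fun r => by rw [hq]; have := hf r; omega) hx
      rw [hq] at this
      omega
  | @strict F A f a B v t₁ t₂ t₃ t₄ h₁ h₂ hd _ ih₁ ih₂ ih₃ =>
    simp only [newCount_append, Tm.qc_app] at hf ⊢
    have l₁ := (h₁.lin_wt hA.1).1
    have l₂ := (h₂.lin_wt hA.2).1
    have q₁ : ∀ r, f.qc r = F.qc r + newCount r t₁ :=
      fun r => h₁.qc hA.1 (by have := hf r; omega)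
    have q₂ : ∀ r, a.qc r = A.qc r + newCount r t₂ :=
      fun r => h₂.qc hA.2 (by have := hf r; omega)
    have q₃ : ∀ r, B.qc r = f.qc r + a.qc r + newCount r t₃ :=
      fun r => hd.qc l₁ (by have := hf r; rw [q₁, q₂]; omega)
    simp only [List.mem_append] at hx
    rcases hx with hx | hx | hx | hx
    · have := ih₁ hA.1 (fun r => by have := hf r; omega) hx
      omega
    · have := ih₂ hA.2 (fun r => by have := hf r; omega) hx
      omega
    · have := hd.supp hx hr
      rw [q₂] at this
      omega
    · have := ih₃ (hd.lin l₁ l₂) (fun r => by rw [q₃, q₁, q₂]; have := hf r; omega) hx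
      rw [q₃, q₁, q₂] at this
      omega

theorem St.supp {C D : Tm} {t : List Label} (h : St C t D) (hC : C.Lin)
    (hf : ∀ r, C.qc r + newCount r t ≤ 1) {x : Label} (hx : x ∈ t) {r : ℕ} (hr : r ∈ x.supp) :
    1 ≤ C.qc r + newCount r t := by
  induction h with
  | appL A _ ih =>
    simp only [Tm.qc_app] at hf ⊢
    have := ih hC.1 (fun r => by have := hf r; omega) hx
    omega
  | appR F _ ih =>
    simp only [Tm.qc_app] at hf ⊢
    have := ih hC.2 (fun r => by have := hf r; omega) hx
    omega
  | lam p _ ih =>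
    simp only [Tm.qc_lam] at hf ⊢
    exact ih hC.1 hf hx
  | @delta F A f a B t₁ t₂ t₃ h₁ h₂ hd =>
    simp only [newCount_append, Tm.qc_app] at hf ⊢
    have q₂ : ∀ r, a.qc r = A.qc r + newCount r t₂ :=
      fun r => h₂.qc hC.2 (by have := hf r; omega)
    simp only [List.mem_append] at hx
    rcases hx with hx | hx | hx
    · have := h₁.supp hC.1 (fun r => by have := hf r; omega) hx hr
      omega
    · have := h₂.supp hC.2 (fun r => by have := hf r; omega) hx hr
      omega
    · have := hd.supp hx hr
      rw [q₂] at this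
      omega
  | _ => simp at hx

/-! ### Postponement of reduction steps. -/

/-- A remaining reduction step inside of a value. -/
inductive Rest : Tm → List Label → Tm → Prop
  | refl (v : Tm) : Rest v [] v
  | lam {M M' : Tm} {t : List Label} (p : ℕ) : St M t M' → Rest (lam p M) t (lam p M')

theorem Rest.atom {v : Tm} {t : List Label} {k : ℕ} {l : List ℕ} (h : Rest v t (atom k l)) :
    v = atom k l ∧ t = [] := by
  cases h
  exact ⟨rfl, rfl⟩

/-- The argument of a contraction is an atom or a banged term. Steps do not enter these, so a
postponed step can remain in a function value only. -/
theorem Delta.arg {f a B v : Tm} {s t : List Label} (h : Delta f a s B) (hr : Rest v t a) :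
    v = a ∧ t = [] := by
  cases h <;> cases hr <;> exact ⟨rfl, rfl⟩

theorem Ev.lam {p : ℕ} {M v : Tm} {t : List Label} (h : Ev (lam p M) t v) :
    v = Tm.lam p M ∧ t = [] := by
  cases h
  exact ⟨rfl, rfl⟩

/-- The functions `p` and `q` count the names at the disposal of the two traces; a name shared by
both would be counted twice. -/
theorem disjoint_of {s t : List Label} {p q : ℕ → ℕ} (hs : ∀ x ∈ s, ∀ r ∈ x.supp, 1 ≤ p r)
    (ht : ∀ x ∈ t, ∀ r ∈ x.supp, 1 ≤ q r) (h : ∀ r, p r + q r ≤ 1) :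
    ∀ a ∈ s, ∀ b ∈ t, a.supp.Disjoint b.supp := by
  intro a ha b hb r hra hrb
  have := hs a ha r hra
  have := ht b hb r hrb
  have := h r
  omega

theorem TEq.assoc_swap {s s' t₁ t₂ t₃ t₁' : List Label} (h₁ : TEq (t₁' ++ s') (s ++ t₁))
    (h : TEq (s' ++ t₂) (t₂ ++ s')) : TEq (t₁' ++ (t₂ ++ (s' ++ t₃))) (s ++ (t₁ ++ (t₂ ++ t₃))) := by
  have e₁ : TEq (t₁' ++ (t₂ ++ (s' ++ t₃))) (t₁' ++ (s' ++ (t₂ ++ t₃))) := by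
    refine append_left _ ?_
    simpa only [List.append_assoc] using h.symm.append_right t₃
  refine e₁.trans ?_
  simpa only [List.append_assoc] using h₁.append_right (t₂ ++ t₃)

/-- Reduction steps can be postponed: if `C` reduces to `D` and `D` evaluates, then `C` evaluates,
up to a step inside of the value. -/
theorem St.expand {D v : Tm} {t : List Label} (hD : Ev D t v) {C : Tm} {s : List Label}
    (h : St C s D) (hC : C.Lin) (hf : ∀ r, C.qc r + newCount r s + newCount r t ≤ 1) :
    ∃ t' v' s', Ev C t' v' ∧ Rest v' s' v ∧ TEq (t' ++ s') (s ++ t) := by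
  -- Each evaluation of `D` is compared with the place of the step. A contraction at the root of `C`
  -- is itself the beginning of an evaluation of `C`; the work lies in steps inside of an
  -- application and in the commuting rules.
  induction hD generalizing C s with
  | @val v hv =>
    have hV := Ev.val hv
    generalize hE : v = v₀ at h
    cases h with
    | appL => subst hE; exact hv.elim
    | appR => subst hE; exact hv.elim
    | lcm => subst hE; exact hv.elim
    | rcm => subst hE; exact hv.elim
    | lam p h => subst hE; exact ⟨[], _, _, .val trivial, .lam p h, by simpa using .refl _⟩
    | lbeta M A =>
      refine ⟨_, _, [], .lin (.val trivial) (hE ▸ hV), .refl _, ?_⟩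
      simpa using .refl _
    | delta h₁ h₂ hd =>
      refine ⟨_, _, [], .strict h₁ h₂ hd (hE ▸ hV), .refl _, ?_⟩
      simpa using .refl _
  | @lin F A M v t₁ t₂ h₁ h₂ ih₁ ih₂ =>
    have hV := Ev.lin h₁ h₂
    generalize hE : app F A = D₀ at h
    cases h with
    | lam => cases hE
    | lbeta M A =>
      refine ⟨_, _, [], .lin (.val trivial) (hE ▸ hV), .refl _, ?_⟩
      simpa using .refl _
    | delta h₁' h₂' hd =>
      refine ⟨_, _, [], .strict h₁' h₂' hd (hE ▸ hV), .refl _, ?_⟩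
      simpa using .refl _
    | @appL F₀ F' s A' hs =>
      cases hE
      simp only [newCount_append, Tm.qc_app] at hf
      obtain ⟨t₁', f', s', e₁, r₁, q₁⟩ := ih₁ hs hC.1 (fun r => by have := hf r; omega)
      cases r₁ with
      | refl =>
        refine ⟨_, _, [], .lin e₁ h₂, .refl _, ?_⟩
        simpa only [List.append_assoc, List.append_nil] using q₁.append_right t₂
      -- The step left under the λ passes to the instance of the body by `St.subst` and is postponed
      -- once more by the induction hypothesis.
      | @lam M' _ s' p hM =>
        have l := e₁.lin_wt hC.1
        have ho : M'.occ 0 = 1 := l.1.2 (by omega) 0 (by simp [bw])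
        have hn : ∀ r, newCount r t₁' + newCount r s' = newCount r s + newCount r t₁ := fun r => by
          simpa using q₁.newCount_eq r
        have hq : ∀ r, M'.qc r = F₀.qc r + newCount r t₁' := fun r => by
          rw [← e₁.qc hC.1 (by have := hf r; have := hn r; omega), Tm.qc_lam]
        obtain ⟨t₂', v', s'', e₂, r₂, q₂⟩ := ih₂ (hM.subst _)
          (l.1.1.inst (by simpa using hC.2)) (fun r => by
            have := hf r; have := hn r
            have e := Tm.qc_inst_single (A := A) r ho
            rw [hq] at e
            rw [Tm.inst] at e
            omega)
        refine ⟨_, _, _, .lin e₁ e₂, r₂, ?_⟩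
        have a₁ := q₂.append_left t₁'
        have a₂ := q₁.append_right t₂
        simp only [List.append_assoc] at a₁ a₂ ⊢
        exact a₁.trans a₂
    | @appR A₀ A' s F' hs =>
      cases hE
      simp only [newCount_append, Tm.qc_app] at hf
      have l := h₁.lin_wt hC.1
      have ho : M.occ 0 = 1 := l.1.2 (by omega) 0 (by simp [bw])
      have hq : ∀ r, M.qc r = F.qc r + newCount r t₁ := fun r => by
        rw [← h₁.qc hC.1 (by have := hf r; omega), Tm.qc_lam]
      -- The argument is passed on unevaluated to a variable that occurs exactly once and not below
      -- `!`, so its step is a single step of the instance. The labels `s` now come after `t₁`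
      -- instead of before; these traces have disjoint names.
      obtain ⟨t₂', v', s'', e₂, r₂, q₂⟩ := ih₂ (hs.inst_arg ho)
        (l.1.1.inst (by simpa using hC.2)) (fun r => by
          have := hf r
          rw [Tm.qc_inst_single (A := A₀) r ho, hq]
          omega)
      refine ⟨_, _, _, .lin h₁ e₂, r₂, ?_⟩
      have a₁ := q₂.append_left t₁
      have a₂ := (TEq.comm (disjoint_of
        (fun x hx r hr => h₁.supp hC.1 (fun r => by have := hf r; omega) hx hr)
        (fun x hx r hr => hs.supp hC.2 (fun r => by have := hf r; omega) hx hr)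
        (fun r => by have := hf r; omega))).append_right t₂
      simp only [List.append_assoc] at a₁ a₂ ⊢
      exact a₁.trans a₂
    -- The commuted redex contracts to `app L (M'.inst [A])`, which `C` also reaches by contracting
    -- its inner redex in place. So the induction hypothesis for this contractum already evaluates
    -- `C`.
    | lcm p hp L M' N =>
      cases hE
      cases h₁
      simp only [List.nil_append, newCount_nil] at hf ⊢
      have e : (app (L.rename (· + bw 1)) M').inst [A] = app L (M'.inst [A]) := by
        have := shift_inst [A] L
        simp only [Tm.inst, List.length_singleton] at this
        simp only [Tm.inst, Tm.subst, bw, this]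
      rw [e] at ih₂
      have ho : M'.occ 0 = 1 := hC.2.1.2 (by omega) 0 (by simp [bw])
      obtain ⟨t', v', s', e', r', q'⟩ := ih₂ (.appR L (.lbeta M' A)) hC
        (fun r => by simpa using hf r)
      exact ⟨t', v', s', e', r', q'⟩
    | rcm p hp L M' N =>
      cases hE
      cases h₁
      simp only [List.nil_append, newCount_nil] at hf ⊢
      have e : (app M' (L.rename (· + bw 1))).inst [A] = app (M'.inst [A]) L := by
        have := shift_inst [A] L
        simp only [Tm.inst, List.length_singleton] at this
        simp only [Tm.inst, Tm.subst, bw, this]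
      rw [e] at ih₂
      obtain ⟨t', v', s', e', r', q'⟩ := ih₂ (.appL L (.lbeta M' A)) hC
        (fun r => by simpa using hf r)
      exact ⟨t', v', s', e', r', q'⟩
  | @strict F A f a B v t₁ t₂ t₃ t₄ h₁ h₂ hd h₄ ih₁ ih₂ ih₃ =>
    have hV := Ev.strict h₁ h₂ hd h₄
    generalize hE : app F A = D₀ at h
    cases h with
    | lam => cases hE
    | lbeta M A =>
      refine ⟨_, _, [], .lin (.val trivial) (hE ▸ hV), .refl _, ?_⟩
      simpa using .refl _
    | delta h₁' h₂' hd' =>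
      refine ⟨_, _, [], .strict h₁' h₂' hd' (hE ▸ hV), .refl _, ?_⟩
      simpa using .refl _
    | @appL F₀ F' s A' hs =>
      cases hE
      simp only [newCount_append, Tm.qc_app] at hf
      obtain ⟨t₁', f', s', e₁, r₁, q₁⟩ := ih₁ hs hC.1 (fun r => by have := hf r; omega)
      cases r₁ with
      | refl =>
        refine ⟨_, _, [], .strict e₁ h₂ hd h₄, .refl _, ?_⟩
        simpa only [List.append_assoc, List.append_nil] using q₁.append_right _
      | @lam M' M s' p hM =>
        have l := e₁.lin_wt hC.1
        have la := h₂.lin_wt hC.2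
        have hn : ∀ r, newCount r t₁' + newCount r s' = newCount r s + newCount r t₁ := fun r => by
          simpa using q₁.newCount_eq r
        have hq : ∀ r, (Tm.lam p M').qc r = F₀.qc r + newCount r t₁' := fun r =>
          e₁.qc hC.1 (by have := hf r; have := hn r; omega)
        have hqa : ∀ r, a.qc r = A.qc r + newCount r t₂ := fun r =>
          h₂.qc hC.2 (by have := hf r; omega)
        -- Contracting an abstraction only substitutes into its body, so the step in the body
        -- becomes a step between the contracta. Such a contraction also has an empty trace.
        obtain ⟨B', hd', hB⟩ : ∃ B', Delta (Tm.lam p M') a t₃ B' ∧ St B' s' B := by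
          cases hd with
          | beta M P => exact ⟨_, .beta _ _, hM.subst _⟩
          | pat M qs => exact ⟨_, .pat _ _, hM.subst _⟩
        have ht₃ : t₃ = [] := by cases hd <;> rfl
        subst ht₃
        obtain ⟨t₄', v', s'', e₄, r₄, q₄⟩ := ih₃ hB (hd'.lin l.1 la.1) (fun r => by
          have := hf r; have := hn r
          have e := hd'.qc l.1 (r := r) (by rw [hq, hqa]; omega)
          rw [hq, hqa] at e
          simp only [newCount_nil] at *
          omega)
        refine ⟨_, _, _, .strict e₁ h₂ hd' e₄, r₄, ?_⟩
        have hc : TEq (s' ++ t₂) (t₂ ++ s') := TEq.comm (disjoint_of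
          (fun x hx r hr => hM.supp l.1.1 (fun r => by
            have := hf r; have := hn r; have := hq r; rw [Tm.qc_lam] at this; omega) hx hr)
          (fun x hx r hr => h₂.supp hC.2 (fun r => by have := hf r; omega) hx hr)
          (fun r => by
            have := hf r; have := hn r; have := hq r; rw [Tm.qc_lam] at this; omega))
        have a₁ := (q₄.append_left t₂).append_left t₁'
        have a₂ := TEq.assoc_swap (t₃ := t₄) q₁ hc
        simp only [List.append_assoc, List.nil_append] at a₁ a₂ ⊢
        exact a₁.trans a₂
    | @appR A₀ A' s F' hs =>
      cases hE
      simp only [newCount_append, Tm.qc_app] at hf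
      obtain ⟨t₂', a', s', e₂, r₂, q₂⟩ := ih₂ hs hC.2 (fun r => by have := hf r; omega)
      obtain ⟨rfl, rfl⟩ := hd.arg r₂
      refine ⟨_, _, [], .strict h₁ e₂ hd h₄, .refl _, ?_⟩
      have a₁ := (q₂.append_left t₁).append_right (t₃ ++ t₄)
      have a₂ := (TEq.comm (disjoint_of
        (fun x hx r hr => h₁.supp hC.1 (fun r => by have := hf r; omega) hx hr)
        (fun x hx r hr => hs.supp hC.2 (fun r => by have := hf r; omega) hx hr)
        (fun r => by have := hf r; omega))).append_right (t₂ ++ (t₃ ++ t₄))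
      simp only [List.append_assoc, List.append_nil] at a₁ a₂ ⊢
      exact a₁.trans a₂
    | lcm p hp L M' N =>
      cases hE
      obtain ⟨rfl, rfl⟩ := h₁.lam
      cases hd with
      | beta => exact (hp rfl).elim
      | pat _ qs =>
      have e : (app (L.rename (· + bw (qs.length + 2))) M').inst (qs.map qvar) =
          app L (M'.inst (qs.map qvar)) := by
        have := shift_inst (qs.map qvar) L
        simp only [Tm.inst, List.length_map] at this
        simp only [Tm.inst, Tm.subst, bw, this]
      rw [e] at ih₃
      simp only [List.nil_append, newCount_append, newCount_nil] at hf ⊢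
      -- For a pattern the argument is evaluated on the way, with trace `t₂`. The induction needs
      -- this to be one step, which is why `St.delta` contains the evaluations of function and
      -- argument.
      obtain ⟨t', v', s', e', r', q'⟩ := ih₃ (.appR L (.delta (F := Tm.lam (qs.length + 2) M') (.val trivial) h₂ (.pat M' qs))) hC
        (fun r => by have := hf r; simp only [List.nil_append, newCount_append, newCount_nil]; omega)
      refine ⟨t', v', s', e', r', ?_⟩
      simpa using q'
    | rcm p hp L M' N =>
      cases hE
      obtain ⟨rfl, rfl⟩ := h₁.lam
      cases hd with
      | beta => exact (hp rfl).elim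
      | pat _ qs =>
      have e : (app M' (L.rename (· + bw (qs.length + 2)))).inst (qs.map qvar) =
          app (M'.inst (qs.map qvar)) L := by
        have := shift_inst (qs.map qvar) L
        simp only [Tm.inst, List.length_map] at this
        simp only [Tm.inst, Tm.subst, bw, this]
      rw [e] at ih₃
      simp only [List.nil_append, newCount_append, newCount_nil] at hf ⊢
      obtain ⟨t', v', s', e', r', q'⟩ := ih₃ (.appL L (.delta (F := Tm.lam (qs.length + 2) M') (.val trivial) h₂ (.pat M' qs))) hC
        (fun r => by have := hf r; simp only [List.nil_append, newCount_append, newCount_nil]; omega)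
      refine ⟨t', v', s', e', r', ?_⟩
      simpa using q'

end QCalc

/-! ### Reduction sequences that end in an observable value. -/

namespace QCalc
open Tm

/-- Sequences of reduction steps. -/
inductive Chain : Tm → List Label → Tm → Prop
  | refl (C : Tm) : Chain C [] C
  | head {C D F : Tm} {s t : List Label} : St C s D → Chain D t F → Chain C (s ++ t) F

theorem Chain.trans {C D F : Tm} {s t : List Label} (h : Chain C s D) (h' : Chain D t F) :
    Chain C (s ++ t) F := by
  induction h with
  | refl C => exact h'
  | head hs _ ih => rw [List.append_assoc]; exact .head hs (ih h')

theorem Chain.single {C D : Tm} {s : List Label} (h : St C s D) : Chain C s D := by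
  simpa using Chain.head h (.refl D)

theorem Chain.appL {C D : Tm} {s : List Label} (h : Chain C s D) (A : Tm) :
    Chain (app C A) s (app D A) := by
  induction h with
  | refl C => exact .refl _
  | head hs _ ih => exact .head (.appL A hs) ih

theorem Chain.qc {C D : Tm} {s : List Label} (h : Chain C s D) (hC : C.Lin) {r : ℕ}
    (hr : C.qc r + newCount r s ≤ 1) : D.qc r = C.qc r + newCount r s := by
  induction h with
  | refl C => rfl
  | head hs _ ih =>
    rw [newCount_append] at hr ⊢
    have := hs.qc hC (r := r) (by omega)
    rw [ih (hs.lin_wt hC).1 (by omega)]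
    omega

/-- A term that reduces to a term that evaluates to an atom evaluates to this atom. -/
theorem Chain.expand {C D : Tm} {s : List Label} (h : Chain C s D) {k : ℕ} {l : List ℕ}
    (hD : Ev D [] (atom k l)) (hC : C.Lin) (hf : ∀ r, C.qc r + newCount r s ≤ 1) :
    ∃ t, Ev C t (atom k l) ∧ TEq t s := by
  induction h with
  | refl C => exact ⟨[], hD, .refl _⟩
  | @head C D F s t hs _ ih =>
    simp only [newCount_append] at hf
    obtain ⟨t', e, q⟩ := ih hD (hs.lin_wt hC).1 (fun r => by
      have := hf r
      rw [hs.qc hC (by omega)]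
      omega)
    obtain ⟨t'', v, s', e', r', q'⟩ := hs.expand e hC (fun r => by
      have := hf r
      rw [q.newCount_eq]
      omega)
    -- No step can remain inside of an atom, so all labels are accounted for.
    obtain ⟨rfl, rfl⟩ := r'.atom
    refine ⟨t'', e', ?_⟩
    rw [List.append_nil] at q'
    exact q'.trans (q.append_left s)

/-! ### Gates act on available variables -/

/-- Every gate of the trace acts on variables in `S` or on variables that were created before. -/
def Scoped : Set ℕ → List Label → Prop
  | _, [] => True
  | S, .inl a :: t => Scoped (insert a.2 S) t
  | S, .inr a :: t => (∀ r ∈ a.2, r ∈ S) ∧ Scoped S t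

theorem Scoped.mono {S S' : Set ℕ} {t : List Label} (h : Scoped S t) (hS : S ⊆ S') :
    Scoped S' t := by
  induction t generalizing S S' with
  | nil => trivial
  | cons a t ih =>
    cases a with
    | inl a => exact ih h (Set.insert_subset_insert hS)
    | inr a => exact ⟨fun r hr => hS (h.1 r hr), ih h.2 hS⟩

theorem Scoped.append {S : Set ℕ} {s t : List Label} (h : Scoped S s)
    (h' : Scoped (S ∪ {r | 1 ≤ newCount r s}) t) : Scoped S (s ++ t) := by
  induction s generalizing S with
  | nil => simpa using h'
  | cons a s ih =>
    cases a with
    | inl a =>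
      refine ih h (h'.mono ?_)
      rintro r (hr | hr)
      · exact Or.inl (Or.inr hr)
      · by_cases hra : r = a.2
        · exact Or.inl (Or.inl hra)
        · right
          simpa [newCount, Label.newWt, Pi.single_apply, Ne.symm hra] using hr
    | inr a =>
      refine ⟨h.1, ih h.2 (h'.mono ?_)⟩
      rintro r (hr | hr)
      · exact Or.inl hr
      · right
        simpa [newCount, Label.newWt] using hr

theorem Delta.scoped {f a B : Tm} {t : List Label} (h : Delta f a t B) :
    Scoped {r | 1 ≤ a.qc r} t := by
  cases h with
  | gate i qs =>
    refine ⟨fun r hr => ?_, trivial⟩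
    rw [Set.mem_ofPred_eq, qc_tup]
    exact List.count_pos_iff.2 hr
  | _ => trivial

/-- Gates receive quantum variables as data. By conservation, whatever a subterm holds at some
moment occurred at the beginning or was created earlier in the trace. -/
theorem Ev.scoped {A v : Tm} {t : List Label} (h : Ev A t v) (hA : A.Lin)
    (hf : ∀ r, A.qc r + newCount r t ≤ 1) : Scoped {r | 1 ≤ A.qc r} t := by
  induction h with
  | val _ => trivial
  | @lin F A M v t₁ t₂ h₁ _ ih₁ ih₂ =>
    simp only [newCount_append, qc_app] at hf
    have l₁ := (h₁.lin_wt hA.1).1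
    have hq : ∀ r, (M.inst [A]).qc r = F.qc r + newCount r t₁ + A.qc r := fun r => by
      have := hf r
      rw [qc_inst_single r (l₁.2 (by omega) 0 (by simp [bw])), ← h₁.qc hA.1 (by omega), qc_lam]
    refine ((ih₁ hA.1 fun r => by have := hf r; omega).mono ?_).append
      ((ih₂ (l₁.1.inst (by simpa using hA.2)) fun r => by
        rw [hq]; have := hf r; omega).mono ?_)
    · intro r hr
      simp only [Set.mem_ofPred_eq, qc_app] at hr ⊢
      omega
    · intro r hr
      simp only [Set.mem_union, Set.mem_ofPred_eq, qc_app, hq] at hr ⊢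
      omega
  | @strict F A f a B v t₁ t₂ t₃ t₄ h₁ h₂ hd _ ih₁ ih₂ ih₃ =>
    simp only [newCount_append, qc_app] at hf
    have l₁ := (h₁.lin_wt hA.1).1
    have l₂ := (h₂.lin_wt hA.2).1
    have q₁ : ∀ r, f.qc r = F.qc r + newCount r t₁ :=
      fun r => h₁.qc hA.1 (by have := hf r; omega)
    have q₂ : ∀ r, a.qc r = A.qc r + newCount r t₂ :=
      fun r => h₂.qc hA.2 (by have := hf r; omega)
    have q₃ : ∀ r, B.qc r = f.qc r + a.qc r + newCount r t₃ :=
      fun r => hd.qc l₁ (by have := hf r; rw [q₁, q₂]; omega)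
    refine ((ih₁ hA.1 fun r => by have := hf r; omega).mono ?_).append
      (((ih₂ hA.2 fun r => by have := hf r; omega).mono ?_).append ((hd.scoped.mono ?_).append
        ((ih₃ (hd.lin l₁ l₂) fun r => by
          rw [q₃, q₁, q₂]; have := hf r; omega).mono ?_)))
    all_goals
      intro r hr
      simp only [Set.mem_union, Set.mem_ofPred_eq, qc_app, q₃, q₁, q₂] at hr ⊢
      omega

/-! ### Observing lists -/

/-- The encoding of lists. -/
def tlist : List Tm → Tm
  | [] => lam 0 (lam 0 (var 0))
  | M :: Ms => lam 0 (lam 0 (app (app (var 1) (M.rename (· + 2))) ((tlist Ms).rename (· + 2))))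

/-- `λ!z.λr.λl.⟨r, l !(z !z) !⟨⟩⟩`. -/
def collector : Tm :=
  lam 0 (lam 1 (lam 1 (app (app consC (var 1))
    (app (app (var 0) (bang (app (var 2) (bang (var 2))))) (bang (tup []))))))

/-- A context that turns an encoded list into a tuple. -/
def observe (C : Tm) : Tm :=
  app (app C (bang (app collector (bang collector)))) (bang (tup []))

theorem shift_two (M : Tm) : M.rename (· + 2) = (M.rename (· + 1)).rename (· + 1) := by
  rw [rename_rename]
  rfl

theorem shift_inst_one (M N : Tm) : (M.rename (· + 1)).subst (instS [N]) = M := shift_inst [N] M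

theorem shift_two_inst (M N : Tm) :
    (M.rename (· + 2)).subst (ups 1 (instS [N])) = M.rename (· + 1) := by
  rw [shift_two, subst_shift, shift_inst_one]

/-- A list is an abstraction, whose evaluation reveals nothing. In this context it unwinds: the
self-application `K` of the collector satisfies `K r l = ⟨r, l !K !⟨⟩⟩`. One context serves all
lengths because tuples are built up by `consC`, component by component. -/
theorem observe_tlist (qs : List ℕ) : Ev (observe (tlist (qs.map qvar))) [] (tup qs) := by
  induction qs with
  | nil =>
    refine Ev.strict (t₁ := []) (t₂ := []) (t₃ := []) (t₄ := [])
      (Ev.strict (t₁ := []) (t₂ := []) (t₃ := []) (t₄ := [])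
        (.val trivial) (.val trivial) (.beta _ _) (.val trivial))
      (.val trivial) (.beta _ _) (.val trivial)
  | cons r qs ih =>
    set R := tlist (qs.map qvar) with hR
    set K := app collector (bang collector) with hK
    have e₁ : Ev (app (app K (qvar r)) R) [] (tup (r :: qs)) := by
      have hKv : Ev K [] (lam 1 (lam 1 (app (app consC (var 1))
          (app (app (var 0) (bang K)) (bang (tup [])))))) :=
        Ev.strict (t₁ := []) (t₂ := []) (t₃ := []) (t₄ := [])
          (.val trivial) (.val trivial) (.beta _ _) (.val trivial)
      have hKr : Ev (app K (qvar r)) [] (lam 1 (app (app consC (qvar r))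
          (app (app (var 0) (bang K)) (bang (tup []))))) :=
        Ev.lin (t₁ := []) (t₂ := []) hKv (.val trivial)
      refine Ev.lin (t₁ := []) (t₂ := []) hKr ?_
      refine Ev.strict (t₁ := []) (t₂ := []) (t₃ := []) (t₄ := [])
        (Ev.strict (t₁ := []) (t₂ := []) (t₃ := []) (t₄ := [])
          (.val trivial) (.val trivial) (.cons r) (.val trivial))
        ih (.pcons r qs) (.val trivial)
    have e₂ : Ev (app (tlist ((r :: qs).map qvar)) (bang K)) []
        (lam 0 (app (app (K.rename (· + 1)) (qvar r)) (R.rename (· + 1)))) := by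
      refine Ev.strict (t₁ := []) (t₂ := []) (t₃ := []) (t₄ := [])
        (.val trivial) (.val trivial) (.beta _ _) ?_
      convert Ev.val _ using 1
      · simp only [inst, subst, bw]
        rw [← shift_two_inst R K]
        rfl
      · trivial
    refine Ev.strict (t₁ := []) (t₂ := []) (t₃ := []) (t₄ := []) e₂ (.val trivial) (.beta _ _) ?_
    convert e₁ using 1
    simp only [inst, subst, shift_inst_one]

end QCalc

namespace QCalc
open Tm

/-! ### Renaming of bits and of quantum variables -/

/-- Renaming of the bits by `f` and of the quantum variables by `ρ` in an atom of tag `k`. -/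
def atomMap (f ρ : ℕ → ℕ) (k : ℕ) (l : List ℕ) : List ℕ :=
  if k = 0 ∨ k = 5 ∨ k = 6 then l.map ρ else if k = 1 then l.map f else l

def Tm.mapA (f ρ : ℕ → ℕ) : Tm → Tm
  | var i => var i
  | atom k l => atom k (atomMap f ρ k l)
  | bang M => bang (M.mapA f ρ)
  | app M N => app (M.mapA f ρ) (N.mapA f ρ)
  | lam p M => lam p (M.mapA f ρ)

def Label.map (f ρ : ℕ → ℕ) : Label → Label
  | .inl a => .inl (f a.1, ρ a.2)
  | .inr a => .inr (a.1, a.2.map ρ)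

/-- All quantum variables of a term are below `k`. -/
def Tm.Below (k : ℕ) : Tm → Prop
  | var _ => True
  | atom n l => n = 0 ∨ n = 5 ∨ n = 6 → ∀ r ∈ l, r < k
  | bang M => M.Below k
  | app M N => M.Below k ∧ N.Below k
  | lam _ M => M.Below k

theorem Tm.mapA_rename (f ρ : ℕ → ℕ) (θ : ℕ → ℕ) (M : Tm) :
    (M.rename θ).mapA f ρ = (M.mapA f ρ).rename θ := by
  induction M generalizing θ with
  | _ => simp_all [rename, mapA]

theorem Tm.mapA_subst (f ρ : ℕ → ℕ) (σ : ℕ → Tm) (M : Tm) :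
    (M.subst σ).mapA f ρ = (M.mapA f ρ).subst (fun i => (σ i).mapA f ρ) := by
  induction M generalizing σ with
  | lam p M ih =>
    simp only [subst, mapA, ih]
    congr 2
    funext i
    simp only [ups]
    split
    · rfl
    · exact mapA_rename _ _ _ _
  | _ => simp_all [subst, mapA]

theorem Tm.mapA_inst (f ρ : ℕ → ℕ) (Ns : List Tm) (M : Tm) :
    (M.inst Ns).mapA f ρ = (M.mapA f ρ).inst (Ns.map (mapA f ρ)) := by
  rw [inst, inst, mapA_subst]
  congr 1
  funext i
  simp only [instS, List.getElem?_map, List.length_map]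
  cases Ns[i]? <;> rfl

theorem Tm.mapA_tree (f ρ : ℕ → ℕ) (l : List Tm) :
    (tree l).mapA f ρ = tree (l.map (mapA f ρ)) := by
  induction l with
  | nil => rfl
  | cons N l ih =>
    simp only [tree, List.foldr_cons, List.map_cons, mapA] at *
    rw [ih]
    rfl

theorem Tm.Below.mono {k k' : ℕ} {M : Tm} (h : M.Below k) (hk : k ≤ k') : M.Below k' := by
  induction M with
  | var i => trivial
  | atom n l => exact fun hn r hr => (h hn r hr).trans_le hk
  | bang M ih => exact ih h
  | app M N ihM ihN => exact ⟨ihM h.1, ihN h.2⟩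
  | lam p M ih => exact ih h

theorem Tm.Below.rename {k : ℕ} {M : Tm} (h : M.Below k) (θ : ℕ → ℕ) : (M.rename θ).Below k := by
  induction M generalizing θ with
  | var i => trivial
  | atom n l => exact h
  | bang M ih => exact ih h _
  | app M N ihM ihN => exact ⟨ihM h.1 _, ihN h.2 _⟩
  | lam p M ih => exact ih h _

theorem Tm.Below.subst {k : ℕ} {M : Tm} (h : M.Below k) {σ : ℕ → Tm} (hσ : ∀ i, (σ i).Below k) :
    (M.subst σ).Below k := by
  induction M generalizing σ with
  | var i => exact hσ i
  | atom n l => exact h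
  | bang M ih => exact ih h hσ
  | app M N ihM ihN => exact ⟨ihM h.1 hσ, ihN h.2 hσ⟩
  | lam p M ih =>
    refine ih h fun i => ?_
    simp only [ups]
    split
    · trivial
    · exact (hσ _).rename _

theorem Tm.Below.inst {k : ℕ} {M : Tm} (h : M.Below k) {Ns : List Tm} (hN : ∀ N ∈ Ns, N.Below k) :
    (M.inst Ns).Below k := by
  refine h.subst fun i => ?_
  simp only [instS]
  cases hi : Ns[i]? with
  | none => trivial
  | some N => exact hN N (List.mem_of_getElem? hi)

theorem Tm.mapA_congr {f ρ ρ' : ℕ → ℕ} {k : ℕ} (hρ : ∀ i < k, ρ' i = ρ i) {M : Tm}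
    (h : M.Below k) : M.mapA f ρ' = M.mapA f ρ := by
  induction M with
  | var i => rfl
  | atom n l =>
    simp only [mapA, atomMap]
    split
    · rename_i hn
      rw [List.map_congr_left fun r hr => hρ r (h hn r hr)]
    · rfl
  | bang M ih => simp only [mapA, ih h]
  | app M N ihM ihN => simp only [mapA, ihM h.1, ihN h.2]
  | lam p M ih => simp only [mapA, ih h]

theorem Label.map_congr {f ρ ρ' : ℕ → ℕ} {k : ℕ} (hρ : ∀ i < k, ρ' i = ρ i) {t : List Label}
    (h : ∀ a ∈ t, ∀ r ∈ a.supp, r < k) : t.map (Label.map f ρ') = t.map (Label.map f ρ) := by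
  refine List.map_congr_left fun a ha => ?_
  have := h a ha
  cases a with
  | inl a => simp only [Label.map, hρ _ (this a.2 (by simp [Label.supp]))]
  | inr a =>
    simp only [Label.map]
    rw [List.map_congr_left (l := a.2) fun r hr => hρ r (this r hr)]

theorem Tm.mapA_eq_atom {f ρ : ℕ → ℕ} {M : Tm} {k : ℕ} {l : List ℕ} (h : M.mapA f ρ = atom k l) :
    ∃ l₀, M = atom k l₀ ∧ l = atomMap f ρ k l₀ := by
  cases M with
  | atom n l₀ =>
    simp only [mapA, atom.injEq] at h
    obtain ⟨rfl, rfl⟩ := h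
    exact ⟨l₀, rfl, rfl⟩
  | _ => simp [mapA] at h

theorem Tm.mapA_eq_lam {f ρ : ℕ → ℕ} {M : Tm} {p : ℕ} {N : Tm} (h : M.mapA f ρ = lam p N) :
    ∃ N₀, M = lam p N₀ ∧ N = N₀.mapA f ρ := by
  cases M with
  | lam n N₀ =>
    simp only [mapA, lam.injEq] at h
    obtain ⟨rfl, rfl⟩ := h
    exact ⟨N₀, rfl, rfl⟩
  | _ => simp [mapA] at h

theorem Tm.mapA_eq_bang {f ρ : ℕ → ℕ} {M N : Tm} (h : M.mapA f ρ = bang N) :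
    ∃ N₀, M = bang N₀ ∧ N = N₀.mapA f ρ := by
  cases M with
  | bang N₀ =>
    simp only [mapA, bang.injEq] at h
    exact ⟨N₀, rfl, h.symm⟩
  | _ => simp [mapA] at h

/-! ### Evaluation with canonical names of the created variables -/

/-- The number of created variables. -/
abbrev newNum (t : List Label) : ℕ := newWt (fun _ => 1) t

/-- Evaluation that names the created variables `k, k + 1, …`. -/
inductive EvC : ℕ → Tm → List Label → Tm → ℕ → Prop
  | val {k : ℕ} {v : Tm} : v.IsVal → EvC k v [] v k
  | lin {k k₁ k₂ : ℕ} {F A M v : Tm} {t₁ t₂ : List Label} :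
      EvC k F t₁ (lam 1 M) k₁ → EvC k₁ (M.inst [A]) t₂ v k₂ → EvC k (app F A) (t₁ ++ t₂) v k₂
  | strict {k k₁ k₂ k₄ : ℕ} {F A f a B v : Tm} {t₁ t₂ t₃ t₄ : List Label} :
      EvC k F t₁ f k₁ → EvC k₁ A t₂ a k₂ → Delta f a t₃ B → (∀ j r, Sum.inl (j, r) ∈ t₃ → r = k₂) →
      EvC (k₂ + newNum t₃) B t₄ v k₄ → EvC k (app F A) (t₁ ++ (t₂ ++ (t₃ ++ t₄))) v k₄

theorem EvC.ev {k k' : ℕ} {A v : Tm} {t : List Label} (h : EvC k A t v k') : Ev A t v := by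
  induction h with
  | val hv => exact .val hv
  | lin _ _ ih₁ ih₂ => exact .lin ih₁ ih₂
  | strict _ _ hd _ _ ih₁ ih₂ ih₃ => exact .strict ih₁ ih₂ hd ih₃

theorem Delta.det {f a B B' : Tm} {t t' : List Label} {k : ℕ} (h : Delta f a t B)
    (hk : ∀ j r, Sum.inl (j, r) ∈ t → r = k) (h' : Delta f a t' B')
    (hk' : ∀ j r, Sum.inl (j, r) ∈ t' → r = k) : t = t' ∧ B = B' := by
  cases h with
  | new j r =>
    cases h' with
    | new _ r' =>
      have e := hk j r (by simp)
      have e' := hk' j r' (by simp)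
      subst e e'
      exact ⟨rfl, rfl⟩
  | beta M P => cases h'; exact ⟨rfl, rfl⟩
  | pat M qs =>
    generalize hp : qs.length + 2 = p at h'
    cases h' with
    | pat => exact ⟨rfl, rfl⟩
  | _ => cases h'; exact ⟨rfl, rfl⟩

/-- No contraction by `Delta` applies to a function `lam 1 M`, so the two rules for applications
exclude each other. The only other choice, the name of a created variable, is settled by the
counter. -/
theorem EvC.det {k k' k'' : ℕ} {A v v' : Tm} {t t' : List Label} (h : EvC k A t v k')
    (h' : EvC k A t' v' k'') : t = t' ∧ v = v' ∧ k' = k'' := by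
  induction h generalizing t' v' k'' with
  | @val k v hv =>
    cases h' with
    | val => exact ⟨rfl, rfl, rfl⟩
    | lin => exact hv.elim
    | strict => exact hv.elim
  | lin _ _ ih₁ ih₂ =>
    cases h' with
    | val hv => exact hv.elim
    | lin h₁ h₂ =>
      obtain ⟨rfl, e, rfl⟩ := ih₁ h₁
      cases e
      obtain ⟨rfl, rfl, rfl⟩ := ih₂ h₂
      exact ⟨rfl, rfl, rfl⟩
    | strict h₁ _ hd =>
      obtain ⟨_, e, _⟩ := ih₁ h₁
      subst e
      cases hd
  | strict _ _ hd hn _ ih₁ ih₂ ih₃ =>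
    cases h' with
    | val hv => exact hv.elim
    | lin h₁ h₂ =>
      obtain ⟨_, e, _⟩ := ih₁ h₁
      subst e
      cases hd
    | strict h₁ h₂ hd' hn' h₃ =>
      obtain ⟨rfl, rfl, rfl⟩ := ih₁ h₁
      obtain ⟨rfl, rfl, rfl⟩ := ih₂ h₂
      obtain ⟨rfl, rfl⟩ := hd.det hn hd' hn'
      obtain ⟨rfl, rfl, rfl⟩ := ih₃ h₃
      exact ⟨rfl, rfl, rfl⟩

/-- The counter hands out each name of an interval once, so freshness of names needs no further
hypothesis. -/
theorem EvC.count {k k' : ℕ} {A v : Tm} {t : List Label} (h : EvC k A t v k') :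
    k ≤ k' ∧ ∀ r, newCount r t = if k ≤ r ∧ r < k' then 1 else 0 := by
  induction h with
  | @val k v hv => exact ⟨le_rfl, fun r => by rw [if_neg (by omega)]; rfl⟩
  | lin _ _ ih₁ ih₂ =>
    refine ⟨ih₁.1.trans ih₂.1, fun r => ?_⟩
    have := ih₁.1
    have := ih₂.1
    rw [newCount_append, ih₁.2, ih₂.2]
    split_ifs <;> omega
  | @strict k k₁ k₂ k₄ F A f a B v t₁ t₂ t₃ t₄ _ _ hd hn _ ih₁ ih₂ ih₃ =>
    have e : ∀ r, newCount r t₃ = if k₂ ≤ r ∧ r < k₂ + newNum t₃ then 1 else 0 := by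
      intro r
      cases hd with
      | new j r' =>
        have := hn j r' (by simp)
        subst this
        simp only [newCount, newNum, newWt_cons, newWt_nil, Label.newWt, Pi.single_apply]
        split_ifs <;> omega
      | gate i qs => simp [newCount, newNum, Label.newWt]
      | _ => simp [newCount, newNum]
    have := ih₁.1
    have := ih₂.1
    have := ih₃.1
    refine ⟨by omega, fun r => ?_⟩
    rw [newCount_append, newCount_append, newCount_append, ih₁.2, ih₂.2, ih₃.2, e]
    split_ifs <;> omega

/-- Contraction looks at the tags of atoms and at the lengths of tuples, but never at the bits or
names in them; in particular `new` accepts every bit. So it lifts along a renaming. Only `new`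
alters the renaming, at the unused name `k`. -/
theorem Delta.canonical {f ρ : ℕ → ℕ} {k : ℕ} {F A : Tm} {t' : List Label} {B' : Tm}
    (h : Delta (F.mapA f ρ) (A.mapA f ρ) t' B') (hF : F.Below k) (hA : A.Below k) :
    ∃ t B ρ', Delta F A t B ∧ (∀ j r, Sum.inl (j, r) ∈ t → r = k) ∧ (∀ i < k, ρ' i = ρ i) ∧
      t' = t.map (Label.map f ρ') ∧ B' = B.mapA f ρ' ∧ B.Below (k + newNum t) ∧
      ∀ a ∈ t, ∀ r ∈ a.supp, r < k + newNum t := by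
  generalize hF' : F.mapA f ρ = F' at h
  generalize hA' : A.mapA f ρ = A' at h
  cases h with
  | beta M P =>
    obtain ⟨M₀, rfl, rfl⟩ := mapA_eq_lam hF'
    obtain ⟨P₀, rfl, rfl⟩ := mapA_eq_bang hA'
    exact ⟨_, _, ρ, .beta _ _, by simp, fun _ _ => rfl, rfl, by rw [mapA_inst]; rfl,
      Below.inst (M := M₀) hF (List.forall_mem_singleton.2 hA), by simp⟩
  | pat M qs =>
    obtain ⟨M₀, rfl, rfl⟩ := mapA_eq_lam hF'
    obtain ⟨l₀, rfl, rfl⟩ := mapA_eq_atom hA'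
    have e : atomMap f ρ 6 l₀ = l₀.map ρ := rfl
    rw [e, List.length_map]
    refine ⟨_, _, ρ, .pat _ _, by simp, fun _ _ => rfl, rfl, ?_, Below.inst (M := M₀) hF ?_, by simp⟩
    · rw [mapA_inst, List.map_map, List.map_map]; rfl
    · intro N hN
      obtain ⟨r, hr, rfl⟩ := List.mem_map.1 hN
      intro _ s hs
      simp only [List.mem_singleton] at hs
      subst hs
      exact hA (by simp) s hr
  | new j r =>
    obtain ⟨l₀, rfl, e⟩ := mapA_eq_atom hF'
    obtain ⟨l₁, rfl, e'⟩ := mapA_eq_atom hA'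
    obtain rfl : [] = l₀ := e
    obtain ⟨j₀, rfl, rfl⟩ := List.map_eq_singleton_iff.1 (e'.symm : l₁.map f = [j])
    refine ⟨_, _, Function.update ρ k r, .new j₀ k, ?_, ?_, ?_, ?_, ?_, ?_⟩
    · rintro j' r' h
      simp only [List.mem_singleton, Sum.inl.injEq, Prod.mk.injEq] at h
      exact h.2
    · intro i hi
      rw [Function.update_of_ne (by omega)]
    · simp [Label.map]
    · simp [mapA, atomMap]
    · intro _ r' hr'
      simp only [List.mem_singleton] at hr'
      simp [newNum, Label.newWt, hr']
    · simp [newNum, Label.newWt, Label.supp]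
  | gate i qs =>
    obtain ⟨l₀, rfl, e⟩ := mapA_eq_atom hF'
    obtain ⟨l₁, rfl, rfl⟩ := mapA_eq_atom hA'
    obtain rfl : [i] = l₀ := e
    refine ⟨_, _, ρ, .gate i l₁, by simp, fun _ _ => rfl, rfl, ?_, ?_, ?_⟩
    · rw [mapA_tree, List.map_map]
      change qtree (l₁.map ρ) = _
      rw [qtree, List.map_map]
      rfl
    · have hl : ∀ r ∈ l₁, r < k := hA (by simp)
      clear hA hA'
      induction l₁ with
      | nil => intro _ r hr; simp at hr
      | cons a l₁ ih =>
        simp only [List.mem_cons, forall_eq_or_imp] at hl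
        refine ⟨⟨by simp [Below], ?_⟩, ih hl.2⟩
        intro _ r hr
        simp only [List.mem_singleton] at hr
        subst hr
        exact hl.1
    · simpa [newNum, Label.newWt, Label.supp] using hA (by simp)
  | cons r =>
    obtain ⟨l₀, rfl, e⟩ := mapA_eq_atom hF'
    obtain ⟨l₁, rfl, e'⟩ := mapA_eq_atom hA'
    obtain rfl : [] = l₀ := e
    obtain ⟨r₀, rfl, rfl⟩ := List.map_eq_singleton_iff.1 (e'.symm : l₁.map ρ = [r])
    exact ⟨_, _, ρ, .cons r₀, by simp, fun _ _ => rfl, rfl, rfl, fun _ => hA (by simp), by simp⟩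
  | pcons r qs =>
    obtain ⟨l₀, rfl, e⟩ := mapA_eq_atom hF'
    obtain ⟨l₁, rfl, rfl⟩ := mapA_eq_atom hA'
    obtain ⟨r₀, rfl, rfl⟩ := List.map_eq_singleton_iff.1 (e.symm : l₀.map ρ = [r])
    refine ⟨_, _, ρ, .pcons r₀ l₁, by simp, fun _ _ => rfl, rfl, rfl, fun _ r' hr' => ?_, by simp⟩
    rcases List.mem_cons.1 hr' with rfl | hr'
    · exact hF (by simp) _ (by simp)
    · exact hA (by simp) _ hr'

/-- Every evaluation of an instance of a term comes from the canonical evaluation of this term. -/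
theorem Ev.canonical {f : ℕ → ℕ} {A' v' : Tm} {t' : List Label} (h : Ev A' t' v') {ρ : ℕ → ℕ}
    {k : ℕ} {A : Tm} (hA : A' = A.mapA f ρ) (hk : A.Below k) :
    ∃ t v k' ρ', EvC k A t v k' ∧ (∀ i < k, ρ' i = ρ i) ∧ t' = t.map (Label.map f ρ') ∧
      v' = v.mapA f ρ' ∧ v.Below k' ∧ ∀ a ∈ t, ∀ r ∈ a.supp, r < k' := by
  induction h generalizing ρ k A with
  | val hv =>
    subst hA
    refine ⟨[], A, k, ρ, .val ?_, fun _ _ => rfl, rfl, rfl, hk, by simp⟩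
    cases A <;> trivial
  | @lin F' A₁ M' v' t₁ t₂ _ _ ih₁ ih₂ =>
    cases A with
    | app F N =>
      simp only [mapA, app.injEq] at hA
      obtain ⟨rfl, rfl⟩ := hA
      obtain ⟨t₁, v₁, k₁, ρ₁, e₁, hρ₁, rfl, hv₁, b₁, s₁⟩ := ih₁ rfl hk.1
      obtain ⟨M, rfl, rfl⟩ := mapA_eq_lam hv₁.symm
      have c₁ := e₁.count.1
      obtain ⟨t₂, v₂, k₂, ρ₂, e₂, hρ₂, rfl, rfl, b₂, s₂⟩ :=
        ih₂ (ρ := ρ₁) (k := k₁) (A := M.inst [N])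
          (by rw [mapA_inst, List.map_singleton, mapA_congr hρ₁ hk.2])
          (Below.inst (M := M) b₁ (by simpa using hk.2.mono c₁))
      have c₂ := e₂.count.1
      refine ⟨_, _, _, ρ₂, .lin e₁ e₂, fun i hi => ?_, ?_, rfl, b₂, ?_⟩
      · rw [hρ₂ i (by omega), hρ₁ i hi]
      · rw [List.map_append, Label.map_congr hρ₂ s₁]
      · intro a ha r hr
        rcases List.mem_append.1 ha with ha | ha
        · exact (s₁ a ha r hr).trans_le c₂
        · exact s₂ a ha r hr
    | _ => simp [mapA] at hA
  | @strict F' A₁ f' a' B' v' t₁ t₂ t₃ t₄ _ _ hd _ ih₁ ih₂ ih₃ =>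
    cases A with
    | app F N =>
      simp only [mapA, app.injEq] at hA
      obtain ⟨rfl, rfl⟩ := hA
      obtain ⟨t₁, v₁, k₁, ρ₁, e₁, hρ₁, rfl, rfl, b₁, s₁⟩ := ih₁ rfl hk.1
      have c₁ := e₁.count.1
      obtain ⟨t₂, v₂, k₂, ρ₂, e₂, hρ₂, rfl, rfl, b₂, s₂⟩ :=
        ih₂ (ρ := ρ₁) (mapA_congr hρ₁ hk.2).symm (hk.2.mono c₁)
      have c₂ := e₂.count.1
      -- Later renamings agree with earlier ones on the names in use before, so the latest one may
      -- be used for all parts.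
      rw [← mapA_congr hρ₂ b₁] at hd
      obtain ⟨t₃, B, ρ₃, hd', hn, hρ₃, rfl, rfl, b₃, s₃⟩ := hd.canonical (b₁.mono c₂) b₂
      obtain ⟨t₄, v₄, k₄, ρ₄, e₄, hρ₄, rfl, rfl, b₄, s₄⟩ := ih₃ rfl b₃
      have c₄ := e₄.count.1
      refine ⟨_, _, _, ρ₄, .strict e₁ e₂ hd' hn e₄, fun i hi => ?_, ?_, rfl, b₄, ?_⟩
      · rw [hρ₄ i (by omega), hρ₃ i (by omega), hρ₂ i (by omega), hρ₁ i hi]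
      · rw [List.map_append, List.map_append, List.map_append, Label.map_congr hρ₄ s₃,
          ← Label.map_congr hρ₂ s₁, ← Label.map_congr (k := k₂) (ρ' := ρ₄) (ρ := ρ₂) _ s₂,
          ← Label.map_congr (k := k₁) (ρ' := ρ₄) (ρ := ρ₂) _ s₁]
        · intro i hi
          rw [hρ₄ i (by omega), hρ₃ i (by omega)]
        · intro i hi
          rw [hρ₄ i (by omega), hρ₃ i (by omega)]
      · intro a ha r hr
        simp only [List.mem_append] at ha
        rcases ha with ha | ha | ha | ha
        · have := s₁ a ha r hr; omega
        · have := s₂ a ha r hr; omega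
        · have := s₃ a ha r hr; omega
        · exact s₄ a ha r hr
    | _ => simp [mapA] at hA

/-! ### The gates in a term -/

/-- All gates of a term have an index in `G`. -/
def Tm.GatesIn (G : Set ℕ) : Tm → Prop
  | var _ => True
  | atom n l => n = 2 → ∀ i ∈ l, i ∈ G
  | bang M => M.GatesIn G
  | app M N => M.GatesIn G ∧ N.GatesIn G
  | lam _ M => M.GatesIn G

theorem Tm.GatesIn.rename {G : Set ℕ} {M : Tm} (h : M.GatesIn G) (θ : ℕ → ℕ) :
    (M.rename θ).GatesIn G := by
  induction M generalizing θ with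
  | var i => trivial
  | atom n l => exact h
  | bang M ih => exact ih h _
  | app M N ihM ihN => exact ⟨ihM h.1 _, ihN h.2 _⟩
  | lam p M ih => exact ih h _

theorem Tm.GatesIn.subst {G : Set ℕ} {M : Tm} (h : M.GatesIn G) {σ : ℕ → Tm}
    (hσ : ∀ i, (σ i).GatesIn G) : (M.subst σ).GatesIn G := by
  induction M generalizing σ with
  | var i => exact hσ i
  | atom n l => exact h
  | bang M ih => exact ih h hσ
  | app M N ihM ihN => exact ⟨ihM h.1 hσ, ihN h.2 hσ⟩
  | lam p M ih =>
    refine ih h fun i => ?_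
    simp only [ups]
    split
    · trivial
    · exact (hσ _).rename _

theorem Tm.GatesIn.inst {G : Set ℕ} {M : Tm} (h : M.GatesIn G) {Ns : List Tm}
    (hN : ∀ N ∈ Ns, N.GatesIn G) : (M.inst Ns).GatesIn G := by
  refine h.subst fun i => ?_
  simp only [instS]
  cases hi : Ns[i]? with
  | none => trivial
  | some N => exact hN N (List.mem_of_getElem? hi)

theorem Tm.GatesIn.mono {G G' : Set ℕ} {M : Tm} (h : M.GatesIn G) (hG : G ⊆ G') :
    M.GatesIn G' := by
  induction M with
  | var i => trivial
  | atom n l => exact fun hn i hi => hG (h hn i hi)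
  | bang M ih => exact ih h
  | app M N ihM ihN => exact ⟨ihM h.1, ihN h.2⟩
  | lam p M ih => exact ih h

theorem Tm.GatesIn.qtree (G : Set ℕ) (qs : List ℕ) : (qtree qs).GatesIn G := by
  induction qs with
  | nil => simp [tree, GatesIn]
  | cons a qs ih => exact ⟨⟨by simp [GatesIn], by simp [GatesIn]⟩, ih⟩

theorem Tm.GatesIn.exists_finite (M : Tm) : ∃ G : Set ℕ, G.Finite ∧ M.GatesIn G := by
  induction M with
  | var i => exact ⟨∅, Set.finite_empty, trivial⟩
  | atom n l => exact ⟨{i | i ∈ l}, l.finite_toSet, fun _ _ h => h⟩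
  | bang M ih => exact ih
  | app M N ihM ihN =>
    obtain ⟨G, hG, hM⟩ := ihM
    obtain ⟨G', hG', hN⟩ := ihN
    exact ⟨G ∪ G', hG.union hG', hM.mono Set.subset_union_left, hN.mono Set.subset_union_right⟩
  | lam p M ih => exact ih

/-- Evaluation copies gate symbols but makes no new ones. This is the source of finite generation.
-/
theorem Ev.gatesIn {G : Set ℕ} {A v : Tm} {t : List Label} (h : Ev A t v) (hA : A.GatesIn G) :
    v.GatesIn G ∧ ∀ i qs, Sum.inr (i, qs) ∈ t → i ∈ G := by
  induction h with
  | val _ => exact ⟨hA, by simp⟩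
  | @lin F A M v t₁ t₂ _ _ ih₁ ih₂ =>
    obtain ⟨l₁, m₁⟩ := ih₁ hA.1
    obtain ⟨l₂, m₂⟩ := ih₂ (GatesIn.inst (G := G) (M := M) l₁ (by simpa using hA.2))
    refine ⟨l₂, fun i qs h => ?_⟩
    rcases List.mem_append.1 h with h | h
    exacts [m₁ i qs h, m₂ i qs h]
  | @strict F A f a B v t₁ t₂ t₃ t₄ _ _ hd _ ih₁ ih₂ ih₃ =>
    obtain ⟨l₁, m₁⟩ := ih₁ hA.1
    obtain ⟨l₂, m₂⟩ := ih₂ hA.2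
    have h₃ : B.GatesIn G ∧ ∀ i qs, Sum.inr (i, qs) ∈ t₃ → i ∈ G := by
      cases hd with
      | beta M P => exact ⟨GatesIn.inst (M := M) l₁ (List.forall_mem_singleton.2 l₂), by simp⟩
      | pat M qs => exact ⟨GatesIn.inst (M := M) l₁ (by simp [GatesIn]), by simp⟩
      | gate i qs =>
        refine ⟨.qtree G qs, fun i' qs' h => ?_⟩
        simp only [List.mem_singleton, Sum.inr.injEq, Prod.mk.injEq] at h
        exact l₁ rfl i' (by simp [h.1])
      | _ => exact ⟨by simp [GatesIn], by simp⟩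
    obtain ⟨l₄, m₄⟩ := ih₃ h₃.1
    refine ⟨l₄, fun i qs h => ?_⟩
    simp only [List.mem_append] at h
    rcases h with h | h | h | h
    exacts [m₁ i qs h, m₂ i qs h, h₃.2 i qs h, m₄ i qs h]

end QCalc

/-! ### The translation of the calculus. -/

namespace QCalc
open Tm

/-- The code of a binder. -/
def Binder.code : Binder → ℕ
  | .bang => 0
  | .lin => 1
  | .tup n => n + 2

theorem Binder.bw_code (p : Binder) : bw p.code = p.width := by
  cases p <;> rfl

namespace Term

/-- The translation of terms. -/
def tr : Term → Tm
  | var i => .var i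
  | qvar r => .qvar r
  | bang M => .bang M.tr
  | bit b => .bit b.toNat
  | gate i => .gate i
  | new M => .app .newC M.tr
  | app M N => .app M.tr N.tr
  | tuple _ Ms => .tree (List.ofFn fun i => (Ms i).tr)
  | lam p M => .lam p.code M.tr

theorem tr_rename (ρ : ℕ → ℕ) (M : Term) : (M.rename ρ).tr = M.tr.rename ρ := by
  induction M generalizing ρ with
  | tuple n Ms ih =>
    simp only [rename, tr, ih, rename_eq_subst, tree_subst, List.map_ofFn]
    rfl
  | lam p M ih =>
    simp only [rename, tr, ih, Tm.rename, p.bw_code]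
    rfl
  | _ => simp_all [rename, tr, Tm.rename]

theorem tr_subst (σ : ℕ → Term) (M : Term) :
    (M.subst σ).tr = M.tr.subst (fun i => (σ i).tr) := by
  induction M generalizing σ with
  | tuple n Ms ih =>
    simp only [subst, tr, ih, tree_subst, List.map_ofFn]
    rfl
  | lam p M ih =>
    simp only [subst, tr, ih, Tm.subst, p.bw_code]
    congr 2
    funext i
    simp only [ups]
    split
    · rfl
    · exact tr_rename _ _
  | _ => simp_all [subst, tr, Tm.subst]

theorem tr_inst {k : ℕ} (Ns : Fin k → Term) (M : Term) :
    (M.inst Ns).tr = M.tr.inst (List.ofFn fun i => (Ns i).tr) := by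
  rw [inst, tr_subst, Tm.inst]
  congr 1
  funext i
  simp only [instS, List.length_ofFn, List.getElem?_ofFn]
  split <;> rfl

theorem tr_list (Ms : List Term) : (Term.list Ms).tr = tlist (Ms.map tr) := by
  induction Ms with
  | nil => rfl
  | cons M Ms ih =>
    simp only [Term.list, tr, shift, tr_rename, ih]
    rfl

end Term

/-! ### Well-formed terms are linear -/

/-- The number of items that make the classical variable `x` linear. -/
def Item.linCount (x : ℕ) : Item → ℕ
  | .var y => if y = x then 1 else 0
  | .pat ys => ys.count x
  | _ => 0

/-- The number of occurrences of `!x`. -/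
def Item.bangCount (x : ℕ) : Item → ℕ
  | .bang y => if y = x then 1 else 0
  | _ => 0

/-- The number of occurrences of the quantum variable `r`. -/
def Item.qCount (r : ℕ) : Item → ℕ
  | .qvar s => if s = r then 1 else 0
  | _ => 0

def Env.linCount (x : ℕ) (Γ : Env) : ℕ := (Γ.map (Item.linCount x)).sum
def Env.bangCount (x : ℕ) (Γ : Env) : ℕ := (Γ.map (Item.bangCount x)).sum
def Env.qCount (r : ℕ) (Γ : Env) : ℕ := (Γ.map (Item.qCount r)).sum

section
variable (x : ℕ) (Γ Δ : Env) (I : Item)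

@[simp] theorem Env.linCount_add :
    Env.linCount x (Γ + Δ) = Env.linCount x Γ + Env.linCount x Δ := by simp [Env.linCount]
@[simp] theorem Env.bangCount_add :
    Env.bangCount x (Γ + Δ) = Env.bangCount x Γ + Env.bangCount x Δ := by simp [Env.bangCount]
@[simp] theorem Env.qCount_add :
    Env.qCount x (Γ + Δ) = Env.qCount x Γ + Env.qCount x Δ := by simp [Env.qCount]
@[simp] theorem Env.linCount_singleton : Env.linCount x {I} = I.linCount x := by
  simp [Env.linCount]
@[simp] theorem Env.bangCount_singleton : Env.bangCount x {I} = I.bangCount x := by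
  simp [Env.bangCount]
@[simp] theorem Env.qCount_singleton : Env.qCount x {I} = I.qCount x := by
  simp [Env.qCount]

theorem Env.linCount_sum {k : ℕ} (Γ : Fin k → Env) :
    Env.linCount x (∑ i, Γ i) = ∑ i, Env.linCount x (Γ i) :=
  map_sum (⟨⟨Env.linCount x, rfl⟩, Env.linCount_add x⟩ : Env →+ ℕ) _ _
theorem Env.bangCount_sum {k : ℕ} (Γ : Fin k → Env) :
    Env.bangCount x (∑ i, Γ i) = ∑ i, Env.bangCount x (Γ i) :=
  map_sum (⟨⟨Env.bangCount x, rfl⟩, Env.bangCount_add x⟩ : Env →+ ℕ) _ _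
theorem Env.qCount_sum {k : ℕ} (Γ : Fin k → Env) :
    Env.qCount x (∑ i, Γ i) = ∑ i, Env.qCount x (Γ i) :=
  map_sum (⟨⟨Env.qCount x, rfl⟩, Env.qCount_add x⟩ : Env →+ ℕ) _ _

theorem Item.count_names : I.names.count (Sum.inl x) = I.linCount x + I.bangCount x := by
  cases I with
  | var y => simp [Item.names, Item.linCount, Item.bangCount, Multiset.count_singleton, eq_comm]
  | pat ys =>
    simp only [Item.names, Item.linCount, Item.bangCount, add_zero]
    rw [Multiset.count_map_eq_count' _ _ Sum.inl_injective, Multiset.coe_count]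
  | bang y => simp [Item.names, Item.linCount, Item.bangCount, Multiset.count_singleton, eq_comm]
  | qvar r => simp [Item.names, Item.linCount, Item.bangCount]

theorem Env.count_names :
    (Γ.bind Item.names).count (Sum.inl x) = Env.linCount x Γ + Env.bangCount x Γ := by
  induction Γ using Multiset.induction_on with
  | empty => rfl
  | cons I Γ ih =>
    simp only [Multiset.cons_bind, Multiset.count_add, ih, Item.count_names, Env.linCount,
      Env.bangCount, Multiset.map_cons, Multiset.sum_cons]
    omega

theorem Env.Valid.count_le (h : Env.Valid Γ) : Env.linCount x Γ + Env.bangCount x Γ ≤ 1 := by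
  rw [← Env.count_names]
  exact Multiset.nodup_iff_count_le_one.1 h _

end

theorem Env.Valid.mono {Γ Δ : Env} (h : (Γ + Δ).Valid) : Γ.Valid := by
  rw [Env.Valid, Multiset.add_bind] at h
  exact (Multiset.nodup_add.1 h).1

theorem Env.valid_of_names {Γ : Env} {I : Item} {Δ : Env} (h : (Γ + Δ).Valid)
    (hI : I.names = Δ.bind Item.names) : (Γ + {I}).Valid := by
  rw [Env.Valid, Multiset.add_bind, Multiset.singleton_bind, hI, ← Multiset.add_bind]
  exact h

theorem bind_map_var (xs : List ℕ) :
    Multiset.bind ((xs.map Item.var : List Item) : Multiset Item) Item.names =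
      (xs : Multiset ℕ).map Sum.inl := by
  induction xs with
  | nil => rfl
  | cons x xs ih =>
    simp only [List.map_cons, ← Multiset.cons_coe, Multiset.cons_bind, ih, Multiset.map_cons,
      Item.names, Multiset.singleton_add]

/-- Axioms have at most one name, and the rules without a validity condition keep the names of the
environment or drop some of them. -/
theorem WF.valid {Γ : Env} {M : Term} (h : WF Γ M) : Γ.Valid := by
  induction h with
  | bit b => exact Multiset.nodup_zero
  | gate i => exact Multiset.nodup_zero
  | qvar r => simp [Env.Valid, Item.names]
  | var x => simp [Env.Valid, Item.names]
  | weak x _ h _ => exact h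
  | contr x y z _ h _ => exact h
  | prom xs _ ih => exact ih
  | der x _ ih => exact Env.valid_of_names ih rfl
  | tensL xs _ _ ih => exact Env.valid_of_names ih (bind_map_var xs).symm
  | tensR _ _ _ _ h _ => exact h
  | new _ ih => exact ih
  | lamVar x _ ih => exact ih.mono
  | lamPat xs _ ih => exact ih.mono
  | lamBang x _ ih => exact ih.mono
  | app _ _ h _ _ => exact h

theorem Env.linCount_map_var (x : ℕ) (xs : List ℕ) :
    Env.linCount x ((xs.map Item.var : List Item) : Multiset Item) = xs.count x := by
  induction xs with
  | nil => rfl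
  | cons y xs ih =>
    rw [List.map_cons, ← Multiset.cons_coe, ← Multiset.singleton_add, Env.linCount_add, ih,
      Env.linCount_singleton, Item.linCount, List.count_cons, add_comm]
    simp

theorem Env.bangCount_map_var (x : ℕ) (xs : List ℕ) :
    Env.bangCount x ((xs.map Item.var : List Item) : Multiset Item) = 0 := by
  induction xs with
  | nil => rfl
  | cons y xs ih =>
    rw [List.map_cons, ← Multiset.cons_coe, ← Multiset.singleton_add, Env.bangCount_add, ih,
      Env.bangCount_singleton]
    rfl

theorem Env.qCount_map_var (x : ℕ) (xs : List ℕ) :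
    Env.qCount x ((xs.map Item.var : List Item) : Multiset Item) = 0 := by
  induction xs with
  | nil => rfl
  | cons y xs ih =>
    rw [List.map_cons, ← Multiset.cons_coe, ← Multiset.singleton_add, Env.qCount_add, ih,
      Env.qCount_singleton]
    rfl

theorem Env.linCount_map_bang (x : ℕ) (xs : Multiset ℕ) :
    Env.linCount x (xs.map Item.bang) = 0 := by
  simp [Env.linCount, Item.linCount, Function.comp_def]

theorem Env.qCount_map_bang (x : ℕ) (xs : Multiset ℕ) :
    Env.qCount x (xs.map Item.bang) = 0 := by
  simp [Env.qCount, Item.qCount, Function.comp_def]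

namespace Tm

theorem qc_rename (r : ℕ) (ρ : ℕ → ℕ) (M : Tm) : (M.rename ρ).qc r = M.qc r := by
  rw [qc, wt_rename]
  rfl

theorem occ_app (x : ℕ) (M N : Tm) : (app M N).occ x = M.occ x + N.occ x := rfl
theorem occ_bang (x : ℕ) (M : Tm) : (bang M).occ x = 2 * M.occ x := rfl
theorem qc_bang (x : ℕ) (M : Tm) : (bang M).qc x = 2 * M.qc x := rfl

theorem occ_tree (x : ℕ) (l : List Tm) : (tree l).occ x = (l.map (occ x)).sum := wt_tree _ _ _
theorem qc_tree (x : ℕ) (l : List Tm) : (tree l).qc x = (l.map (qc x)).sum := wt_tree _ _ _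

/-- Variable counts in the body of an abstraction that binds named variables. -/
theorem occ_bindVars (w : ℕ) (xs : List ℕ) (M : Tm) :
    (M.rename fun y => if y ∈ xs then xs.idxOf y else y + xs.length).occ (w + xs.length) =
      if w ∈ xs then 0 else M.occ w := by
  rw [occ, wt_rename]
  split
  · rename_i hw
    refine (congrArg (fun ω => M.wt _ ω) ?_).trans M.wt_zero
    funext y
    simp only [Function.comp, Pi.single_apply]
    split
    · rename_i hy
      have := List.idxOf_lt_length_iff.2 hy
      rw [if_neg (by omega)]
    · rename_i hy
      rw [if_neg]
      intro e
      exact hy ((by omega : y = w) ▸ hw)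
  · rename_i hw
    rw [occ]
    congr 1
    funext y
    simp only [Function.comp, Pi.single_apply]
    split
    · rename_i hy
      have := List.idxOf_lt_length_iff.2 hy
      rw [if_neg (by omega), if_neg]
      rintro rfl
      exact hw hy
    · congr 1
      apply propext
      omega

theorem occ_bindVars_bound {xs : List ℕ} (hxs : xs.Nodup) (M : Tm) {j : ℕ} (hj : j < xs.length) :
    (M.rename fun y => if y ∈ xs then xs.idxOf y else y + xs.length).occ j = M.occ xs[j] := by
  rw [occ, wt_rename, occ]
  congr 1
  funext y
  simp only [Function.comp, Pi.single_apply]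
  split
  · rename_i hy
    congr 1
    apply propext
    constructor
    · rintro rfl
      simp
    · rintro rfl
      exact hxs.idxOf_getElem j hj
  · rename_i hy
    rw [if_neg (by omega), if_neg]
    rintro rfl
    exact hy (List.getElem_mem _)

theorem Lin.lam_bindVars {M : Tm} (hM : M.Lin) {xs : List ℕ} (hxs : xs.Nodup) {p : ℕ}
    (hp : p ≠ 0 → bw p = xs.length) (h : p ≠ 0 → ∀ x ∈ xs, M.occ x = 1) :
    (Tm.lam p (M.rename fun y => if y ∈ xs then xs.idxOf y else y + xs.length)).Lin := by
  refine ⟨hM.rename _, fun h0 i hi => ?_⟩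
  rw [hp h0] at hi
  rw [occ_bindVars_bound hxs _ hi]
  exact h h0 _ (List.getElem_mem _)

end Tm

/-- Linearity alone is not inductive, so it is proved together with exact counts: a classical
variable that is not banged occurs as often as the environment says, patterns included, and so does
each quantum variable. Validity of the environment makes the count of a variable equal to one when
it gets bound. Nothing is claimed for banged variables. -/
theorem WF.lin {Γ : Env} {M : Term} (h : WF Γ M) :
    M.tr.Lin ∧ (∀ x, Env.bangCount x Γ = 0 → M.tr.occ x = Env.linCount x Γ) ∧
      ∀ r, M.tr.qc r = Env.qCount r Γ := by
  induction h with
  | bit b => exact ⟨trivial, fun _ _ => rfl, fun _ => rfl⟩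
  | gate i => exact ⟨trivial, fun _ _ => rfl, fun _ => rfl⟩
  | qvar r =>
    refine ⟨trivial, fun x _ => ?_, fun s => ?_⟩
    · simp [Term.tr, occ, wt, Item.linCount]
    · simp [Term.tr, qc, wt, Item.qCount, Pi.single_apply]
  | var x =>
    refine ⟨trivial, fun y _ => ?_, fun s => ?_⟩
    · simp [Term.tr, occ, wt, Item.linCount, Pi.single_apply]
    · simp [Term.tr, qc, wt, Item.qCount]
  | weak x _ _ ih =>
    refine ⟨ih.1, fun y hy => ?_, fun r => ?_⟩
    · simp only [Env.bangCount_add, Nat.add_eq_zero_iff] at hy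
      simp [ih.2.1 y hy.1, Item.linCount]
    · simp [ih.2.2 r, Item.qCount]
  | @contr Γ M x y z hM _ ih =>
    refine ⟨?_, fun w hw => ?_, fun r => ?_⟩
    · rw [Term.tr_rename]
      exact ih.1.rename _
    · simp only [Env.bangCount_add, Env.bangCount_singleton, Item.bangCount,
        Nat.add_eq_zero_iff, ite_eq_right_iff, one_ne_zero, imp_false] at hw
      have hv := hM.valid.count_le w
      simp only [Env.bangCount_add, Env.bangCount_singleton, Env.linCount_add,
        Env.linCount_singleton, Item.bangCount, Item.linCount] at hv
      rw [Term.tr_rename, occ, wt_rename]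
      simp only [Env.linCount_add, Env.linCount_singleton, Item.linCount, add_zero]
      -- The contracted names have left the term, and validity of the premise excludes them from the
      -- linear part of `Γ`; both counts are zero.
      by_cases hxy : w = x ∨ w = y
      · have h0 : Env.linCount w Γ = 0 := by
          rcases hxy with rfl | rfl
          · rw [if_pos rfl] at hv
            omega
          · rw [if_pos (rfl : w = w)] at hv
            omega
        rw [h0]
        refine (congrArg (fun ω => M.tr.wt _ ω) ?_).trans M.tr.wt_zero
        funext i
        simp only [Function.comp, Pi.single_apply]
        split
        · rw [if_neg hw.2]
        · rename_i hi
          rw [if_neg]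
          rintro rfl
          exact hi hxy
      · have e := ih.2.1 w (by
          simp only [Env.bangCount_add, Env.bangCount_singleton, Item.bangCount, hw.1]
          rw [if_neg fun e => hxy (.inl e.symm), if_neg fun e => hxy (.inr e.symm)])
        simp only [Env.linCount_add, Env.linCount_singleton, Item.linCount, add_zero] at e
        rw [← e, occ]
        congr 1
        funext i
        simp only [Function.comp, Pi.single_apply]
        split
        · rename_i hi
          rw [if_neg hw.2, if_neg]
          rintro rfl
          exact hxy hi
        · rfl
    · rw [Term.tr_rename, qc_rename, ih.2.2]
      simp [Item.qCount]
  | @prom M xs _ ih =>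
    refine ⟨ih.1, fun x hx => ?_, fun r => ?_⟩
    -- Below `!` only banged variables are in scope, so the count that gets doubled is zero.
    · rw [Term.tr, occ_bang, ih.2.1 x hx, Env.linCount_map_bang]
    · rw [Term.tr, qc_bang, ih.2.2 r, Env.qCount_map_bang]
  | @der Γ M x _ ih =>
    refine ⟨ih.1, fun y hy => ?_, fun r => ?_⟩
    · simp only [Env.bangCount_add, Env.bangCount_singleton, Item.bangCount,
        Nat.add_eq_zero_iff, ite_eq_right_iff, one_ne_zero, imp_false] at hy
      rw [ih.2.1 y (by simp [hy.1, Item.bangCount])]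
      simp [Item.linCount, hy.2]
    · rw [ih.2.2]
      simp [Item.qCount]
  | @tensL Γ M xs _ _ ih =>
    refine ⟨ih.1, fun y hy => ?_, fun r => ?_⟩
    · simp only [Env.bangCount_add, Nat.add_eq_zero_iff] at hy
      rw [ih.2.1 y (by rw [Env.bangCount_add, Env.bangCount_map_var, hy.1])]
      simp [Env.linCount_map_var, Item.linCount]
    · rw [ih.2.2]
      simp [Env.qCount_map_var, Item.qCount]
  | @tensR k _ Γ Ms _ _ ih =>
    refine ⟨Lin.tree fun N hN => ?_, fun x hx => ?_, fun r => ?_⟩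
    · obtain ⟨i, rfl⟩ := (List.mem_ofFn' _ _).1 hN
      exact (ih i).1
    · rw [Env.bangCount_sum, Finset.sum_eq_zero_iff] at hx
      rw [Term.tr, occ_tree, List.map_ofFn, List.sum_ofFn, Env.linCount_sum]
      exact Finset.sum_congr rfl fun i hi => (ih i).2.1 x (hx i hi)
    · rw [Term.tr, qc_tree, List.map_ofFn, List.sum_ofFn, Env.qCount_sum]
      exact Finset.sum_congr rfl fun i _ => (ih i).2.2 r
  | @new Γ M _ ih =>
    refine ⟨⟨trivial, ih.1⟩, fun x hx => ?_, fun r => ?_⟩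
    · rw [← ih.2.1 x hx, Term.tr, occ_app]
      exact Nat.zero_add _
    · rw [← ih.2.2 r, Term.tr, qc_app]
      exact Nat.zero_add _
  | @lamVar Γ M x hM ih =>
    have hv := fun w => hM.valid.count_le w
    simp only [Env.bangCount_add, Env.bangCount_singleton, Env.linCount_add,
      Env.linCount_singleton, Item.bangCount, Item.linCount] at hv
    refine ⟨?_, fun w hw => ?_, fun r => ?_⟩
    · rw [Term.tr, Term.bindVars, Term.tr_rename]
      refine ih.1.lam_bindVars (by simp) (fun _ => rfl) fun _ y hy => ?_
      rw [List.mem_singleton] at hy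
      subst hy
      have := hv y
      rw [if_pos rfl] at this
      rw [ih.2.1 y (by simp only [Env.bangCount_add, Env.bangCount_singleton, Item.bangCount]; omega)]
      simp only [Env.linCount_add, Env.linCount_singleton, Item.linCount, if_true]
      omega
    · rw [Term.tr, Term.bindVars, Term.tr_rename, occ_lam]
      refine (occ_bindVars w [x] _).trans ?_
      split
      · rename_i h
        rw [List.mem_singleton] at h
        subst h
        have := hv w
        rw [if_pos rfl] at this
        omega
      · rename_i h
        rw [ih.2.1 w (by simp [hw, Item.bangCount])]
        simp only [List.mem_singleton] at h
        simp [Item.linCount, Ne.symm h]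
    · rw [Term.tr, Term.bindVars, Term.tr_rename, qc_lam, qc_rename, ih.2.2]
      simp [Item.qCount]
  | @lamPat Γ M xs hM ih =>
    have hv := fun w => hM.valid.count_le w
    simp only [Env.bangCount_add, Env.bangCount_singleton, Env.linCount_add,
      Env.linCount_singleton, Item.bangCount, Item.linCount] at hv
    have hnd : xs.Nodup := List.nodup_iff_count_le_one.2 fun w => by
      have := hv w
      omega
    refine ⟨?_, fun w hw => ?_, fun r => ?_⟩
    · rw [Term.tr, Term.bindVars, Term.tr_rename]
      refine ih.1.lam_bindVars hnd (fun _ => rfl) fun _ y hy => ?_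
      have h1 := List.count_pos_iff.2 hy
      have := hv y
      rw [ih.2.1 y (by simp only [Env.bangCount_add, Env.bangCount_singleton, Item.bangCount]; omega)]
      simp only [Env.linCount_add, Env.linCount_singleton, Item.linCount]
      omega
    · rw [Term.tr, Term.bindVars, Term.tr_rename, occ_lam]
      refine (occ_bindVars w xs _).trans ?_
      split
      · rename_i h
        have h1 := List.count_pos_iff.2 h
        have := hv w
        omega
      · rename_i h
        rw [ih.2.1 w (by simp [hw, Item.bangCount])]
        simp [Item.linCount, List.count_eq_zero.2 h]
    · rw [Term.tr, Term.bindVars, Term.tr_rename, qc_lam, qc_rename, ih.2.2]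
      simp [Item.qCount]
  | @lamBang Γ M x hM ih =>
    have hv := fun w => hM.valid.count_le w
    simp only [Env.bangCount_add, Env.bangCount_singleton, Env.linCount_add,
      Env.linCount_singleton, Item.bangCount, Item.linCount] at hv
    refine ⟨?_, fun w hw => ?_, fun r => ?_⟩
    · rw [Term.tr, Term.bindVars, Term.tr_rename]
      exact ih.1.lam_bindVars (by simp) (fun h => (h rfl).elim) fun h => (h rfl).elim
    · rw [Term.tr, Term.bindVars, Term.tr_rename, occ_lam]
      refine (occ_bindVars w [x] _).trans ?_
      split
      · rename_i h
        rw [List.mem_singleton] at h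
        subst h
        have := hv w
        rw [if_pos rfl] at this
        omega
      · rename_i h
        simp only [List.mem_singleton] at h
        rw [ih.2.1 w (by simp [hw, Item.bangCount, Ne.symm h])]
        simp [Item.linCount]
    · rw [Term.tr, Term.bindVars, Term.tr_rename, qc_lam, qc_rename, ih.2.2]
      simp [Item.qCount]
  | app _ _ _ ih₁ ih₂ =>
    refine ⟨⟨ih₁.1, ih₂.1⟩, fun x hx => ?_, fun r => ?_⟩
    · simp only [Env.bangCount_add, Nat.add_eq_zero_iff] at hx
      rw [Term.tr, occ_app, ih₁.2.1 x hx.1, ih₂.2.1 x hx.2, Env.linCount_add]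
    · rw [Term.tr, qc_app, ih₁.2.2, ih₂.2.2, Env.qCount_add]

end QCalc

namespace QCalc
open Tm

/-! ### The action of traces on states -/

/-- States of countably many quantum variables. -/
abbrev QState : Type := (ℕ → Bool) → ℂ

open Classical in
/-- A vector in `H(V)` as a state in which the variables outside of `V` have the value `0`. -/
noncomputable def hat {V : Finset ℕ} (φ : Reg V) : QState := fun f =>
  if ∀ r, r ∉ V → f r = false then φ (fun v => f v) else 0

/-- The action of the matrix `U` on the quantum variables `g`. -/
noncomputable def gateAct {n : ℕ} (U : Matrix (Fin n → Bool) (Fin n → Bool) ℂ) (g : Fin n → ℕ)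
    (ψ : QState) : QState := fun f =>
  ∑ b : Fin n → Bool, U (fun j => f (g j)) b * ψ (Function.extend g b f)

/-- The action of the creation of `r` with the value `b`. -/
noncomputable def newAct (b : Bool) (r : ℕ) (ψ : QState) : QState := fun f =>
  if f r = b then ψ (Function.update f r false) else 0

/-- The action of a label, where `β` gives the values of the bits. -/
noncomputable def Label.act (E : GateEnum) (β : ℕ → Bool) : Label → QState → QState
  | .inl a, ψ => newAct (β a.1) a.2 ψ
  | .inr a, ψ =>
    if h : a.2.length = E.arity a.1 then
      gateAct (E.mat a.1) (fun j => a.2.get (Fin.cast h.symm j)) ψ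
    else ψ

noncomputable def act (E : GateEnum) (β : ℕ → Bool) (t : List Label) (ψ : QState) : QState :=
  t.foldl (fun ψ a => a.act E β ψ) ψ

variable {E : GateEnum} {β : ℕ → Bool}

theorem act_append (s t : List Label) (ψ : QState) :
    act E β (s ++ t) ψ = act E β t (act E β s ψ) := List.foldl_append

theorem newAct_comm {b b' : Bool} {r r' : ℕ} (h : r ≠ r') (ψ : QState) :
    newAct b r (newAct b' r' ψ) = newAct b' r' (newAct b r ψ) := by
  funext f
  simp only [newAct, Function.update_of_ne h, Function.update_of_ne h.symm,
    Function.update_comm h]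
  split_ifs <;> rfl

theorem extend_comm {m n : ℕ} {g : Fin m → ℕ} {g' : Fin n → ℕ} (h : ∀ i j, g i ≠ g' j)
    (b : Fin m → Bool) (b' : Fin n → Bool) (f : ℕ → Bool) :
    Function.extend g b (Function.extend g' b' f) =
      Function.extend g' b' (Function.extend g b f) := by
  classical
  funext x
  simp only [Function.extend_def]
  by_cases h₁ : ∃ i, g i = x
  · have h₂ : ¬∃ j, g' j = x := by
      rintro ⟨j, rfl⟩
      obtain ⟨i, hi⟩ := h₁
      exact h i j hi
    simp [h₁, h₂]
  · simp [h₁]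

theorem extend_comp_of_ne {m n : ℕ} {g : Fin m → ℕ} {g' : Fin n → ℕ} (h : ∀ i j, g i ≠ g' j)
    (b : Fin m → Bool) (f : ℕ → Bool) (j : Fin n) : Function.extend g b f (g' j) = f (g' j) :=
  Function.extend_apply' _ _ _ fun ⟨i, hi⟩ => h i j hi

theorem gateAct_comm {m n : ℕ} {U : Matrix (Fin m → Bool) (Fin m → Bool) ℂ}
    {U' : Matrix (Fin n → Bool) (Fin n → Bool) ℂ} {g : Fin m → ℕ} {g' : Fin n → ℕ}
    (h : ∀ i j, g i ≠ g' j) (ψ : QState) :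
    gateAct U g (gateAct U' g' ψ) = gateAct U' g' (gateAct U g ψ) := by
  funext f
  simp only [gateAct, Finset.mul_sum, extend_comp_of_ne h,
    extend_comp_of_ne fun j i => (h i j).symm]
  rw [Finset.sum_comm]
  refine Finset.sum_congr rfl fun b' _ => Finset.sum_congr rfl fun b _ => ?_
  rw [extend_comm h]
  ring

theorem newAct_gateAct_comm {n : ℕ} {U : Matrix (Fin n → Bool) (Fin n → Bool) ℂ} {g : Fin n → ℕ}
    {b : Bool} {r : ℕ} (h : ∀ i, g i ≠ r) (ψ : QState) :
    newAct b r (gateAct U g ψ) = gateAct U g (newAct b r ψ) := by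
  funext f
  have hr : ∀ b', Function.extend g b' f r = f r := fun b' =>
    Function.extend_apply' _ _ _ fun ⟨i, hi⟩ => h i hi
  have hu : ∀ b', Function.update (Function.extend g b' f) r false =
      Function.extend g b' (Function.update f r false) := by
    classical
    intro b'
    funext x
    by_cases hx : x = r
    · subst hx
      rw [Function.update_self, Function.extend_apply' _ _ _ fun ⟨i, hi⟩ => h i hi,
        Function.update_self]
    · rw [Function.update_of_ne hx, Function.extend_def, Function.extend_def]
      split
      · rfl
      · rw [Function.update_of_ne hx]
  simp only [newAct, gateAct, hr, hu]
  split
  · refine Finset.sum_congr rfl fun b' _ => ?_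
    congr 1
    congr 1
    funext j
    rw [Function.update_of_ne (h j)]
  · simp

theorem Label.act_comm {a b : Label} (h : a.supp.Disjoint b.supp) (ψ : QState) :
    a.act E β (b.act E β ψ) = b.act E β (a.act E β ψ) := by
  cases a with
  | inl a =>
    cases b with
    | inl b => exact newAct_comm (by simpa [Label.supp, eq_comm] using h) ψ
    | inr b =>
      simp only [Label.act]
      split
      · refine newAct_gateAct_comm (fun i hi => ?_) ψ
        exact h (a := a.2) (by simp [Label.supp]) (by rw [← hi]; exact List.get_mem _ _)
      · rfl
  | inr a =>
    cases b with
    | inl b =>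
      simp only [Label.act]
      split
      · refine (newAct_gateAct_comm (fun i hi => ?_) ψ).symm
        exact h (a := b.2) (by rw [← hi]; exact List.get_mem _ _) (by simp [Label.supp])
      · rfl
    | inr b =>
      simp only [Label.act]
      split
      · split
        · refine gateAct_comm (fun i j hij => ?_) ψ
          exact h (a := _) (List.get_mem a.2 _) (by rw [hij]; exact List.get_mem b.2 _)
        · rfl
      · rfl

/-- All labels act on one common space of states, where operators on disjoint sets of variables
commute. So a trace matters only up to `TEq`. -/
theorem TEq.act_eq {s t : List Label} (h : TEq s t) (ψ : QState) :
    act E β s ψ = act E β t ψ := by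
  induction h generalizing ψ with
  | refl l => rfl
  | cons a _ ih => exact ih _
  | swap a b l h =>
    simp only [act, List.foldl_cons]
    rw [Label.act_comm h]
  | trans _ _ ih ih' => exact (ih ψ).trans (ih' ψ)

/-! ### Vectors as states -/

theorem hat_injective {V : Finset ℕ} : Function.Injective (hat (V := V)) := by
  intro φ φ' h
  funext g
  have := congrFun h fun r => if hr : r ∈ V then g ⟨r, hr⟩ else false
  simpa +contextual [hat] using this

/-- Variables outside of `V` are pinned to the value `0`; creating one of them replaces this `0` by
`b`. -/
theorem hat_adjoin {V : Finset ℕ} (φ : Reg V) {r : ℕ} (hr : r ∉ V) (b : Bool) :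
    hat (φ.adjoin r b) = newAct b r (hat φ) := by
  funext f
  have e : (∀ s, s ∉ V → Function.update f r false s = false) ↔
      ∀ s, s ∉ insert r V → f s = false := by
    constructor
    · intro h s hs
      simp only [Finset.mem_insert, not_or] at hs
      simpa [Function.update_of_ne hs.1] using h s hs.2
    · intro h s hs
      by_cases hsr : s = r
      · subst hsr; simp
      · rw [Function.update_of_ne hsr]
        exact h s (by simp [hsr, hs])
  have e' : (fun v : V => Function.update f r false v) = fun v : V => f v := by
    funext v
    rw [Function.update_of_ne]
    rintro h
    exact hr (h ▸ v.2)
  by_cases h₁ : ∀ s, s ∉ insert r V → f s = false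
  · simp only [hat, newAct, Reg.adjoin, e', if_pos h₁, if_pos (e.2 h₁)]
  · simp only [hat, newAct, if_neg h₁, if_neg fun h => h₁ (e.1 h), ite_self]

theorem hat_applyAt {V : Finset ℕ} {n : ℕ} (U : Matrix (Fin n → Bool) (Fin n → Bool) ℂ)
    {r : Fin n → V} (hr : Function.Injective r) (φ : Reg V) :
    hat (applyAt U r φ) = gateAct U (fun j => r j) (hat φ) := by
  classical
  funext f
  have hr' : Function.Injective fun j => (r j : ℕ) := Subtype.val_injective.comp hr
  have e : ∀ b : Fin n → Bool, (∀ s, s ∉ V → Function.extend (fun j => (r j : ℕ)) b f s = false) ↔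
      ∀ s, s ∉ V → f s = false := by
    intro b
    refine forall₂_congr fun s hs => ?_
    rw [Function.extend_apply']
    rintro ⟨j, rfl⟩
    exact hs (r j).2
  have e' : ∀ b : Fin n → Bool, (fun v : V => Function.extend (fun j => (r j : ℕ)) b f v) =
      Function.extend r b fun v : V => f v := by
    intro b
    funext v
    by_cases h : ∃ j, r j = v
    · obtain ⟨j, rfl⟩ := h
      rw [hr.extend_apply]
      exact hr'.extend_apply _ _ j
    · rw [Function.extend_apply' _ _ _ h, Function.extend_apply']
      rintro ⟨j, hj⟩
      exact h ⟨j, Subtype.ext hj⟩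
  simp only [hat, gateAct, applyAt, e, e']
  split_ifs
  · rfl
  · simp

/-! ### Reduction steps of configurations -/

theorem Tm.qtree_ev (qs : List ℕ) : Ev (qtree qs) [] (tup qs) := by
  induction qs with
  | nil => exact .val trivial
  | cons r qs ih =>
    exact Ev.strict (t₁ := []) (t₂ := []) (t₃ := []) (t₄ := [])
      (Ev.strict (t₁ := []) (t₂ := []) (t₃ := []) (t₄ := [])
        (.val trivial) (.val trivial) (.cons r) (.val trivial)) ih (.pcons r qs) (.val trivial)

theorem St.tree {n : ℕ} {f : Fin n → Tm} {i : Fin n} {s : List Label} {N : Tm}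
    (h : St (f i) s N) :
    St (tree (List.ofFn f)) s (tree (List.ofFn (Function.update f i N))) := by
  induction n with
  | zero => exact i.elim0
  | succ n ih =>
    rw [List.ofFn_succ, List.ofFn_succ]
    refine Fin.cases (fun h => ?_) (fun i h => ?_) i h
    · have : (fun j : Fin n => Function.update f 0 N j.succ) = fun j => f j.succ := by
        funext j
        rw [Function.update_of_ne (Fin.succ_ne_zero j)]
      rw [this, Function.update_self]
      exact .appL _ (.appR _ h)
    · have : (fun j : Fin n => Function.update f i.succ N j.succ) =
          Function.update (fun j => f j.succ) i N := by
        funext j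
        by_cases hj : j = i
        · subst hj; simp
        · rw [Function.update_of_ne hj, Function.update_of_ne (by simpa using hj)]
      rw [this, Function.update_of_ne (Fin.succ_ne_zero i).symm]
      exact .appR _ (ih (f := fun j => f j.succ) h)

/-- The gates in a trace have arguments that fit. -/
def GatesFit (E : GateEnum) (t : List Label) : Prop :=
  ∀ i qs, Sum.inr (i, qs) ∈ t → qs.length = E.arity i ∧ qs.Nodup

/-- The bits of a term that comes from an actual term. -/
def bitVal (j : ℕ) : Bool := decide (j ≠ 0)

theorem bitVal_toNat (b : Bool) : bitVal b.toNat = b := by cases b <;> rfl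

/-- The hypothesis supplies the distinctness of the arguments of a gate, which `Step` does not ask
for. Tuples are translated to trees; their evaluation has no labels and is absorbed by `St.delta`.
-/
theorem Step.st {C D : PreConf} (h : Step E C D) (hC : ∀ r, C.term.tr.qc r ≤ 1) :
    ∃ s, St C.term.tr s D.term.tr ∧ hat D.reg = act E bitVal s (hat C.reg) ∧
      (∀ r, newCount r s + (if r ∈ C.QV then 1 else 0) = if r ∈ D.QV then 1 else 0) ∧
      GatesFit E s := by
  induction h with
  | @tuple C D n Ms i hi _ _ _ ih =>
    have hle : ∀ r, C.term.tr.qc r ≤ 1 := fun r => by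
      refine le_trans ?_ (hC r)
      simp only [Term.tr, qc_tree, List.map_ofFn, List.sum_ofFn, Function.comp]
      rw [← hi]
      exact Finset.single_le_sum (f := fun j => (Ms j).tr.qc r) (fun _ _ => Nat.zero_le _)
        (Finset.mem_univ i)
    obtain ⟨s, h, hs⟩ := ih hle
    refine ⟨s, ?_, hs⟩
    rw [← hi] at h
    have key := St.tree (f := fun j => (Ms j).tr) h
    have e : Function.update (fun j => (Ms j).tr) i D.term.tr =
        fun j => (Function.update Ms i D.term j).tr := by
      funext j
      by_cases hj : j = i
      · subst hj; simp
      · simp [Function.update_of_ne hj]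
    rw [e] at key
    exact key
  | argR M _ _ _ ih =>
    obtain ⟨s, h, hs⟩ := ih fun r => by
      have := hC r
      simp only [Term.tr, qc_app] at this
      omega
    exact ⟨s, .appR _ h, hs⟩
  | argL N _ _ _ ih =>
    obtain ⟨s, h, hs⟩ := ih fun r => by
      have := hC r
      simp only [Term.tr, qc_app] at this
      omega
    exact ⟨s, .appL _ h, hs⟩
  | inNew _ _ _ ih =>
    obtain ⟨s, h, hs⟩ := ih fun r => by
      have := hC r
      simp only [Term.tr, qc_app] at this
      omega
    exact ⟨s, .appR _ h, hs⟩
  | inLam p _ _ _ ih =>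
    obtain ⟨s, h, hs⟩ := ih fun r => by
      have := hC r
      simpa only [Term.tr, qc_lam] using this
    exact ⟨s, .lam _ h, hs⟩
  | @Uq V φ i r _ _ =>
    have ht : List.ofFn (fun j => qvar (r j : ℕ)) =
        (List.ofFn fun j => (r j : ℕ)).map qvar := by
      rw [List.map_ofFn]
      rfl
    have hnd : (List.ofFn fun j => (r j : ℕ)).Nodup := by
      refine List.nodup_iff_count_le_one.2 fun x => ?_
      have := hC x
      simp only [Term.tr, qc_app] at this
      rw [ht, ← qtree, qc, qc, wt_qtree, sum_map_single] at this
      omega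
    have hinj : Function.Injective r := by
      rw [List.nodup_ofFn] at hnd
      exact fun a b hab => hnd (congrArg Subtype.val hab)
    refine ⟨[Sum.inr (i, List.ofFn fun j => (r j : ℕ))], ?_, ?_, ?_, ?_⟩
    · simp only [Term.tr, ht]
      exact St.delta (t₁ := []) (t₂ := []) (.val trivial) (qtree_ev _) (.gate i _)
    · simp only [act, List.foldl_cons, List.foldl_nil, Label.act]
      rw [dif_pos (List.length_ofFn ..), hat_applyAt _ hinj]
      simp
    · intro x
      simp [newCount, Label.newWt]
    · intro i' qs h
      simp only [List.mem_singleton, Sum.inr.injEq, Prod.mk.injEq] at h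
      obtain ⟨rfl, rfl⟩ := h
      exact ⟨List.length_ofFn .., hnd⟩
  | @new V φ b r hr _ _ =>
    refine ⟨[Sum.inl (b.toNat, r)], ?_, ?_, ?_, ?_⟩
    · exact St.delta (t₁ := []) (t₂ := []) (.val trivial) (.val trivial) (.new _ r)
    · simp only [act, List.foldl_cons, List.foldl_nil, Label.act]
      rw [bitVal_toNat, hat_adjoin φ hr]
    · intro x
      simp only [newCount, newWt_cons, newWt_nil, Label.newWt, Pi.single_apply, Finset.mem_insert]
      by_cases hx : x = r
      · subst hx; simp [hr]
      · simp [hx, Ne.symm hx]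
    · intro i qs h
      simp at h
  | @lBeta V φ M N _ _ =>
    refine ⟨[], ?_, rfl, by simp, by simp [GatesFit]⟩
    simp only [Term.tr_inst]
    exact .lbeta _ _
  | @qBeta V φ n M r _ _ =>
    have ht : List.ofFn (fun j => qvar (r j : ℕ)) =
        (List.ofFn fun j => (r j : ℕ)).map qvar := by
      rw [List.map_ofFn]
      rfl
    refine ⟨[], ?_, rfl, by simp, by simp [GatesFit]⟩
    simp only [Term.tr_inst, ht, Term.tr, Binder.code]
    have hp := Delta.pat M.tr (List.ofFn fun j => (r j : ℕ))
    rw [List.length_ofFn] at hp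
    exact St.delta (t₁ := []) (t₂ := []) (.val trivial) (qtree_ev _) hp
  | @cBeta V φ M N _ _ =>
    refine ⟨[], ?_, rfl, by simp, by simp [GatesFit]⟩
    simp only [Term.tr_inst]
    exact St.delta (t₁ := []) (t₂ := []) (.val trivial) (.val trivial) (.beta _ _)
  | @lCm V φ p hp L M N _ _ =>
    refine ⟨[], ?_, rfl, by simp, by simp [GatesFit]⟩
    simp only [Term.tr, Term.shift, Term.tr_rename, ← p.bw_code]
    exact .lcm _ (by cases p <;> simp_all [Binder.code]) _ _ _
  | @rCm V φ p hp L M N _ _ =>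
    refine ⟨[], ?_, rfl, by simp, by simp [GatesFit]⟩
    simp only [Term.tr, Term.shift, Term.tr_rename, ← p.bw_code]
    exact .rcm _ (by cases p <;> simp_all [Binder.code]) _ _ _

end QCalc

namespace QCalc
open Tm

variable {E : GateEnum} {β : ℕ → Bool}

/-! ### Renaming of the quantum variables -/

theorem Delta.mapA {F A B : Tm} {t : List Label} (h : Delta F A t B) (f ρ : ℕ → ℕ) :
    Delta (F.mapA f ρ) (A.mapA f ρ) (t.map (Label.map f ρ)) (B.mapA f ρ) := by
  cases h with
  | beta M P => rw [mapA_inst]; exact .beta _ _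
  | pat M qs =>
    rw [mapA_inst, List.map_map]
    have := Delta.pat (M.mapA f ρ) (qs.map ρ)
    rw [List.length_map, List.map_map] at this
    exact this
  | new j r => exact .new _ _
  | gate i qs =>
    have := Delta.gate i (qs.map ρ)
    rw [qtree, List.map_map] at this
    rw [mapA_tree, List.map_map]
    exact this
  | cons r => exact .cons _
  | pcons r qs => exact .pcons _ _

theorem Ev.mapA {A v : Tm} {t : List Label} (h : Ev A t v) (f ρ : ℕ → ℕ) :
    Ev (A.mapA f ρ) (t.map (Label.map f ρ)) (v.mapA f ρ) := by
  induction h with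
  | @val v hv => exact .val (by cases v <;> trivial)
  | lin _ _ ih₁ ih₂ =>
    rw [mapA_inst] at ih₂
    rw [List.map_append]
    exact .lin ih₁ ih₂
  | strict _ _ hd _ ih₁ ih₂ ih₃ =>
    simp only [List.map_append]
    exact .strict ih₁ ih₂ (hd.mapA f ρ) ih₃

theorem St.mapA {C D : Tm} {t : List Label} (h : St C t D) (f ρ : ℕ → ℕ) :
    St (C.mapA f ρ) (t.map (Label.map f ρ)) (D.mapA f ρ) := by
  induction h with
  | appL A _ ih => exact .appL _ ih
  | appR F _ ih => exact .appR _ ih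
  | lam p _ ih => exact .lam p ih
  | lbeta M A => rw [mapA_inst]; exact .lbeta _ _
  | delta h₁ h₂ hd =>
    simp only [List.map_append]
    exact .delta (h₁.mapA f ρ) (h₂.mapA f ρ) (hd.mapA f ρ)
  | lcm p hp L M N =>
    simp only [Tm.mapA, mapA_rename]
    exact .lcm p hp _ _ _
  | rcm p hp L M N =>
    simp only [Tm.mapA, mapA_rename]
    exact .rcm p hp _ _ _

theorem Chain.mapA {C D : Tm} {t : List Label} (h : Chain C t D) (f ρ : ℕ → ℕ) :
    Chain (C.mapA f ρ) (t.map (Label.map f ρ)) (D.mapA f ρ) := by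
  induction h with
  | refl C => exact .refl _
  | head hs _ ih => rw [List.map_append]; exact .head (hs.mapA f ρ) ih

theorem Term.tr_mapQ (θ : ℕ → ℕ) (M : Term) : (M.mapQ θ).tr = M.tr.mapA id θ := by
  induction M with
  | tuple n Ms ih =>
    simp only [mapQ, tr, ih, mapA_tree, List.map_ofFn]
    rfl
  | bit b => simp [mapQ, tr, mapA, atomMap]
  | qvar r => simp [mapQ, tr, mapA, atomMap]
  | gate i => simp [mapQ, tr, mapA, atomMap]
  | new M ih => simp [mapQ, tr, mapA, atomMap, ih]
  | _ => simp_all [mapQ, tr, mapA]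

theorem Tm.mapA_id (M : Tm) : M.mapA id id = M := by
  induction M with
  | atom k l => simp [mapA, atomMap]
  | _ => simp_all [mapA]

/-- Renaming of the quantum variables in a state. -/
def QState.perm (π : Equiv.Perm ℕ) (ψ : QState) : QState := fun f => ψ (f ∘ π)

theorem Label.act_perm (π : Equiv.Perm ℕ) (a : Label) (ψ : QState) :
    (a.map id π).act E β (ψ.perm π) = QState.perm π (a.act E β ψ) := by
  cases a with
  | inl a =>
    funext f
    have : Function.update f (π a.2) false ∘ π = Function.update (f ∘ π) a.2 false := by
      funext x
      by_cases hx : x = a.2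
      · subst hx; simp
      · simp [Function.update_of_ne hx, Function.update_of_ne (π.injective.ne hx)]
    simp [Label.map, Label.act, newAct, QState.perm, this]
  | inr a =>
    simp only [Label.map, Label.act, List.length_map]
    split
    · rename_i h
      funext f
      simp only [gateAct, QState.perm]
      refine Finset.sum_congr rfl fun b _ => ?_
      have e : (fun j => f ((a.2.map π).get (Fin.cast (by rw [List.length_map, h]) j))) =
          fun j => (f ∘ π) (a.2.get (Fin.cast h.symm j)) := by
        funext j
        simp
      have e' : Function.extend
          (fun j => (a.2.map π).get (Fin.cast (by rw [List.length_map, h]) j)) b f ∘ π =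
          Function.extend (fun j => a.2.get (Fin.cast h.symm j)) b (f ∘ π) := by
        classical
        funext x
        simp [Function.extend_def]
      rw [e, e']
    · rfl

theorem act_perm (π : Equiv.Perm ℕ) (t : List Label) (ψ : QState) :
    act E β (t.map (Label.map id π)) (ψ.perm π) = QState.perm π (act E β t ψ) := by
  induction t generalizing ψ with
  | nil => rfl
  | cons a t ih =>
    simp only [act, List.map_cons, List.foldl_cons] at ih ⊢
    rw [Label.act_perm, ih]

theorem newCount_perm (π : Equiv.Perm ℕ) (t : List Label) (r : ℕ) :
    newCount (π r) (t.map (Label.map id π)) = newCount r t := by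
  induction t with
  | nil => rfl
  | cons a t ih =>
    simp only [newCount, List.map_cons, newWt_cons] at ih ⊢
    rw [ih]
    cases a <;> simp [Label.newWt, Label.map, Pi.single_apply]

theorem GatesFit.perm {t : List Label} (h : GatesFit E t) (π : Equiv.Perm ℕ) :
    GatesFit E (t.map (Label.map id π)) := by
  intro i qs hi
  obtain ⟨a, ha, e⟩ := List.mem_map.1 hi
  cases a with
  | inl a => simp [Label.map] at e
  | inr a =>
    simp only [Label.map, Sum.inr.injEq, Prod.mk.injEq] at e
    obtain ⟨rfl, rfl⟩ := e
    have := h _ _ ha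
    rw [List.length_map]
    exact ⟨this.1, this.2.map π.injective⟩

/-- Both complements are countably infinite, so some bijection between them completes `θ`. -/
theorem exists_perm_extending {V W : Finset ℕ} (θ : V ≃ W) :
    ∃ π : Equiv.Perm ℕ, (∀ v : V, π v = θ v) ∧ ∀ r, π r ∈ W ↔ r ∈ V := by
  have i₁ : Infinite {r // ¬r ∈ V} := V.finite_toSet.infinite_compl.to_subtype
  have i₂ : Infinite {r // ¬r ∈ W} := W.finite_toSet.infinite_compl.to_subtype
  obtain ⟨d₁⟩ := nonempty_denumerable {r // ¬r ∈ V}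
  obtain ⟨d₂⟩ := nonempty_denumerable {r // ¬r ∈ W}
  let e : {r // ¬r ∈ V} ≃ {r // ¬r ∈ W} := Denumerable.equiv₂ _ _
  refine ⟨Equiv.subtypeCongr θ e, fun v => ?_, fun r => ?_⟩
  · simp [Equiv.subtypeCongr, Equiv.sumCompl]
  · by_cases hr : r ∈ V
    · have : Equiv.subtypeCongr θ e r = θ ⟨r, hr⟩ := by
        simp [Equiv.subtypeCongr, Equiv.sumCompl, hr]
      rw [this]
      simp [hr]
    · have : Equiv.subtypeCongr θ e r = e ⟨r, hr⟩ := by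
        simp [Equiv.subtypeCongr, Equiv.sumCompl, hr]
      rw [this]
      simp [hr, (e ⟨r, hr⟩).2]

/-! ### Reduction sequences of configurations -/

/-- The state in which all variables have the value `0`. -/
noncomputable def zeroState : QState := hat (V := ∅) fun _ => 1

/-- The preconfiguration `D` is reached from the term `C` without quantum variables. -/
def Reached (E : GateEnum) (C : Tm) (D : PreConf) : Prop :=
  ∃ t, Chain C t D.term.tr ∧ hat D.reg = act E bitVal t zeroState ∧
    (∀ r, newCount r t = if r ∈ D.QV then 1 else 0) ∧ GatesFit E t

theorem zeroState_perm (π : Equiv.Perm ℕ) : zeroState.perm π = zeroState := by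
  funext f
  have : (∀ r, f (π r) = false) ↔ ∀ r, f r = false := π.forall_congr_left.trans (by simp)
  have e : (∀ r, r ∉ (∅ : Finset ℕ) → (f ∘ π) r = false) ↔ ∀ r, r ∉ (∅ : Finset ℕ) → f r = false := by
    simpa using this
  simp only [QState.perm, zeroState, hat]
  by_cases h : ∀ r, r ∉ (∅ : Finset ℕ) → f r = false
  · rw [if_pos h, if_pos (e.2 h)]
  · rw [if_neg h, if_neg (mt e.1 h)]

/-- Configurations are classes, so names may change in the middle of a reduction. A permutation of
all names carries the whole reduction sequence along. It fixes the initial term, which has no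
quantum variables, and the initial state. -/
theorem Reached.equiv {C : Tm} {D D' : PreConf} (h : Reached E C D) (hC : C.Below 0)
    (hD : D.Equiv D') : Reached E C D' := by
  obtain ⟨t, hc, hr, hn, hg⟩ := h
  obtain ⟨θ, e₁, e₂⟩ := hD
  obtain ⟨π, hπ, hπ'⟩ := exists_perm_extending θ
  refine ⟨t.map (Label.map id π), ?_, ?_, fun r => ?_, hg.perm π⟩
  · have := hc.mapA id π
    rw [mapA_congr (ρ := id) (fun i hi => absurd hi (Nat.not_lt_zero i)) hC, mapA_id,
      ← Term.tr_mapQ] at this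
    rw [e₂, Term.mapQ_congr (η := π)]
    · exact this
    · intro r hr
      have hr' := D.qvars_subset hr
      simp only [extendMap, dif_pos hr']
      exact (hπ ⟨r, hr'⟩).symm
  · rw [← zeroState_perm π, act_perm, ← hr, e₁]
    funext f
    have e : (∀ r, r ∉ D'.QV → f r = false) ↔ ∀ r, r ∉ D.QV → (f ∘ π) r = false := by
      constructor
      · exact fun h r hr => h (π r) (mt (hπ' r).1 hr)
      · intro h r hr
        have := h (π.symm r) fun h' => hr (by simpa using (hπ' (π.symm r)).2 h')
        simpa using this
    simp only [hat, QState.perm]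
    by_cases h : ∀ r, r ∉ D'.QV → f r = false
    · rw [if_pos h, if_pos (e.1 h)]
      simp only [Function.comp_def, hπ]
    · rw [if_neg h, if_neg (mt e.2 h)]
  · have := newCount_perm π t (π.symm r)
    rw [Equiv.apply_symm_apply] at this
    rw [this, hn]
    have := hπ' (π.symm r)
    rw [Equiv.apply_symm_apply] at this
    simp [this]

theorem Reached.step {C : Tm} {D D' : PreConf} (h : Reached E C D) (hC : C.Lin)
    (hq : ∀ r, C.qc r = 0) (hD : Step E D D') : Reached E C D' := by
  obtain ⟨t, hc, hr, hn, hg⟩ := h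
  obtain ⟨s, hs, hr', hn', hg'⟩ := hD.st fun r => by
    have : newCount r t ≤ 1 := by rw [hn]; split <;> omega
    rw [hc.qc hC (by rw [hq]; omega), hq]
    omega
  refine ⟨t ++ s, hc.trans (.single hs), ?_, fun r => ?_, fun i qs hi => ?_⟩
  · rw [act_append, ← hr, hr']
  · rw [newCount_append, hn, ← hn', add_comm]
  · rcases List.mem_append.1 hi with hi | hi
    exacts [hg i qs hi, hg' i qs hi]

theorem Reached.reflTransGen {C : Tm} {c d : Conf} (h : Relation.ReflTransGen (Red E) c d)
    (hC : C.Lin) (hq : ∀ r, C.qc r = 0) (hb : C.Below 0) {C₀ : PreConf} (hc : C₀.conf = c)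
    (h₀ : Reached E C C₀) : ∀ D : PreConf, D.conf = d → Reached E C D := by
  induction h with
  | refl =>
    intro D hD
    exact h₀.equiv hb (Quotient.exact (hc.trans hD.symm))
  | tail _ hr ih =>
    intro D hD
    obtain ⟨D₁, D₂, e₁, e₂, _, hs⟩ := hr
    exact ((ih D₁ e₁).step hC hq hs).equiv hb (Quotient.exact (e₂.trans hD.symm))

/-- The term that is evaluated on an input. -/
def inputTm (M : Tm) (bs : List Tm) : Tm := app M (bang (tlist (bs.map bang)))

theorem tr_applyInput (M : Term) (cs : List Bool) :
    (applyInput M cs).tr = inputTm M.tr (cs.map fun c => bit c.toNat) := by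
  simp only [applyInput, Term.tr, Term.tr_list, inputTm, List.map_map]
  rfl

theorem tr_outList (m : ℕ) : (outList m).tr = tlist ((List.range' 1 m).map qvar) := by
  rw [outList, Term.tr_list, List.map_map]
  rfl

theorem Tm.Lin.tlist {l : List Tm} (h : ∀ N ∈ l, N.Lin) : (tlist l).Lin := by
  induction l with
  | nil => simp [QCalc.tlist, Tm.Lin]
  | cons N l ih =>
    simp only [List.mem_cons, forall_eq_or_imp] at h
    have h₁ := h.1.rename (· + 2)
    have h₂ := (ih h.2).rename (· + 2)
    simp [QCalc.tlist, Tm.Lin, h₁, h₂]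

theorem Tm.Below.tlist {k : ℕ} {l : List Tm} (h : ∀ N ∈ l, N.Below k) : (tlist l).Below k := by
  induction l with
  | nil => trivial
  | cons N l ih =>
    simp only [List.mem_cons, forall_eq_or_imp] at h
    exact ⟨⟨trivial, h.1.rename _⟩, (ih h.2).rename _⟩

theorem Tm.GatesIn.tlist {G : Set ℕ} {l : List Tm} (h : ∀ N ∈ l, N.GatesIn G) :
    (tlist l).GatesIn G := by
  induction l with
  | nil => trivial
  | cons N l ih =>
    simp only [List.mem_cons, forall_eq_or_imp] at h
    exact ⟨⟨trivial, h.1.rename _⟩, (ih h.2).rename _⟩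

theorem Tm.Below.qc {M : Tm} (h : M.Below 0) (r : ℕ) : M.qc r = 0 := by
  induction M with
  | var i => rfl
  | atom k l =>
    rw [Tm.qc, wt]
    split
    · rename_i hk
      have : l = [] := List.eq_nil_iff_forall_not_mem.2 fun x hx => Nat.not_lt_zero _ (h hk x hx)
      simp [this]
    · rfl
  | bang M ih => exact (congrArg (2 * ·) (ih h) : _)
  | app F A ih₁ ih₂ => rw [qc_app, ih₁ h.1, ih₂ h.2]
  | lam p M ih => rw [qc_lam]; exact ih h

end QCalc

namespace QCalc

/-! ### Primitive recursive functions, by `fun_prop` -/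

attribute [fun_prop] Primrec
attribute [fun_prop] Primrec.id Primrec.const Primrec.comp Primrec.pair Primrec.fst Primrec.snd

section Primrec

variable {α β γ : Type*} [Primcodable α] [Primcodable β] [Primcodable γ]

@[fun_prop] theorem primrec_fst {f : α → β × γ} (hf : Primrec f) : Primrec fun a => (f a).1 :=
  Primrec.fst.comp hf

@[fun_prop] theorem primrec_snd {f : α → β × γ} (hf : Primrec f) : Primrec fun a => (f a).2 :=
  Primrec.snd.comp hf

@[fun_prop] theorem primrec_inl {f : α → β} (hf : Primrec f) :
    Primrec fun a => (Sum.inl (f a) : β ⊕ γ) := Primrec.sumInl.comp hf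

@[fun_prop] theorem primrec_inr {f : α → γ} (hf : Primrec f) :
    Primrec fun a => (Sum.inr (f a) : β ⊕ γ) := Primrec.sumInr.comp hf

@[fun_prop] theorem primrec_cons {f : α → β} {g : α → List β} (hf : Primrec f) (hg : Primrec g) :
    Primrec fun a => f a :: g a := Primrec.list_cons.comp hf hg

@[fun_prop] theorem primrec_append {f g : α → List β} (hf : Primrec f) (hg : Primrec g) :
    Primrec fun a => f a ++ g a := Primrec.list_append.comp hf hg

@[fun_prop] theorem primrec_length {f : α → List β} (hf : Primrec f) :
    Primrec fun a => (f a).length := Primrec.list_length.comp hf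

@[fun_prop] theorem primrec_add {f g : α → ℕ} (hf : Primrec f) (hg : Primrec g) :
    Primrec fun a => f a + g a := Primrec.nat_add.comp hf hg

@[fun_prop] theorem primrec_sub {f g : α → ℕ} (hf : Primrec f) (hg : Primrec g) :
    Primrec fun a => f a - g a := Primrec.nat_sub.comp hf hg

@[fun_prop] theorem primrec_mul {f g : α → ℕ} (hf : Primrec f) (hg : Primrec g) :
    Primrec fun a => f a * g a := Primrec.nat_mul.comp hf hg

@[fun_prop] theorem primrec_natPair {f g : α → ℕ} (hf : Primrec f) (hg : Primrec g) :
    Primrec fun a => Nat.pair (f a) (g a) := Primrec₂.natPair.comp hf hg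

@[fun_prop] theorem primrec_encode {f : α → β} (hf : Primrec f) :
    Primrec fun a => Encodable.encode (f a) := Primrec.encode.comp hf

theorem primrec_map {f : α → List β} {g : β → γ} (hf : Primrec f) (hg : Primrec g) :
    Primrec fun a => (f a).map g := Primrec.list_map hf (hg.comp Primrec.snd)

end Primrec

/-- A total search for a value with a decidable property. -/
theorem exists_computable_choice {X : Type*} [Primcodable X] {p : ℕ → X → Bool}
    (hp : Computable₂ p) (h : ∀ n, ∃ x, p n x = true) :
    ∃ F : ℕ → X, Computable F ∧ ∀ n, p n (F n) = true := by
  let f : ℕ → ℕ → Option X := fun n m =>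
    (Encodable.decode m : Option X).bind fun x => bif p n x then some x else none
  have hf : Computable₂ f := by
    refine Computable.option_bind (Computable.decode.comp Computable.snd) ?_
    exact Computable.cond (hp.comp (Computable.fst.comp Computable.fst) Computable.snd)
      (Computable.option_some.comp Computable.snd) (Computable.const none)
  have hdom : ∀ n, (Nat.rfindOpt (f n)).Dom := by
    intro n
    obtain ⟨x, hx⟩ := h n
    exact Nat.rfindOpt_dom.2 ⟨Encodable.encode x, x, by simp [f, hx]⟩
  refine ⟨fun n => (Nat.rfindOpt (f n)).get (hdom n), ?_, fun n => ?_⟩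
  · exact (Partrec.rfindOpt hf).of_eq_tot fun n => Part.get_mem _
  · obtain ⟨m, hm⟩ := Nat.rfindOpt_spec (Part.get_mem (hdom n))
    obtain ⟨x, _, hx⟩ := Option.bind_eq_some_iff.1 (Option.mem_def.1 hm)
    cases hpx : p n x
    · simp [hpx] at hx
    · simp only [hpx, cond_true, Option.some.injEq] at hx
      exact (congrArg (p n) hx).symm.trans hpx

/-! ### Systems of rules -/

/-- A system of rules: an instance of a rule has a conclusion and a list of premises. -/
structure Rules (α : Type) [Primcodable α] where
  W : Type
  [primcodable : Primcodable W]
  concl : W → α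
  prems : W → List α
  primrec_concl : Primrec concl
  primrec_prems : Primrec prems

namespace Rules

attribute [instance] Rules.primcodable

variable {α : Type} [Primcodable α]

def sum (R S : Rules α) : Rules α where
  W := R.W ⊕ S.W
  concl := Sum.elim R.concl S.concl
  prems := Sum.elim R.prems S.prems
  primrec_concl := (Primrec.sumCasesOn Primrec.id (R.primrec_concl.comp Primrec.snd).to₂
    (S.primrec_concl.comp Primrec.snd).to₂).of_eq fun w => by cases w <;> rfl
  primrec_prems := (Primrec.sumCasesOn Primrec.id (R.primrec_prems.comp Primrec.snd).to₂
    (S.primrec_prems.comp Primrec.snd).to₂).of_eq fun w => by cases w <;> rfl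

/-- The predicate `P` is closed under the rules. -/
def Sound (R : Rules α) (P : α → Prop) : Prop := ∀ w, (∀ c ∈ R.prems w, P c) → P (R.concl w)

/-- What is derivable by the rules. -/
def Der (R : Rules α) (c : α) : Prop := ∀ P, R.Sound P → P c

theorem sound_sum {R S : Rules α} {P : α → Prop} : (R.sum S).Sound P ↔ R.Sound P ∧ S.Sound P :=
  ⟨fun h => ⟨fun w => h (.inl w), fun w => h (.inr w)⟩, fun h w => by
    cases w with
    | inl w => exact h.1 w
    | inr w => exact h.2 w⟩

theorem primrecRel_mem : PrimrecRel fun (c : α) (l : List α) => c ∈ l :=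
  ((PrimrecRel.exists_mem_list (R := fun a b : α => a = b) Primrec.eq).comp Primrec.snd
    Primrec.fst).of_eq fun p => by simp

variable [DecidableEq α]

/-- Validity of derivations, given as lists of rule instances. -/
def check (R : Rules α) : List R.W → Bool
  | [] => true
  | w :: l => decide (∀ c ∈ R.prems w, c ∈ l.map R.concl) && R.check l

theorem check_cons {R : Rules α} {w : R.W} {l : List R.W} :
    R.check (w :: l) = true ↔ (∀ c ∈ R.prems w, c ∈ l.map R.concl) ∧ R.check l = true := by
  rw [check, Bool.and_eq_true, decide_eq_true_iff]

theorem check_append {R : Rules α} {l l' : List R.W} (h : R.check l = true)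
    (h' : R.check l' = true) : R.check (l ++ l') = true := by
  induction l with
  | nil => exact h'
  | cons w l ih =>
    rw [check_cons] at h
    refine check_cons.2 ⟨fun c hc => ?_, ih h.2⟩
    exact (List.map_append (l₁ := l)).symm ▸ List.mem_append_left _ (h.1 c hc)

/-- In a valid list the premises of an instance are concluded further down the list. Valid lists can
be concatenated, so derivations of several premises are combined without using trees. -/
theorem der_iff {R : Rules α} {c : α} :
    R.Der c ↔ ∃ l, R.check l = true ∧ c ∈ l.map R.concl := by
  constructor
  · intro h
    refine h (fun c => ∃ l, R.check l = true ∧ c ∈ l.map R.concl) fun w hw => ?_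
    have : ∀ s : List α, (∀ c ∈ s, ∃ l, R.check l = true ∧ c ∈ l.map R.concl) →
        ∃ l, R.check l = true ∧ ∀ c ∈ s, c ∈ l.map R.concl := by
      intro s hs
      induction s with
      | nil => exact ⟨[], rfl, by simp⟩
      | cons a s ih =>
        simp only [List.mem_cons, forall_eq_or_imp] at hs ⊢
        obtain ⟨l₁, h₁, ha⟩ := hs.1
        obtain ⟨l₂, h₂, hs'⟩ := ih hs.2
        refine ⟨l₁ ++ l₂, check_append h₁ h₂, ?_, fun c hc => ?_⟩ <;> rw [List.map_append]
        · exact List.mem_append_left _ ha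
        · exact List.mem_append_right _ (hs' c hc)
    obtain ⟨l, hl, h⟩ := this _ hw
    exact ⟨w :: l, check_cons.2 ⟨h, hl⟩, by simp⟩
  · rintro ⟨l, hl, hc⟩ P hP
    induction l generalizing c with
    | nil => simp at hc
    | cons w l ih =>
      rw [check_cons] at hl
      rcases List.mem_cons.1 hc with rfl | hc
      · exact hP w fun c hc => ih hl.2 (hl.1 c hc)
      · exact ih hl.2 hc

theorem primrec_check (R : Rules α) : Primrec R.check := by
  have h : PrimrecPred fun p : R.W × List R.W => ∀ c ∈ R.prems p.1, c ∈ p.2.map R.concl :=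
    (PrimrecRel.forall_mem_list primrecRel_mem).comp (R.primrec_prems.comp Primrec.fst)
      (primrec_map Primrec.snd R.primrec_concl)
  have h₁ : Primrec fun p : R.W × List R.W × Bool => (p.1, p.2.1) := by fun_prop
  have h' : Primrec fun p : R.W × List R.W × Bool =>
      decide (∀ c ∈ R.prems p.1, c ∈ p.2.1.map R.concl) && p.2.2 :=
    Primrec.and.comp (h.decide.comp h₁) (Primrec.snd.comp Primrec.snd)
  refine (Primrec.list_rec Primrec.id (Primrec.const true) (h'.comp Primrec.snd).to₂).of_eq ?_
  intro l
  induction l with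
  | nil => rfl
  | cons w l ih => exact congrArg (_ && ·) ih

/-- A derivable conclusion of a given form is found by a computable search. -/
theorem exists_computable (R : Rules α) {X : Type} [Primcodable X] {c : ℕ → X → α}
    (hc : Computable₂ c) (h : ∀ n, ∃ x, R.Der (c n x)) :
    ∃ F : ℕ → X, Computable F ∧ ∀ n, R.Der (c n (F n)) := by
  have hp : Computable₂ fun (n : ℕ) (x : List R.W × X) =>
      R.check x.1 && decide (c n x.2 ∈ x.1.map R.concl) := by
    have h₁ : Primrec fun y : α × List R.W => decide (y.1 ∈ y.2.map R.concl) :=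
      (primrecRel_mem.comp Primrec.fst (primrec_map Primrec.snd R.primrec_concl)).decide
    have h₂ : Primrec fun y : α × List R.W =>
        R.check y.2 && decide (y.1 ∈ y.2.map R.concl) :=
      Primrec.and.comp (R.primrec_check.comp Primrec.snd) h₁
    have h₃ : Computable fun q : ℕ × List R.W × X => (c q.1 q.2.2, q.2.1) :=
      (hc.comp Computable.fst (Computable.snd.comp Computable.snd)).pair
        (Computable.fst.comp Computable.snd)
    have h₄ := h₂.to_comp.comp h₃
    exact h₄
  obtain ⟨F, hF, hF'⟩ := exists_computable_choice hp fun n => by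
    obtain ⟨x, hx⟩ := h n
    obtain ⟨l, hl, hc⟩ := der_iff.1 hx
    exact ⟨(l, x), by simp only [Bool.and_eq_true, decide_eq_true_iff]; exact ⟨hl, hc⟩⟩
  refine ⟨fun n => (F n).2, Computable.snd.comp hF, fun n => ?_⟩
  have := hF' n
  simp only [Bool.and_eq_true, decide_eq_true_iff] at this
  exact der_iff.2 ⟨_, this.1, this.2⟩

end Rules

end QCalc

namespace QCalc
open Tm

/-! ### Computability of the evaluation -/

namespace Tm

/-- The code of a term. -/
def code : Tm → ℕ
  | var i => 5 * i
  | atom k l => 5 * Nat.pair k (Encodable.encode l) + 1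
  | bang M => 5 * M.code + 2
  | app M N => 5 * Nat.pair M.code N.code + 3
  | lam p M => 5 * Nat.pair p M.code + 4

/-- Constructors correspond to residues modulo `5`. Surjectivity makes `Tm` a copy of `ℕ`, and for
it to be primitive recursive to build a term, only the codes have to be considered. -/
theorem code_bijective : Function.Bijective code := by
  constructor
  · intro M
    induction M with
    | var i => intro N h; cases N <;> simp only [code] at h <;> first | omega | (congr; omega)
    | atom k l =>
      intro N h
      cases N <;> simp only [code] at h <;> first | omega | skip
      obtain ⟨rfl, h'⟩ := Nat.pair_eq_pair.1 (Nat.eq_of_mul_eq_mul_left (by norm_num) (Nat.add_right_cancel h))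
      rw [Encodable.encode_injective h']
    | bang M ih =>
      intro N h
      cases N <;> simp only [code] at h <;> first | omega | skip
      rw [ih (Nat.eq_of_mul_eq_mul_left (by norm_num) (Nat.add_right_cancel h))]
    | app M₁ M₂ ih₁ ih₂ =>
      intro N h
      cases N <;> simp only [code] at h <;> first | omega | skip
      obtain ⟨h₁, h₂⟩ := Nat.pair_eq_pair.1 (Nat.eq_of_mul_eq_mul_left (by norm_num) (Nat.add_right_cancel h))
      rw [ih₁ h₁, ih₂ h₂]
    | lam p M ih =>
      intro N h
      cases N <;> simp only [code] at h <;> first | omega | skip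
      obtain ⟨rfl, h'⟩ := Nat.pair_eq_pair.1 (Nat.eq_of_mul_eq_mul_left (by norm_num) (Nat.add_right_cancel h))
      rw [ih h']
  · intro n
    induction n using Nat.strong_induction_on with
    | _ n ih =>
      have l := Nat.unpair_left_le (n / 5)
      have r := Nat.unpair_right_le (n / 5)
      have e := Nat.pair_unpair (n / 5)
      have : n % 5 = 0 ∨ n % 5 = 1 ∨ n % 5 = 2 ∨ n % 5 = 3 ∨ n % 5 = 4 := by omega
      rcases this with h | h | h | h | h
      · exact ⟨var (n / 5), by rw [code]; omega⟩
      · refine ⟨atom (n / 5).unpair.1 (Denumerable.ofNat _ (n / 5).unpair.2), ?_⟩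
        rw [code, Denumerable.encode_ofNat, e]
        omega
      · obtain ⟨M, hM⟩ := ih (n / 5) (by omega)
        exact ⟨bang M, by rw [code, hM]; omega⟩
      · obtain ⟨M, hM⟩ := ih _ (by omega : (n / 5).unpair.1 < n)
        obtain ⟨N, hN⟩ := ih _ (by omega : (n / 5).unpair.2 < n)
        exact ⟨app M N, by rw [code, hM, hN, e]; omega⟩
      · obtain ⟨M, hM⟩ := ih _ (by omega : (n / 5).unpair.2 < n)
        exact ⟨lam (n / 5).unpair.1 M, by rw [code, hM, e]; omega⟩

noncomputable instance : Primcodable Tm := Primcodable.ofEquiv ℕ (Equiv.ofBijective code code_bijective)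

theorem primrec_code : Primrec code := Primrec.of_equiv (e := Equiv.ofBijective code code_bijective)

theorem primrec_of_code {α : Type*} [Primcodable α] {f : α → Tm}
    (hf : Primrec fun a => (f a).code) : Primrec f :=
  (Primrec.of_equiv_iff (Equiv.ofBijective code code_bijective)).1 hf

variable {α : Type*} [Primcodable α]

@[fun_prop] theorem primrec_var {f : α → ℕ} (hf : Primrec f) : Primrec fun a => var (f a) :=
  primrec_of_code (by simp only [code]; fun_prop)

@[fun_prop] theorem primrec_atom {f : α → ℕ} {g : α → List ℕ} (hf : Primrec f) (hg : Primrec g) :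
    Primrec fun a => atom (f a) (g a) :=
  primrec_of_code (by simp only [code]; fun_prop)

@[fun_prop] theorem primrec_bang {f : α → Tm} (hf : Primrec f) : Primrec fun a => bang (f a) :=
  primrec_of_code (by
    have := primrec_code.comp hf
    simp only [code]
    fun_prop)

@[fun_prop] theorem primrec_app {f g : α → Tm} (hf : Primrec f) (hg : Primrec g) :
    Primrec fun a => app (f a) (g a) :=
  primrec_of_code (by
    have := primrec_code.comp hf
    have := primrec_code.comp hg
    simp only [code]
    fun_prop)

@[fun_prop] theorem primrec_lam {f : α → ℕ} {g : α → Tm} (hf : Primrec f) (hg : Primrec g) :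
    Primrec fun a => lam (f a) (g a) :=
  primrec_of_code (by
    have := primrec_code.comp hg
    simp only [code]
    fun_prop)

@[fun_prop] theorem primrec_map_qvar {f : α → List ℕ} (hf : Primrec f) :
    Primrec fun a => (f a).map qvar := primrec_map hf (by fun_prop)

@[fun_prop] theorem primrec_qtree {f : α → List ℕ} (hf : Primrec f) :
    Primrec fun a => qtree (f a) := by
  have h : Primrec fun q : List Tm × Tm × Tm => app (app consC q.2.1) q.2.2 := by fun_prop
  have : Primrec tree :=
    Primrec.list_foldr Primrec.id (Primrec.const (tup [])) h.to₂
  exact this.comp (primrec_map_qvar hf)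

theorem bw_eq (p : ℕ) : bw p = (p - 2) + (1 - (p - 1)) := by
  match p with
  | 0 => rfl
  | 1 => rfl
  | n + 2 => simp [bw]

@[fun_prop] theorem primrec_bw {f : α → ℕ} (hf : Primrec f) : Primrec fun a => bw (f a) := by
  simp only [bw_eq]
  fun_prop

/-- The substitution under `d` binders that instantiates the next variables by `Ns` and shifts the
others by `k`. -/
def opS (d : ℕ) (Ns : List Tm) (k : ℕ) : ℕ → Tm := fun i =>
  if i < d then var i else
    if h : i - d < Ns.length then Ns[i - d].rename (· + d) else var (i - Ns.length + k)

/-- Shifts and instantiations both have the form `opS`, and this family is closed under lifting.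
Substitution can thus be described by rules about finite data, without showing that a recursion on
terms is primitive recursive. -/
theorem ups_opS (b d : ℕ) (Ns : List Tm) (k : ℕ) : ups b (opS d Ns k) = opS (d + b) Ns k := by
  funext i
  simp only [ups, opS]
  by_cases h₁ : i < b
  · rw [if_pos h₁, if_pos (by omega)]
  · rw [if_neg h₁]
    by_cases h₂ : i - b < d
    · rw [if_pos h₂, if_pos (by omega), rename]
      congr 1
      omega
    · rw [if_neg h₂, if_neg (by omega)]
      have e : i - (d + b) = i - b - d := by omega
      by_cases h₃ : i - b - d < Ns.length
      · rw [dif_pos h₃, dif_pos (by omega), rename_rename]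
        simp only [e]
        congr 1
        funext x
        simp [add_assoc]
      · rw [dif_neg h₃, dif_neg (by omega), rename]
        congr 1
        omega

theorem opS_nil (d : ℕ) : opS 0 [] d = fun i => var (i + d) := by
  funext i
  simp [opS]

theorem opS_inst (Ns : List Tm) : opS 0 Ns 0 = instS Ns := by
  funext i
  simp only [opS, instS, Nat.not_lt_zero, if_false, Nat.sub_zero, add_zero]
  by_cases h : i < Ns.length
  · rw [dif_pos h, List.getElem?_eq_getElem h, Option.getD_some]
    simp [rename_eq_subst, subst_var]
  · rw [dif_neg h, List.getElem?_eq_none (by omega), Option.getD_none]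

end Tm

/-- The judgements of evaluation: substitution (`0`), evaluation (`1`), and contraction (`2`). -/
abbrev Fact : Type := ℕ × ℕ × ℕ × List Tm × Tm × Tm × List Label

abbrev opF (d : ℕ) (Ns : List Tm) (k : ℕ) (M M' : Tm) : Fact := (0, d, k, Ns, M, M', [])
abbrev evF (k : ℕ) (A : Tm) (t : List Label) (v : Tm) (k' : ℕ) : Fact := (1, k, k', [], A, v, t)
abbrev deltaF (k : ℕ) (F A : Tm) (t : List Label) (B : Tm) (k' : ℕ) : Fact :=
  (2, k, k', [A], F, B, t)

def Fact.Holds (c : Fact) : Prop :=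
  (∀ d Ns k M M', c = opF d Ns k M M' → M' = M.subst (opS d Ns k)) ∧
  (∀ k A t v k', c = evF k A t v k' → EvC k A t v k') ∧
  ∀ k F A t B k', c = deltaF k F A t B k' → Delta F A t B ∧
    (∀ j r, Sum.inl (j, r) ∈ t → r = k) ∧ k' = k + newNum t

theorem Fact.holds_op {d : ℕ} {Ns : List Tm} {k : ℕ} {M M' : Tm} :
    (opF d Ns k M M').Holds ↔ M' = M.subst (opS d Ns k) := by
  refine ⟨fun h => h.1 _ _ _ _ _ rfl, fun h => ⟨?_, by simp, by simp⟩⟩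
  rintro d Ns k M M' e
  simp only [Prod.mk.injEq] at e
  obtain ⟨_, rfl, rfl, rfl, rfl, rfl, _⟩ := e
  exact h

theorem Fact.holds_ev {k k' : ℕ} {A v : Tm} {t : List Label} :
    (evF k A t v k').Holds ↔ EvC k A t v k' := by
  refine ⟨fun h => h.2.1 _ _ _ _ _ rfl, fun h => ⟨by simp, ?_, by simp⟩⟩
  rintro k A t v k' e
  simp only [Prod.mk.injEq] at e
  obtain ⟨_, rfl, rfl, _, rfl, rfl, rfl⟩ := e
  exact h

theorem Fact.holds_delta {k k' : ℕ} {F A B : Tm} {t : List Label} :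
    (deltaF k F A t B k').Holds ↔ Delta F A t B ∧
      (∀ j r, Sum.inl (j, r) ∈ t → r = k) ∧ k' = k + newNum t := by
  refine ⟨fun h => h.2.2 _ _ _ _ _ _ rfl, fun h => ⟨by simp, by simp, ?_⟩⟩
  rintro k F A t B k' e
  simp only [Prod.mk.injEq, List.cons.injEq] at e
  obtain ⟨_, rfl, rfl, ⟨rfl, _⟩, rfl, rfl, rfl⟩ := e
  exact h

section Rules

variable {W : Type} [Primcodable W]

/-- The system with one rule. -/
noncomputable def rule (concl : W → Fact) (prems : W → List Fact) (h₁ : Primrec concl)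
    (h₂ : Primrec prems) : Rules Fact := ⟨W, concl, prems, h₁, h₂⟩

end Rules

/-- The rules of substitution. -/
noncomputable def opRules : Rules Fact :=
  (rule (W := ℕ × List Tm × ℕ × ℕ)
    (fun (j, Ns, k, i) => opF (i + j + 1) Ns k (var i) (var i)) (fun _ => [])
    (by fun_prop) (by fun_prop)).sum <|
  (rule (W := ℕ × List Tm × Tm × List Tm × ℕ × Tm)
    (fun (d, Ns, N, Ns', k, N') => opF d (Ns ++ N :: Ns') k (var (d + Ns.length)) N')
    (fun (d, _, N, _, _, N') => [opF 0 [] d N N']) (by fun_prop) (by fun_prop)).sum <|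
  (rule (W := ℕ × List Tm × ℕ × ℕ)
    (fun (d, Ns, k, j) => opF d Ns k (var (d + Ns.length + j)) (var (d + j + k))) (fun _ => [])
    (by fun_prop) (by fun_prop)).sum <|
  (rule (W := ℕ × List Tm × ℕ × ℕ × List ℕ)
    (fun (d, Ns, k, n, l) => opF d Ns k (atom n l) (atom n l)) (fun _ => [])
    (by fun_prop) (by fun_prop)).sum <|
  (rule (W := ℕ × List Tm × ℕ × Tm × Tm)
    (fun (d, Ns, k, M, M') => opF d Ns k (bang M) (bang M'))
    (fun (d, Ns, k, M, M') => [opF d Ns k M M']) (by fun_prop) (by fun_prop)).sum <|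
  (rule (W := ℕ × List Tm × ℕ × Tm × Tm × Tm × Tm)
    (fun (d, Ns, k, M, M', N, N') => opF d Ns k (app M N) (app M' N'))
    (fun (d, Ns, k, M, M', N, N') => [opF d Ns k M M', opF d Ns k N N'])
    (by fun_prop) (by fun_prop)).sum <|
  rule (W := ℕ × List Tm × ℕ × ℕ × Tm × Tm)
    (fun (d, Ns, k, p, M, M') => opF d Ns k (lam p M) (lam p M'))
    (fun (d, Ns, k, p, M, M') => [opF (d + bw p) Ns k M M']) (by fun_prop) (by fun_prop)

/-- The rules of contraction. -/
noncomputable def deltaRules : Rules Fact :=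
  (rule (W := ℕ × Tm × Tm × Tm)
    (fun (k, M, P, B) => deltaF k (lam 0 M) (bang P) [] B k) (fun (_, M, P, B) => [opF 0 [P] 0 M B])
    (by fun_prop) (by fun_prop)).sum <|
  (rule (W := ℕ × Tm × List ℕ × Tm)
    (fun (k, M, qs, B) => deltaF k (lam (qs.length + 2) M) (tup qs) [] B k)
    (fun (_, M, qs, B) => [opF 0 (qs.map qvar) 0 M B]) (by fun_prop) (by fun_prop)).sum <|
  (rule (W := ℕ × ℕ)
    (fun (k, j) => deltaF k newC (bit j) [Sum.inl (j, k)] (qvar k) (k + 1)) (fun _ => [])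
    (by fun_prop) (by fun_prop)).sum <|
  (rule (W := ℕ × ℕ × List ℕ)
    (fun (k, i, qs) => deltaF k (gate i) (tup qs) [Sum.inr (i, qs)] (qtree qs) k) (fun _ => [])
    (by fun_prop) (by fun_prop)).sum <|
  (rule (W := ℕ × ℕ)
    (fun (k, r) => deltaF k consC (qvar r) [] (pcons r) k) (fun _ => [])
    (by fun_prop) (by fun_prop)).sum <|
  rule (W := ℕ × ℕ × List ℕ)
    (fun (k, r, qs) => deltaF k (pcons r) (tup qs) [] (tup (r :: qs)) k) (fun _ => [])
    (by fun_prop) (by fun_prop)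

/-- The rules of evaluation. -/
noncomputable def evRules : Rules Fact :=
  (rule (W := ℕ × ℕ × Tm)
    (fun (k, p, M) => evF k (lam p M) [] (lam p M) k) (fun _ => [])
    (by fun_prop) (by fun_prop)).sum <|
  (rule (W := ℕ × Tm)
    (fun (k, M) => evF k (bang M) [] (bang M) k) (fun _ => [])
    (by fun_prop) (by fun_prop)).sum <|
  (rule (W := ℕ × ℕ × List ℕ)
    (fun (k, n, l) => evF k (atom n l) [] (atom n l) k) (fun _ => [])
    (by fun_prop) (by fun_prop)).sum <|
  (rule (W := (ℕ × ℕ × ℕ) × (Tm × Tm × Tm × Tm × Tm) × List Label × List Label)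
    (fun ((k, _, k₂), (F, A, _, _, v), t₁, t₂) => evF k (app F A) (t₁ ++ t₂) v k₂)
    (fun ((k, k₁, k₂), (F, A, M, B, v), t₁, t₂) =>
      [evF k F t₁ (lam 1 M) k₁, opF 0 [A] 0 M B, evF k₁ B t₂ v k₂])
    (by fun_prop) (by fun_prop)).sum <|
  rule (W := (ℕ × ℕ × ℕ × ℕ × ℕ) × (Tm × Tm × Tm × Tm × Tm × Tm) ×
      List Label × List Label × List Label × List Label)
    (fun ((k, _, _, _, k₄), (F, A, _, _, _, v), t₁, t₂, t₃, t₄) =>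
      evF k (app F A) (t₁ ++ (t₂ ++ (t₃ ++ t₄))) v k₄)
    (fun ((k, k₁, k₂, k₃, k₄), (F, A, f, a, B, v), t₁, t₂, t₃, t₄) =>
      [evF k F t₁ f k₁, evF k₁ A t₂ a k₂, deltaF k₂ f a t₃ B k₃, evF k₃ B t₄ v k₄])
    (by fun_prop) (by fun_prop)

noncomputable def rules : Rules Fact := opRules.sum (deltaRules.sum evRules)

/-- Side conditions are built into the shape of the conclusions: depth `i + j + 1` exceeds `i`, the
index `d + Ns.length + j` lies beyond the instantiated ones, and `Ns ++ N :: Ns'` has the entry `N`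
at `Ns.length`. -/
theorem opRules_sound : opRules.Sound Fact.Holds := by
  simp only [opRules, Rules.sound_sum]
  refine ⟨?_, ?_, ?_, ?_, ?_, ?_, ?_⟩
  · rintro ⟨j, Ns, k, i⟩ -
    exact Fact.holds_op.2 (by rw [subst, opS, if_pos (by omega)])
  · rintro ⟨d, Ns, N, Ns', k, N'⟩ h
    have := Fact.holds_op.1 (h _ List.mem_cons_self)
    refine Fact.holds_op.2 ?_
    rw [this, opS_nil, ← rename_eq_subst, subst, opS, if_neg (by omega), dif_pos (by simp)]
    simp
  · rintro ⟨d, Ns, k, j⟩ -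
    refine Fact.holds_op.2 ?_
    rw [subst, opS, if_neg (by omega), dif_neg (by omega)]
    congr 1
    omega
  · rintro ⟨d, Ns, k, n, l⟩ -
    exact Fact.holds_op.2 rfl
  · rintro ⟨d, Ns, k, M, M'⟩ h
    have := Fact.holds_op.1 (h _ List.mem_cons_self)
    exact Fact.holds_op.2 (by rw [this, subst])
  · rintro ⟨d, Ns, k, M, M', N, N'⟩ h
    have h₁ := Fact.holds_op.1 (h _ List.mem_cons_self)
    have h₂ := Fact.holds_op.1 (h _ (List.mem_cons_of_mem _ List.mem_cons_self))
    exact Fact.holds_op.2 (by rw [h₁, h₂, subst])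
  · rintro ⟨d, Ns, k, p, M, M'⟩ h
    have := Fact.holds_op.1 (h _ List.mem_cons_self)
    exact Fact.holds_op.2 (by rw [this, subst, ups_opS])

theorem deltaRules_sound : deltaRules.Sound Fact.Holds := by
  simp only [deltaRules, Rules.sound_sum]
  refine ⟨?_, ?_, ?_, ?_, ?_, ?_⟩
  · rintro ⟨k, M, P, B⟩ h
    have := Fact.holds_op.1 (h _ List.mem_cons_self)
    rw [opS_inst] at this
    dsimp only at this
    subst this
    exact Fact.holds_delta.2 ⟨.beta _ _, by simp, by simp⟩
  · rintro ⟨k, M, qs, B⟩ h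
    have := Fact.holds_op.1 (h _ List.mem_cons_self)
    rw [opS_inst] at this
    dsimp only at this
    subst this
    exact Fact.holds_delta.2 ⟨.pat _ _, by simp, by simp⟩
  · rintro ⟨k, j⟩ -
    exact Fact.holds_delta.2 ⟨.new _ _, by simp, by simp [Label.newWt]⟩
  · rintro ⟨k, i, qs⟩ -
    exact Fact.holds_delta.2 ⟨.gate _ _, by simp, by simp [Label.newWt]⟩
  · rintro ⟨k, r⟩ -
    exact Fact.holds_delta.2 ⟨.cons _, by simp, by simp⟩
  · rintro ⟨k, r, qs⟩ -
    exact Fact.holds_delta.2 ⟨.pcons _ _, by simp, by simp⟩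

theorem evRules_sound : evRules.Sound Fact.Holds := by
  simp only [evRules, Rules.sound_sum]
  refine ⟨?_, ?_, ?_, ?_, ?_⟩
  · rintro ⟨k, p, M⟩ -
    exact Fact.holds_ev.2 (.val trivial)
  · rintro ⟨k, M⟩ -
    exact Fact.holds_ev.2 (.val trivial)
  · rintro ⟨k, n, l⟩ -
    exact Fact.holds_ev.2 (.val trivial)
  · rintro ⟨⟨k, k₁, k₂⟩, ⟨F, A, M, B, v⟩, t₁, t₂⟩ h
    have h₁ := Fact.holds_ev.1 (h (evF k F t₁ (lam 1 M) k₁) (by simp [rule]))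
    have h₂ := Fact.holds_op.1 (h (opF 0 [A] 0 M B) (by simp [rule]))
    have h₃ := Fact.holds_ev.1 (h (evF k₁ B t₂ v k₂) (by simp [rule]))
    rw [opS_inst] at h₂
    subst h₂
    exact Fact.holds_ev.2 (.lin h₁ h₃)
  · rintro ⟨⟨k, k₁, k₂, k₃, k₄⟩, ⟨F, A, f, a, B, v⟩, t₁, t₂, t₃, t₄⟩ h
    have h₁ := Fact.holds_ev.1 (h (evF k F t₁ f k₁) (by simp [rule]))
    have h₂ := Fact.holds_ev.1 (h (evF k₁ A t₂ a k₂) (by simp [rule]))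
    have h₃ := Fact.holds_delta.1 (h (deltaF k₂ f a t₃ B k₃) (by simp [rule]))
    have h₄ := Fact.holds_ev.1 (h (evF k₃ B t₄ v k₄) (by simp [rule]))
    obtain ⟨hd, hn, rfl⟩ := h₃
    exact Fact.holds_ev.2 (.strict h₁ h₂ hd hn h₄)

/-- Completeness of the rules of substitution. An instantiated variable yields a shifted entry of
`Ns`, and shifting is again a substitution. To avoid a circle, the variables that yield variables
come first; this settles all shifts, and then the instantiated variables follow. -/
theorem sound_op {P : Fact → Prop} (h : opRules.Sound P) (d : ℕ) (Ns : List Tm) (k : ℕ) (M : Tm) :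
    P (opF d Ns k M (M.subst (opS d Ns k))) := by
  simp only [opRules, Rules.sound_sum] at h
  obtain ⟨h₁, h₂, h₃, h₄, h₅, h₆, h₇⟩ := h
  have hv : ∀ d Ns k i, d + Ns.length ≤ i ∨ i < d → P (opF d Ns k (var i) (opS d Ns k i)) := by
    rintro d Ns k i (hi | hi)
    · obtain ⟨j, rfl⟩ := Nat.exists_eq_add_of_le hi
      have : opS d Ns k (d + Ns.length + j) = var (d + j + k) := by
        rw [opS, if_neg (by omega), dif_neg (by omega)]
        congr 1
        omega
      rw [this]
      exact h₃ (d, Ns, k, j) (by simp [rule])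
    · obtain ⟨j, rfl⟩ := Nat.exists_eq_add_of_lt hi
      have : opS (i + j + 1) Ns k i = var i := by rw [opS, if_pos (by omega)]
      rw [this]
      exact h₁ (j, Ns, k, i) (by simp [rule])
  have of_var : ∀ (d : ℕ) (Ns : List Tm) (k : ℕ) (M : Tm),
      (∀ d' i, P (opF d' Ns k (var i) (opS d' Ns k i))) →
      P (opF d Ns k M (M.subst (opS d Ns k))) := by
    intro d Ns k M hP
    induction M generalizing d with
    | var i => exact hP d i
    | atom n l => exact h₄ (d, Ns, k, n, l) (by simp [rule])
    | bang M ih => exact h₅ (d, Ns, k, M, _) (by simpa [rule] using ih d)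
    | app M N ih₁ ih₂ =>
      exact h₆ (d, Ns, k, M, _, N, _) (by simpa [rule] using ⟨ih₁ d, ih₂ d⟩)
    | lam p M ih =>
      rw [subst, ups_opS]
      exact h₇ (d, Ns, k, p, M, _) (by simpa [rule] using ih (d + bw p))
  refine of_var d Ns k M fun d i => ?_
  by_cases hi : d + Ns.length ≤ i ∨ i < d
  · exact hv d Ns k i hi
  · obtain ⟨j, rfl⟩ := Nat.exists_eq_add_of_le (by omega : d ≤ i)
    have hj : j < Ns.length := by omega
    have e : opS d Ns k (d + j) = Ns[j].subst (opS 0 [] d) := by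
      rw [opS, if_neg (by omega), dif_pos (by omega), opS_nil, ← rename_eq_subst]
      simp
    have e' : Ns = Ns.take j ++ Ns[j] :: Ns.drop (j + 1) := by simp
    have := h₂ (d, Ns.take j, Ns[j], Ns.drop (j + 1), k, Ns[j].subst (opS 0 [] d)) (by
      simpa [rule] using of_var 0 [] d Ns[j] fun d' i => hv d' [] d i (by simp; omega))
    simp only [rule, ← e', List.length_take, min_eq_left hj.le] at this
    rw [e]
    exact this

theorem sound_delta {P : Fact → Prop} (h : deltaRules.Sound P) (h₀ : opRules.Sound P) {k : ℕ}
    {F A B : Tm} {t : List Label} (hd : Delta F A t B) (hk : ∀ j r, Sum.inl (j, r) ∈ t → r = k) :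
    P (deltaF k F A t B (k + newNum t)) := by
  simp only [deltaRules, Rules.sound_sum] at h
  obtain ⟨h₁, h₂, h₃, h₄, h₅, h₆⟩ := h
  cases hd with
  | beta M Q =>
    have := sound_op h₀ 0 [Q] 0 M
    rw [opS_inst] at this
    exact h₁ (k, M, Q, _) (by simpa [rule] using this)
  | pat M qs =>
    have := sound_op h₀ 0 (qs.map qvar) 0 M
    rw [opS_inst] at this
    exact h₂ (k, M, qs, _) (by simpa [rule] using this)
  | new j r =>
    obtain rfl := hk j r (by simp)
    exact h₃ (r, j) (by simp [rule])
  | gate i qs => exact h₄ (k, i, qs) (by simp [rule])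
  | cons r => exact h₅ (k, r) (by simp [rule])
  | pcons r qs => exact h₆ (k, r, qs) (by simp [rule])

/-- Evaluation is partial, so it is not presented as a function: its graph is the set of derivable
facts of this form, which is what a search can use. -/
theorem der_ev_iff {k k' : ℕ} {A v : Tm} {t : List Label} :
    rules.Der (evF k A t v k') ↔ EvC k A t v k' := by
  constructor
  · intro h
    refine Fact.holds_ev.1 (h _ ?_)
    simp only [rules, Rules.sound_sum]
    exact ⟨opRules_sound, deltaRules_sound, evRules_sound⟩
  · intro h P hP
    simp only [rules, Rules.sound_sum] at hP
    obtain ⟨h₀, hd, he⟩ := hP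
    simp only [evRules, Rules.sound_sum] at he
    obtain ⟨h₁, h₂, h₃, h₄, h₅⟩ := he
    induction h with
    | @val k v hv =>
      cases v with
      | var i => exact hv.elim
      | app M N => exact hv.elim
      | atom n l => exact h₃ (k, n, l) (by simp [rule])
      | bang M => exact h₂ (k, M) (by simp [rule])
      | lam p M => exact h₁ (k, p, M) (by simp [rule])
    | @lin k k₁ k₂ F A M v t₁ t₂ _ _ ih₁ ih₂ =>
      have := sound_op h₀ 0 [A] 0 M
      rw [opS_inst] at this
      exact h₄ ((k, k₁, k₂), (F, A, M, _, v), t₁, t₂) (by simpa [rule] using ⟨ih₁, this, ih₂⟩)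
    | @strict k k₁ k₂ k₄ F A f a B v t₁ t₂ t₃ t₄ _ _ hδ hn _ ih₁ ih₂ ih₃ =>
      have := sound_delta hd h₀ hδ hn
      exact h₅ ((k, k₁, k₂, _, k₄), (F, A, f, a, B, v), t₁, t₂, t₃, t₄)
        (by simpa [rule] using ⟨ih₁, ih₂, this, ih₃⟩)

/-- Evaluations to tuples are found by a computable search. -/
theorem exists_computable_eval {S : ℕ → Tm} (hS : Computable S)
    (h : ∀ n, ∃ t ss k', EvC 0 (S n) t (tup ss) k') :
    ∃ F : ℕ → List Label × List ℕ, Computable F ∧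
      ∀ n, ∃ k', EvC 0 (S n) (F n).1 (tup (F n).2) k' := by
  classical
  have hc : Computable₂ fun (n : ℕ) (x : (List Label × List ℕ) × ℕ) =>
      evF 0 (S n) x.1.1 (tup x.1.2) x.2 := by
    have h₁ : Primrec fun y : Tm × (List Label × List ℕ) × ℕ =>
        evF 0 y.1 y.2.1.1 (tup y.2.1.2) y.2.2 := by fun_prop
    have h₂ : Computable fun q : ℕ × (List Label × List ℕ) × ℕ => (S q.1, q.2) :=
      (hS.comp Computable.fst).pair Computable.snd
    have h₃ := h₁.to_comp.comp h₂
    exact h₃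
  obtain ⟨F, hF, hF'⟩ := rules.exists_computable hc fun n => by
    obtain ⟨t, ss, k', hn⟩ := h n
    exact ⟨((t, ss), k'), der_ev_iff.2 hn⟩
  exact ⟨fun n => (F n).1, Computable.fst.comp hF, fun n => ⟨_, der_ev_iff.1 (hF' n)⟩⟩

end QCalc

namespace QCalc
open Tm

variable {E : GateEnum}

/-! ### Traces of computations -/

theorem Term.tr_below {k : ℕ} {M : Term} (h : ∀ r ∈ M.qvars, r < k) : M.tr.Below k := by
  induction M with
  | var i => trivial
  | qvar r => simpa [tr, Below, qvars] using h
  | bang M ih => exact ih h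
  | bit b => simp [tr, Below]
  | gate i => simp [tr, Below]
  | new M ih => exact ⟨by simp [Below], ih h⟩
  | app M N ih₁ ih₂ =>
    simp only [qvars, Finset.mem_union] at h
    exact ⟨ih₁ fun r hr => h r (.inl hr), ih₂ fun r hr => h r (.inr hr)⟩
  | tuple n Ms ih =>
    simp only [qvars, Finset.mem_biUnion, Finset.mem_univ, true_and] at h
    have : ∀ N ∈ List.ofFn fun i => (Ms i).tr, N.Below k := by
      intro N hN
      obtain ⟨i, rfl⟩ := List.mem_ofFn.1 hN
      exact ih i fun r hr => h r ⟨i, hr⟩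
    rw [tr]
    generalize List.ofFn (fun i => (Ms i).tr) = l at this
    induction l with
    | nil => simp [tree, Below]
    | cons N l ihl =>
      simp only [List.mem_cons, forall_eq_or_imp] at this
      exact ⟨⟨by simp [Below], this.1⟩, ihl this.2⟩
  | lam p M ih => exact ih h

theorem Term.tr_mapA_of_bits {f : ℕ → ℕ} (h₀ : f 0 = 0) (h₁ : f 1 = 1) (M : Term) :
    M.tr.mapA f id = M.tr := by
  induction M with
  | tuple n Ms ih => simp only [tr, mapA_tree, List.map_ofFn, Function.comp_def, ih]
  | bit b => cases b <;> simp [tr, mapA, atomMap, h₀, h₁]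
  | qvar r => simp [tr, mapA, atomMap]
  | gate i => simp [tr, mapA, atomMap]
  | new M ih => simp [tr, mapA, atomMap, ih]
  | _ => simp_all [tr, mapA]

theorem Tm.Lin.observe {C : Tm} (h : C.Lin) : (observe C).Lin := by
  have : collector.Lin := by
    simp [collector, Lin, occ, wt, bw, low, Pi.single_apply]
  exact ⟨⟨h, this, this⟩, trivial⟩

theorem Tm.Below.observe {k : ℕ} {C : Tm} (h : C.Below k) : (observe C).Below k := by
  refine ⟨⟨h, ?_⟩, ?_⟩ <;> simp [Below, collector]

theorem Tm.GatesIn.observe {G : Set ℕ} {C : Tm} (h : C.GatesIn G) : (observe C).GatesIn G := by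
  refine ⟨⟨h, ?_⟩, ?_⟩ <;> simp [GatesIn, collector]

theorem tlist_mapA (f ρ : ℕ → ℕ) (l : List Tm) :
    (tlist l).mapA f ρ = tlist (l.map (Tm.mapA f ρ)) := by
  induction l with
  | nil => rfl
  | cons M l ih => simp only [tlist, Tm.mapA, mapA_rename, ih, List.map_cons]

theorem observe_mapA (f ρ : ℕ → ℕ) (C : Tm) :
    (observe C).mapA f ρ = observe (C.mapA f ρ) := by
  simp [observe, collector, mapA, atomMap]

theorem inputTm_mapA (f ρ : ℕ → ℕ) (M : Tm) (bs : List Tm) :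
    (inputTm M bs).mapA f ρ = inputTm (M.mapA f ρ) (bs.map (Tm.mapA f ρ)) := by
  simp [inputTm, mapA, tlist_mapA, Function.comp_def]

theorem Tm.Lin.inputTm {M : Tm} {bs : List Tm} (h : M.Lin) (hb : ∀ b ∈ bs, b.Lin) :
    (inputTm M bs).Lin := by
  refine ⟨h, Lin.tlist (l := bs.map bang) fun N hN => ?_⟩
  obtain ⟨b, hb', rfl⟩ := List.mem_map.1 hN
  exact hb b hb'

theorem Tm.Below.inputTm {k : ℕ} {M : Tm} {bs : List Tm} (h : M.Below k)
    (hb : ∀ b ∈ bs, b.Below k) : (inputTm M bs).Below k := by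
  refine ⟨h, Below.tlist (l := bs.map bang) fun N hN => ?_⟩
  obtain ⟨b, hb', rfl⟩ := List.mem_map.1 hN
  exact hb b hb'

theorem Tm.GatesIn.inputTm {G : Set ℕ} {M : Tm} {bs : List Tm} (h : M.GatesIn G)
    (hb : ∀ b ∈ bs, b.GatesIn G) : (inputTm M bs).GatesIn G := by
  refine ⟨h, GatesIn.tlist (l := bs.map bang) fun N hN => ?_⟩
  obtain ⟨b, hb', rfl⟩ := List.mem_map.1 hN
  exact hb b hb'

/-- The observed computation on the bits `c_1,…,c_n`. -/
def bitRun (M : Term) (cs : List Bool) : Tm :=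
  observe (inputTm M.tr (cs.map fun c => bit c.toNat))

/-- A computation gives an evaluation of the observed term to a tuple. -/
theorem Computes.trace {M : Term} {cs : List Bool} {m : ℕ} {Q : Reg (outVars m)}
    (hM : M.WellFormed) (h : Computes E M cs m Q) :
    M.qvars = ∅ ∧ ∃ t, Ev (bitRun M cs) t (tup (List.range' 1 m)) ∧
      hat Q = act E bitVal t zeroState ∧
      (∀ r, newCount r t = if r ∈ outVars m then 1 else 0) ∧ GatesFit E t := by
  obtain ⟨h₀, h', hr, -⟩ := h
  have hq : M.qvars = ∅ := by
    simp only [applyInput, Term.qvars, Finset.subset_empty, Finset.union_eq_empty] at h₀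
    exact h₀.1
  refine ⟨hq, ?_⟩
  have hlin : (inputTm M.tr (cs.map fun c => bit c.toNat)).Lin :=
    (WF.lin hM).1.inputTm (List.forall_mem_map.2 fun _ _ => trivial)
  have hb : (inputTm M.tr (cs.map fun c => bit c.toNat)).Below 0 :=
    (Term.tr_below (by simp [hq])).inputTm (List.forall_mem_map.2 fun _ _ => by simp [Below])
  obtain ⟨s, hc, hs, hn, hg⟩ := Reached.reflTransGen hr hlin hb.qc hb
    (C₀ := ⟨∅, fun _ => 1, applyInput M cs, h₀⟩) rfl
    ⟨[], by rw [tr_applyInput]; exact .refl _, rfl, by simp, by simp [GatesFit]⟩ _ rfl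
  rw [tr_outList] at hc
  -- The reduction is performed inside of the observing context, whose hole is in function position,
  -- and then turned into an evaluation with an equivalent trace.
  obtain ⟨t, he, ht⟩ := ((hc.appL _).appL _ : Chain (bitRun M cs) s _).expand
    (observe_tlist (List.range' 1 m)) hlin.observe fun r => by
      have h₁ := hb.observe.qc r
      have h₂ := hn r
      rw [observe] at h₁
      split at h₂ <;> omega
  refine ⟨t, he, ?_, fun r => ?_, fun i qs hi => hg i qs (ht.perm.mem_iff.1 hi)⟩
  · rw [ht.act_eq]
    exact hs
  · rw [ht.newCount_eq]
    exact hn r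

/-! ### Creations before gates -/

/-- The creations in a trace. -/
def news (t : List Label) : List (ℕ × ℕ) := t.filterMap Sum.getLeft?

/-- The gates in a trace. -/
def gateSeq (t : List Label) : GateSeq := t.filterMap Sum.getRight?

theorem mem_news {t : List Label} {a : ℕ × ℕ} : a ∈ news t ↔ Sum.inl a ∈ t := by
  simp [news, List.mem_filterMap]

theorem mem_gateSeq {t : List Label} {a : ℕ × List ℕ} : a ∈ gateSeq t ↔ Sum.inr a ∈ t := by
  simp [gateSeq, List.mem_filterMap]

theorem newCount_pos {t : List Label} {j r : ℕ} (h : Sum.inl (j, r) ∈ t) : 1 ≤ newCount r t := by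
  induction t with
  | nil => simp at h
  | cons a t ih =>
    rw [newCount, newWt_cons]
    rcases List.mem_cons.1 h with rfl | h
    · simp [Label.newWt]
    · have := ih h
      rw [newCount] at this
      omega

theorem exists_mem_of_newCount {t : List Label} {r : ℕ} (h : newCount r t ≠ 0) :
    ∃ j, Sum.inl (j, r) ∈ t := by
  induction t with
  | nil => simp at h
  | cons a t ih =>
    rw [newCount, newWt_cons] at h
    by_cases h' : newCount r t = 0
    · rw [newCount] at h'
      cases a with
      | inl a =>
        obtain ⟨j, r'⟩ := a
        have : r' = r := by
          by_contra hne
          exact h (by simp [Label.newWt, h', hne])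
        subst this
        exact ⟨j, by simp⟩
      | inr a => exact absurd h' (by simpa [Label.newWt] using h)
    · obtain ⟨j, hj⟩ := ih h'
      exact ⟨j, List.mem_cons_of_mem _ hj⟩

/-- A gate uses variables available before it. No variable is created twice, so all later creations
concern other names, and the gate can be moved past them. -/
theorem Scoped.teq {S : Set ℕ} {t : List Label} (h : Scoped S t)
    (hS : ∀ r ∈ S, newCount r t = 0) (ht : ∀ r, newCount r t ≤ 1) :
    TEq t ((news t).map Sum.inl ++ (gateSeq t).map Sum.inr) := by
  induction t generalizing S with
  | nil => exact .refl _
  | cons a t ih =>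
    simp only [newCount, newWt_cons] at hS ht ih
    cases a with
    | inl a =>
      refine .cons _ (ih h ?_ fun r => by have := ht r; omega)
      rintro r (rfl | hr)
      · have := ht a.2
        simp only [Label.newWt, Pi.single_eq_same] at this
        omega
      · have := hS r hr
        omega
    | inr a =>
      have h₁ := ih h.2 (fun r hr => by have := hS r hr; omega) fun r => by have := ht r; omega
      refine (TEq.cons _ h₁).trans ?_
      have h₂ : TEq (Sum.inr a :: (news t).map Sum.inl) ((news t).map Sum.inl ++ [Sum.inr a]) := by
        refine TEq.comm_one fun b hb => ?_
        obtain ⟨⟨j, r⟩, hc, rfl⟩ := List.mem_map.1 hb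
        refine List.disjoint_left.2 fun x hx hx' => ?_
        obtain rfl := List.mem_singleton.1 hx'
        have h₃ := newCount_pos (mem_news.1 hc)
        have := hS _ (h.1 _ hx)
        rw [newCount] at h₃
        omega
      have := h₂.append_right ((gateSeq t).map Sum.inr)
      rw [List.append_assoc] at this
      exact this

open Classical in
/-- The basis states. -/
noncomputable def basis (b : ℕ → Bool) : QState := fun f => if f = b then 1 else 0

theorem zeroState_eq : zeroState = basis fun _ => false := by
  funext f
  simp only [zeroState, hat, basis]
  by_cases h : f = fun _ => false
  · rw [if_pos h, if_pos fun r _ => by rw [h]]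
  · rw [if_neg h, if_neg fun h' => h (funext fun r => h' r (by simp))]

theorem newAct_basis {b : ℕ → Bool} {r : ℕ} (hr : b r = false) (c : Bool) :
    newAct c r (basis b) = basis (Function.update b r c) := by
  funext f
  simp only [newAct, basis]
  by_cases h : f = Function.update b r c
  · subst h
    rw [if_pos (by simp), if_pos, if_pos rfl]
    rw [Function.update_idem, ← hr, Function.update_eq_self]
  · rw [if_neg h]
    split_ifs with h₁ h₂
    · refine absurd ?_ h
      rw [← h₂, Function.update_idem, ← h₁, Function.update_eq_self]
    · rfl
    · rfl

theorem act_news_basis {β : ℕ → Bool} {l : List (ℕ × ℕ)} {b b' : ℕ → Bool}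
    (hl : (l.map Prod.snd).Nodup) (h : ∀ a ∈ l, b a.2 = false ∧ b' a.2 = β a.1)
    (h' : ∀ r, r ∉ l.map Prod.snd → b' r = b r) :
    act E β (l.map Sum.inl) (basis b) = basis b' := by
  induction l generalizing b with
  | nil => rw [funext fun r => h' r (by simp)]; rfl
  | cons a l ih =>
    simp only [List.map_cons, List.nodup_cons, List.mem_cons, forall_eq_or_imp] at hl h h'
    simp only [act, List.map_cons, List.foldl_cons] at ih ⊢
    rw [Label.act, newAct_basis h.1.1]
    refine ih hl.2 (fun c hc => ⟨?_, (h.2 c hc).2⟩) fun r hr => ?_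
    · rw [Function.update_of_ne, (h.2 c hc).1]
      rintro e
      exact hl.1 (e ▸ List.mem_map_of_mem hc)
    · by_cases e : r = a.2
      · subst e
        rw [Function.update_self, h.1.2]
      · rw [Function.update_of_ne e]
        exact h' r (by simp [e, hr])

theorem hat_ket {V : Finset ℕ} {b : ℕ → Bool} (hb : ∀ r, r ∉ V → b r = false) :
    hat (ket fun r : V => b r) = basis b := by
  funext f
  simp only [hat, ket, basis]
  by_cases h : f = b
  · subst h
    rw [if_pos hb, if_pos rfl, if_pos rfl]
  · rw [if_neg h]
    split_ifs with h₁ h₂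
    · refine absurd (funext fun r => ?_) h
      by_cases hr : r ∈ V
      · exact congrFun h₂ ⟨r, hr⟩
      · rw [h₁ r hr, hb r hr]
    · rfl
    · rfl

theorem act_gates {β : ℕ → Bool} {V : Finset ℕ} {K : GateSeq}
    (hK : ∀ a ∈ K, a.2.length = E.arity a.1 ∧ a.2.Nodup ∧ ∀ r ∈ a.2, r ∈ V) (φ : Reg V) :
    act E β (K.map Sum.inr) (hat φ) = hat (circuitOp E V K φ) := by
  induction K generalizing φ with
  | nil => rfl
  | cons a K ih =>
    simp only [List.mem_cons, forall_eq_or_imp] at hK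
    obtain ⟨⟨h₁, h₂, h₃⟩, hK⟩ := hK
    simp only [act, circuitOp, List.map_cons, List.foldl_cons] at ih ⊢
    rw [← ih hK, Label.act, dif_pos h₁, applyGate, dif_pos ⟨h₁, h₃⟩, hat_applyAt]
    intro i j hij
    have := (List.nodup_iff_injective_get.1 h₂) (Subtype.ext_iff.1 hij)
    exact (Fin.cast_injective _) this

end QCalc

namespace QCalc
open Tm

variable {E : GateEnum}

/-! ### The circuit family -/

/-- The index of the input bit that is given by the symbolic bit `j`, for inputs of length `n`. -/
def bitIdx (n j : ℕ) : ℕ := if j = 0 then 0 else if j = 1 then n + 1 else j - 1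

/-- The value of the symbolic bit `j`. -/
def symVal (cs : List Bool) (j : ℕ) : ℕ := (inputBit cs (bitIdx cs.length j)).toNat

/-- The observed computation on `n` symbolic bits. -/
def symRun (M : Term) (n : ℕ) : Tm :=
  observe (inputTm M.tr ((List.range n).map fun i => bit (i + 2)))

/-- All indices beyond `n` are read as `1`, just as `n + 1` is. Capping at `n + 1` is thus harmless,
and it makes the bound on `g` hold for every argument. -/
theorem inputBit_min (cs : List Bool) (i : ℕ) :
    inputBit cs (min i (cs.length + 1)) = inputBit cs i := by
  rcases Nat.le_total i (cs.length + 1) with h | h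
  · rw [min_eq_left h]
  · rw [min_eq_right h]
    obtain ⟨k, rfl⟩ : ∃ k, i = k + 1 := ⟨i - 1, by omega⟩
    simp only [inputBit]
    rw [List.getD_eq_default _ _ le_rfl, List.getD_eq_default _ _ (by omega)]

/-- The numbers `0` and `1` are kept for the constant bits in the term itself, so the input bit with
index `i + 1` is the symbolic bit `i + 2`; `bitIdx` undoes this numbering. -/
theorem symRun_mapA (M : Term) (cs : List Bool) :
    (symRun M cs.length).mapA (symVal cs) id = bitRun M cs := by
  have h₀ : symVal cs 0 = 0 := by simp [symVal, bitIdx, inputBit]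
  have h₁ : symVal cs 1 = 1 := by simp [symVal, bitIdx, inputBit]
  rw [symRun, observe_mapA, inputTm_mapA, Term.tr_mapA_of_bits h₀ h₁, bitRun, List.map_map]
  congr 2
  refine List.ext_getElem (by simp) fun i h h' => ?_
  simp only [List.length_map] at h'
  simp [mapA, atomMap, symVal, bitIdx, inputBit, h']

theorem symRun_lin {M : Term} (hM : M.WellFormed) (n : ℕ) : (symRun M n).Lin :=
  ((WF.lin hM).1.inputTm (List.forall_mem_map.2 fun _ _ => by simp [Lin])).observe

theorem symRun_below {M : Term} (hM : M.qvars = ∅) (n : ℕ) : (symRun M n).Below 0 :=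
  ((Term.tr_below (by simp [hM])).inputTm (List.forall_mem_map.2 fun _ _ => by simp [Below])).observe

theorem symRun_gatesIn {M : Term} {G : Set ℕ} (hM : M.tr.GatesIn G) (n : ℕ) :
    (symRun M n).GatesIn G :=
  (hM.inputTm (List.forall_mem_map.2 fun _ _ => by simp [GatesIn])).observe

/-- Lists of bits are closed, so the shifts in `tlist` have no effect on them and the input list is
obtained by a mere fold. -/
theorem tlist_bits_rename (l : List ℕ) (ρ : ℕ → ℕ) :
    (tlist (l.map fun i => bang (bit i))).rename ρ = tlist (l.map fun i => bang (bit i)) := by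
  induction l generalizing ρ with
  | nil => simp [tlist, rename, up, bw]
  | cons i l ih => simp [tlist, rename, up, bw, ih]

theorem primrec_symRun (M : Term) : Primrec (symRun M) := by
  have h₀ : Primrec fun p : List ℕ × ℕ × Tm =>
      lam 0 (lam 0 (app (app (var 1) (bang (bit p.2.1))) p.2.2)) := by fun_prop
  have h₁ : Primrec fun l : List ℕ => tlist (l.map fun i => bang (bit i)) := by
    refine (Primrec.list_foldr Primrec.id (Primrec.const (tlist [])) h₀.to₂).of_eq fun l => ?_
    induction l with
    | nil => rfl
    | cons i l ih =>
      simp only [List.map_cons, tlist, tlist_bits_rename] at ih ⊢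
      rw [← ih]
      rfl
  have h₂ : Primrec fun n : ℕ => (List.range n).map (· + 2) :=
    primrec_map Primrec.list_range (by fun_prop)
  have h₃ := h₁.comp h₂
  have h₄ : Primrec fun T : Tm =>
      app (app (app M.tr (bang T)) (bang (app collector (bang collector)))) (bang (tup [])) := by
    fun_prop
  refine (h₄.comp h₃).of_eq fun n => ?_
  simp [symRun, inputTm, observe, Function.comp_def]

/-- The names `1, 2, …` of the variables in the order of the list `ss`. -/
def outName (ss : List ℕ) (s : ℕ) : ℕ := ss.idxOf s + 1

/-- The trace of an evaluation to the tuple `ss`, with the names of the output variables. -/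
def outTrace (x : List Label × List ℕ) : List Label := x.1.map (Label.map id (outName x.2))

/-- The source of the variable `r`. -/
def src (t : List Label) (r : ℕ) : ℕ :=
  (news t).foldr (fun a j => if a.2 = r then a.1 else j) 0

theorem src_eq {t : List Label} {j r : ℕ} (ht : newCount r t ≤ 1) (h : Sum.inl (j, r) ∈ t) :
    src t r = j := by
  induction t with
  | nil => simp at h
  | cons a t ih =>
    rw [newCount, newWt_cons] at ht
    have hp : Sum.inl (j, r) ∈ t → 1 ≤ newWt (Pi.single r 1) t := fun h => newCount_pos h
    cases a with
    | inl a =>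
      simp only [Label.newWt, Pi.single_apply] at ht
      change (if a.2 = r then a.1 else src t r) = j
      rcases List.mem_cons.1 h with e | h
      · cases e
        exact if_pos rfl
      · have := hp h
        rw [if_neg fun e => by rw [if_pos e] at ht; omega]
        exact ih (by rw [newCount]; split at ht <;> omega) h
    | inr a =>
      have h' : Sum.inl (j, r) ∈ t := by simpa using h
      exact ih (by rw [newCount]; omega) h'

theorem primrec_outTrace : Primrec outTrace := by
  have h₁ : Primrec fun p : List ℕ × ℕ => outName p.1 p.2 :=
    Primrec.succ.comp (Primrec.list_idxOf.comp Primrec.snd Primrec.fst)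
  have h₂ : Primrec fun p : List ℕ × Label => p.2.map id (outName p.1) := by
    have h₃ : Primrec fun p : (List ℕ × Label) × ℕ × ℕ =>
        (Sum.inl (p.2.1, outName p.1.1 p.2.2) : Label) := by
      have := h₁.comp (f := fun p : List ℕ × ℕ => outName p.1 p.2)
        (g := fun p : (List ℕ × Label) × ℕ × ℕ => (p.1.1, p.2.2)) (by fun_prop)
      fun_prop
    have h₄ : Primrec fun p : (List ℕ × Label) × ℕ × List ℕ =>
        (Sum.inr (p.2.1, p.2.2.map (outName p.1.1)) : Label) := by
      have : Primrec fun p : (List ℕ × Label) × ℕ × List ℕ => p.2.2.map (outName p.1.1) :=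
        Primrec.list_map (by fun_prop) (h₁.comp (by fun_prop :
          Primrec fun q : ((List ℕ × Label) × ℕ × List ℕ) × ℕ => (q.1.1.1, q.2)))
      fun_prop
    refine (Primrec.sumCasesOn Primrec.snd h₃.to₂ h₄.to₂).of_eq fun p => ?_
    rcases p with ⟨ss, a | a⟩ <;> rfl
  exact Primrec.list_map Primrec.fst (h₂.comp (by fun_prop :
    Primrec fun q : (List Label × List ℕ) × Label => (q.1.2, q.2)))

theorem primrec_news : Primrec news := by
  have h : Primrec fun p : List Label × Label => p.2.getLeft? := by
    refine (Primrec.sumCasesOn (h := fun _ _ => none) Primrec.snd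
      (Primrec.option_some.comp Primrec.snd).to₂ (Primrec.const none).to₂).of_eq fun p => ?_
    rcases p with ⟨_, a | a⟩ <;> rfl
  exact Primrec.listFilterMap Primrec.id h.to₂

theorem primrec_gateSeq : Primrec gateSeq := by
  have h : Primrec fun p : List Label × Label => p.2.getRight? := by
    refine (Primrec.sumCasesOn (g := fun _ _ => none) Primrec.snd (Primrec.const none).to₂
      (Primrec.option_some.comp Primrec.snd).to₂).of_eq fun p => ?_
    rcases p with ⟨_, a | a⟩ <;> rfl
  exact Primrec.listFilterMap Primrec.id h.to₂

theorem primrec_src : Primrec₂ src := by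
  have h : Primrec fun p : (List Label × ℕ) × (ℕ × ℕ) × ℕ =>
      if p.2.1.2 = p.1.2 then p.2.1.1 else p.2.2 :=
    Primrec.ite (Primrec.eq.comp (by fun_prop) (by fun_prop)) (by fun_prop) (by fun_prop)
  exact Primrec.list_foldr (primrec_news.comp Primrec.fst) (Primrec.const 0) h.to₂

theorem primrec_bitIdx : Primrec₂ bitIdx :=
  Primrec.ite (Primrec.eq.comp Primrec.snd (Primrec.const 0)) (Primrec.const 0)
    (Primrec.ite (Primrec.eq.comp Primrec.snd (Primrec.const 1)) (by fun_prop) (by fun_prop))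

theorem newCount_map_left (f : ℕ → ℕ) (t : List Label) (r : ℕ) :
    newCount r (t.map (Label.map f id)) = newCount r t := by
  induction t with
  | nil => rfl
  | cons a t ih =>
    simp only [newCount, List.map_cons, newWt_cons] at ih ⊢
    rw [ih]
    cases a <;> rfl

theorem gateSeq_map_left (f : ℕ → ℕ) (t : List Label) :
    gateSeq (t.map (Label.map f id)) = gateSeq t := by
  induction t with
  | nil => rfl
  | cons a t ih =>
    cases a with
    | inl a => exact ih
    | inr a =>
      refine congrArg₂ List.cons ?_ ih
      simp

theorem nodup_news {t : List Label} (h : ∀ r, newCount r t ≤ 1) :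
    ((news t).map Prod.snd).Nodup := by
  induction t with
  | nil => exact List.nodup_nil
  | cons a t ih =>
    simp only [newCount, newWt_cons] at h ih
    have ih := ih fun r => by have := h r; omega
    cases a with
    | inl a =>
      refine List.nodup_cons.2 ⟨fun ha => ?_, ih⟩
      obtain ⟨⟨j, r⟩, hb, e⟩ := List.mem_map.1 ha
      have h₁ := newCount_pos (mem_news.1 hb)
      have h₂ := h a.2
      simp only at e
      subst e
      simp only [Label.newWt, Pi.single_eq_same] at h₂
      rw [newCount] at h₁
      omega
    | inr a => exact ih

/-- The trace of a computation is an instance of the trace of the symbolic computation. -/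
theorem Computes.symbolic {M : Term} {cs : List Bool} {m : ℕ} {Q : Reg (outVars m)}
    (hM : M.WellFormed) (h : Computes E M cs m Q) :
    ∃ t ss k', EvC 0 (symRun M cs.length) t (tup ss) k' ∧ ss.length = m ∧
      ∃ s, s = (outTrace (t, ss)).map (Label.map (symVal cs) id) ∧
        Ev (bitRun M cs) s (tup (List.range' 1 m)) ∧
        hat Q = act E bitVal s zeroState ∧
        (∀ r, newCount r s = if r ∈ outVars m then 1 else 0) ∧ GatesFit E s := by
  obtain ⟨hq, s, he, hs⟩ := h.trace hM
  obtain ⟨t, v, k', ρ, hev, -, rfl, hv, -, -⟩ :=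
    he.canonical (symRun_mapA M cs).symm (symRun_below hq _)
  obtain ⟨ss, rfl, hss⟩ := mapA_eq_atom hv.symm
  have hss : List.range' 1 m = ss.map ρ := hss
  refine ⟨t, ss, k', hev, by simpa using (congrArg List.length hss).symm, _, ?_, he, hs⟩
  have hle : ∀ r, (symRun M cs.length).qc r + newCount r t ≤ 1 := fun r => by
    rw [(symRun_below hq _).qc, hev.count.2]
    split <;> simp
  -- The initial term has no quantum variables and none gets lost, so every name in the trace
  -- appears in the final tuple.
  have hmem : ∀ a ∈ t, ∀ r ∈ a.supp, r ∈ ss := fun a ha r hr => by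
    have h₁ := hev.ev.supp (symRun_lin hM _) hle ha hr
    have h₂ := hev.ev.qc (symRun_lin hM _) (hle r)
    rw [qc_tup] at h₂
    exact List.count_pos_iff.1 (by omega)
  -- The actual output is `1, …, m` in this order. So the renaming takes each name to its position
  -- in `ss`, counted from one, whatever the input bits are.
  have hρ : ∀ r ∈ ss, ρ r = outName ss r := fun r hr => by
    have hi := List.idxOf_lt_length_of_mem hr
    have h₁ : (ss.map ρ)[ss.idxOf r]'(by simpa using hi) = ρ r := by simp
    rw [← h₁]
    simp only [← hss, List.getElem_range', outName]
    omega
  rw [outTrace, List.map_map]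
  refine List.map_congr_left fun a ha => ?_
  cases a with
  | inl a => simp [Label.map, hρ _ (hmem _ ha a.2 (by simp [Label.supp]))]
  | inr a =>
    simp only [Function.comp, Label.map, List.map_map, Sum.inr.injEq, Prod.mk.injEq, true_and]
    exact List.map_congr_left fun r hr => hρ r (hmem _ ha r hr)

/-- The circuits of the symbolic computation compute the results of all computations. -/
theorem Computes.eq_circuitOp {M : Term} {cs : List Bool} {m : ℕ} {Q : Reg (outVars m)}
    (hM : M.WellFormed) (h : Computes E M cs m Q) {n : ℕ} (hlen : cs.length = n)
    {t : List Label} {ss : List ℕ} {k' : ℕ} (hev : EvC 0 (symRun M n) t (tup ss) k') :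
    m = ss.length ∧ (∀ a ∈ gateSeq (outTrace (t, ss)),
        a.2.length = E.arity a.1 ∧ a.2.Nodup ∧ ∀ r ∈ a.2, r ∈ outVars m) ∧
      Q = circuitOp E (outVars m) (gateSeq (outTrace (t, ss))) (ket fun r => inputBit cs
        (min (bitIdx n (src (outTrace (t, ss)) r)) (n + 1))) := by
  subst hlen
  have hq := (h.trace hM).1
  obtain ⟨t', ss', k'', hev', hm, s, hs, he, hQ, hn, hg⟩ := h.symbolic hM
  -- By determinism, the given symbolic evaluation is the one that underlies the computation on
  -- `cs`.
  obtain ⟨rfl, e, -⟩ := hev.det hev'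
  cases e
  set τ := outTrace (t, ss) with hτ
  have hK : gateSeq s = gateSeq τ := by rw [hs, gateSeq_map_left]
  have hnτ : ∀ r, newCount r τ ≤ 1 := fun r => by
    have := hn r
    rw [hs, newCount_map_left] at this
    split at this <;> omega
  have hlin : (bitRun M cs).Lin :=
    ((WF.lin hM).1.inputTm (List.forall_mem_map.2 fun _ _ => by simp [Lin])).observe
  have hqc : ∀ r, (bitRun M cs).qc r = 0 :=
    (((Term.tr_below (by simp [hq])).inputTm
      (List.forall_mem_map.2 fun _ _ => by simp [Below])).observe).qc
  have hle : ∀ r, (bitRun M cs).qc r + newCount r s ≤ 1 := fun r => by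
    rw [hqc, hn]
    split <;> simp
  have hfit : ∀ a ∈ gateSeq τ,
      a.2.length = E.arity a.1 ∧ a.2.Nodup ∧ ∀ r ∈ a.2, r ∈ outVars m := by
    intro a ha
    rw [← hK, mem_gateSeq] at ha
    refine ⟨(hg _ _ ha).1, (hg _ _ ha).2, fun r hr => ?_⟩
    have := he.supp hlin hle ha hr
    rw [hqc, hn] at this
    by_contra hr'
    simp [hr'] at this
  refine ⟨hm.symm, hfit, hat_injective ?_⟩
  -- With the creations in front, it remains to see that they turn the zero state into the basis
  -- vector given by the input bits.
  have hsc := (he.scoped hlin hle).teq (fun r hr => by simp [hqc] at hr)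
    fun r => (Nat.le_add_left _ _).trans (hle r)
  rw [hQ, hsc.act_eq, act_append, zeroState_eq, hK, ← act_gates (β := bitVal) hfit]
  congr 1
  let b : ℕ → Bool := fun r => if r ∈ outVars m then
    inputBit cs (min (bitIdx cs.length (src τ r)) (cs.length + 1)) else false
  have hb : (ket fun r : outVars m => inputBit cs
      (min (bitIdx cs.length (src τ r)) (cs.length + 1))) = ket fun r : outVars m => b r := by
    congr 1
    funext r
    exact (if_pos r.2).symm
  rw [hb, hat_ket (b := b) fun r hr => if_neg hr]
  refine act_news_basis (nodup_news fun r => (Nat.le_add_left _ _).trans (hle r)) ?_ fun r hr => ?_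
  · rintro ⟨j, r⟩ ha
    rw [mem_news] at ha
    refine ⟨rfl, ?_⟩
    have hr : r ∈ outVars m := by
      by_contra hr
      have := newCount_pos ha
      rw [hn, if_neg hr] at this
      omega
    rw [hs] at ha
    obtain ⟨c, hc, e⟩ := List.mem_map.1 ha
    cases c with
    | inr c => simp [Label.map] at e
    | inl c =>
      simp only [Label.map, id, Sum.inl.injEq, Prod.mk.injEq] at e
      obtain ⟨rfl, rfl⟩ := e
      simp only [b, if_pos hr]
      rw [inputBit_min, src_eq (hnτ _) hc, symVal, bitVal_toNat]
  · refine if_neg fun hr' => ?_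
    obtain ⟨j, hj⟩ := exists_mem_of_newCount (t := s) (r := r) (by rw [hn, if_pos hr']; omega)
    exact hr (List.mem_map.2 ⟨(j, r), mem_news.2 hj, rfl⟩)

end QCalc

theorem mainTheorem7 (E : QCalc.GateEnum) (M : QCalc.Term) (hM : QCalc.QRel E M) :
    ∃ (f : ℕ → ℕ) (g : ℕ → ℕ → ℕ) (h : ℕ → ℕ), QCalc.IsFinGenCircuitFamily E f g h ∧
      ∀ (cs : List Bool) (m : ℕ) (Q : QCalc.Reg (QCalc.outVars m)),
        QCalc.Computes E M cs m Q →
          m = f cs.length ∧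
          Q = QCalc.circuitOp E (QCalc.outVars m) (QCalc.circuit E (h cs.length))
            (QCalc.ket fun r => QCalc.inputBit cs (g cs.length r)) := by
  open QCalc in
  obtain ⟨hwf, hM⟩ := hM
  obtain ⟨G, hG, hMG⟩ := Tm.GatesIn.exists_finite M.tr
  -- The symbolic run depends on the length only, so the input of `n` zeros suffices to show that it
  -- has an evaluation and that the search ends.
  obtain ⟨F, hF, hev⟩ := exists_computable_eval (primrec_symRun M).to_comp fun n => by
    obtain ⟨m, Q, h⟩ := hM (List.replicate n false)
    obtain ⟨t, ss, k', h, -⟩ := h.symbolic hwf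
    rw [List.length_replicate] at h
    exact ⟨t, ss, k', h⟩
  have hτ : Computable fun n => outTrace (F n) := primrec_outTrace.to_comp.comp hF
  have hcirc : ∀ n, (∀ a ∈ gateSeq (outTrace (F n)), a.2.length = E.arity a.1 ∧ a.2.Nodup ∧
      ∀ r ∈ a.2, r ∈ outVars (F n).2.length) ∧ ∀ a ∈ gateSeq (outTrace (F n)), a.1 ∈ G := fun n => by
    obtain ⟨m, Q, h⟩ := hM (List.replicate n false)
    obtain ⟨k', hk⟩ := hev n
    obtain ⟨rfl, hfit, -⟩ := h.eq_circuitOp hwf List.length_replicate hk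
    refine ⟨hfit, fun a ha => ?_⟩
    obtain ⟨c, hc, e⟩ := List.mem_map.1 (mem_gateSeq.1 ha)
    cases c with
    | inl c => simp [Label.map] at e
    | inr c =>
      cases e
      exact (hk.ev.gatesIn (symRun_gatesIn hMG n)).2 c.1 c.2 hc
  -- The gates fit, so `circuit` does not fall back to the empty circuit.
  have hK : ∀ n, circuit E (Encodable.encode (gateSeq (outTrace (F n)))) =
      gateSeq (outTrace (F n)) := fun n => by
    rw [circuit, Denumerable.ofNat_encode, if_pos]
    exact fun a ha => ⟨((hcirc n).1 a ha).1, ((hcirc n).1 a ha).2.1⟩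
  -- The second function follows an output variable back to the symbolic bit from which it was
  -- created.
  refine ⟨fun n => (F n).2.length,
    fun n i => min (bitIdx n (src (outTrace (F n)) i)) (n + 1),
    fun n => Encodable.encode (gateSeq (outTrace (F n))),
    ⟨{U | ∃ i ∈ G, E.op i = U}, hG.image E.op, ?_, ?_, ?_, ?_, ?_, ?_⟩, fun cs m Q h => ?_⟩
  · rintro _ ⟨i, -, rfl⟩
    exact E.range_op.subset ⟨i, rfl⟩
  · exact Computable.list_length.comp (Computable.snd.comp hF)
  · have h₁ : Computable fun p : ℕ × ℕ => src (outTrace (F p.1)) p.2 :=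
      primrec_src.to_comp.comp (hτ.comp Computable.fst) Computable.snd
    exact Primrec.nat_min.to_comp.comp (primrec_bitIdx.to_comp.comp Computable.fst h₁)
      (Computable.succ.comp Computable.fst)
  · exact Computable.encode.comp (primrec_gateSeq.to_comp.comp hτ)
  · exact fun n i _ _ => min_le_right _ _
  · intro n
    rw [hK]
    exact ⟨fun a ha => ⟨((hcirc n).1 a ha).1, ((hcirc n).1 a ha).2.1⟩,
      fun a ha => ⟨⟨a.1, (hcirc n).2 a ha, rfl⟩, ((hcirc n).1 a ha).2.2⟩⟩
  · obtain ⟨k', hk⟩ := hev cs.length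
    obtain ⟨rfl, -, hQ⟩ := h.eq_circuitOp hwf rfl hk
    refine ⟨rfl, ?_⟩
    rw [hK]
    exact hQ
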